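/- Let $\mathbb{P}=\{2^0,2^1,2^2,\dots\}$. A cyclic $d$-dimensional cocycle of period $n$ consists of a set $X$ with $n\ge 1$ elements, a cyclic permutation $T$ of $X$ (with a single cycle, of length $n$), for each $x\in X$ a $d$-dimensional real inner product space $E(x)$, and for each $x$ an invertible linear map $A(x):E(x)\to E(Tx)$. Write $A^\ell(x)=A(T^{\ell-1}x)\cdots A(x)$ and $\mathfrak{m}(B)=\inf_{\|v\|=1}\|Bv\|$. The cocycle is bounded by $K$ if $K^{-1}\le\mathfrak{m}(A(x))\le\|A(x)\|\le K$ for every $x$. It admits an $\ell$-dominated splitting if there are invariant subbundles $F$, $G$ with nonzero fibres of constant dimension such that $E(x)=F(x)\oplus G(x)$ and $\|A^\ell(x)|_{F(x)}\|\,/\,\mathfrak{m}(A^\ell(x)|_{G(x)})<\tfrac12$ for every $x$. Its Lyapunov exponents $\lambda_1\le\dots\le\lambda_d$ are the numbers $\frac1n\log|z|$, where $z$ runs over the complex eigenvalues of $A^n(x)$ with multiplicity (they do not depend on $x$), and its Lyapunov graph is $\sigma(A)=(\sigma_0(A),\dots,\sigma_d(A))$ with $\sigma_i(A)=\lambda_1+\dots+\lambda_i$.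 Let $\mathcal{S}_d$ be the set of convex graphs, that is, of $(\sigma_0,\dots,\sigma_d)\in\mathbb{R}^{d+1}$ with $\sigma_0=0$ and $\sigma_i-\sigma_{i-1}\le\sigma_{i+1}-\sigma_i$ for $0<i<d$; graphs are ordered coordinatewise. Theorem. For any $d\ge2$, $K>1$, $\varepsilon>0$ there exists $L\in\mathbb{P}$ such that the following holds. Let $(X,T,E,A)$ be a cyclic $d$-dimensional cocycle bounded by $K$, of period at least $L$, that admits no $L$-dominated splitting. Let $\sigma\in\mathcal{S}_d$ satisfy $\sigma\ge\sigma(A)$ and $\sigma_d=\sigma_d(A)$. Then there exists a path of cocycles $A_t$, $t\in[0,1]$, on $E$ over $T$, with $A_t(x)$ depending continuously on $t$ for each $x$, such that $A_0=A$; $\|A_t(x)-A(x)\|<\varepsilon$ for all $t$ and $x$; the path of graphs $\sigma(A_t)$ is continuous and non-decreasing (that is, $\sigma(A_t)\ge\sigma(A_{t'})$ whenever $t>t'$); and $\sigma(A_1)=\sigma$. -/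

import Mathlib

/-- The minimum expansion factor `inf_{‖v‖ = 1} ‖B v‖` of a linear map. -/
noncomputable def minExpansion {V W : Type*} [NormedAddCommGroup V] [NormedSpace ℝ V]
    [NormedAddCommGroup W] [NormedSpace ℝ W] (B : V →L[ℝ] W) : ℝ :=
  ⨅ v : Metric.sphere (0 : V) 1, ‖B v‖

/-- The set `{2^0, 2^1, 2^2, …}`. -/
def powersOfTwo : Set ℕ := {l | ∃ k : ℕ, l = 2 ^ k}

namespace CyclicCocycle

section Basic

variable {X : Type*} {E : X → Type*} [∀ x, NormedAddCommGroup (E x)]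
  [∀ x, InnerProductSpace ℝ (E x)]

/-- `T` is a cyclic permutation of the whole of `X` (when `X` is a singleton, `T` is the
identity). -/
def IsCyclic {X : Type*} (T : Equiv.Perm X) : Prop := T.IsCycleOn Set.univ

/-- A linear cocycle over the permutation `T` of the discrete space `X`, on the bundle with
Euclidean fibres `E x`: a family of invertible linear maps `A x : E x → E (T x)`. -/
abbrev Cocycle (T : Equiv.Perm X) (E : X → Type*) [∀ x, NormedAddCommGroup (E x)]
    [∀ x, InnerProductSpace ℝ (E x)] :=
  ∀ x, E x ≃L[ℝ] E (T x)

variable {T : Equiv.Perm X}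

/-- The fibre map of the iterate, `A^n(x) = A(T^{n-1} x) ⋯ A(T x) A(x) : E x → E (T^n x)`. -/
noncomputable def iter (A : Cocycle T E) : (n : ℕ) → (x : X) → E x ≃L[ℝ] E (T^[n] x)
  | 0, x => ContinuousLinearEquiv.refl ℝ (E x)
  | n + 1, x => (A x).trans (iter A n (T x))

/-- `A` is bounded by `K`. -/
def IsBoundedBy (A : Cocycle T E) (K : ℝ) : Prop :=
  ∀ x, K⁻¹ ≤ minExpansion (A x : E x →L[ℝ] E (T x)) ∧
    minExpansion (A x : E x →L[ℝ] E (T x)) ≤ ‖(A x : E x →L[ℝ] E (T x))‖ ∧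
    ‖(A x : E x →L[ℝ] E (T x))‖ ≤ K

/-- `B` is an `ε`-perturbation of `A`. -/
def IsPerturbation (A B : Cocycle T E) (ε : ℝ) : Prop :=
  ∀ x, ‖(B x : E x →L[ℝ] E (T x)) - (A x : E x →L[ℝ] E (T x))‖ < ε

/-- A path of cocycles `A_t`, `t ∈ [0,1]`: a family for which `A_t(x)` depends continuously
on `t` for each point `x` of the discrete space `X`. -/
def IsPath (P : unitInterval → Cocycle T E) : Prop :=
  ∀ x, Continuous fun t => (P t x : E x →L[ℝ] E (T x))

/-- A path is `ε`-short if each of its members is an `ε`-perturbation of the initial one. -/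
def IsShort (P : unitInterval → Cocycle T E) (ε : ℝ) : Prop :=
  ∀ t, IsPerturbation (P 0) (P t) ε

/-- `F` is a nonzero invariant subbundle, with fibres of constant dimension. -/
structure IsInvariantSubbundle (A : Cocycle T E) (F : ∀ x, Submodule ℝ (E x)) : Prop where
  ne_bot : ∀ x, F x ≠ ⊥
  finrank_eq : ∀ x y, Module.finrank ℝ (F x) = Module.finrank ℝ (F y)
  map_eq : ∀ x, (F x).map ((A x : E x →L[ℝ] E (T x)) : E x →ₗ[ℝ] E (T x)) = F (T x)

/-- `F` is `l`-dominated by `G`. -/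
def IsDominatedBy (A : Cocycle T E) (l : ℕ) (F G : ∀ x, Submodule ℝ (E x)) : Prop :=
  ∀ x, ‖(iter A l x : E x →L[ℝ] E (T^[l] x)).comp (F x).subtypeL‖ /
      minExpansion ((iter A l x : E x →L[ℝ] E (T^[l] x)).comp (G x).subtypeL) < 1 / 2

/-- `A` admits an `l`-dominated splitting. -/
def HasDominatedSplitting (A : Cocycle T E) (l : ℕ) : Prop :=
  ∃ F G : ∀ x, Submodule ℝ (E x), IsInvariantSubbundle A F ∧ IsInvariantSubbundle A G ∧
    (∀ x, IsCompl (F x) (G x)) ∧ IsDominatedBy A l F G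

/-- The identification of fibres over equal base points. -/
def fibreCast {x y : X} (h : x = y) : E x ≃ₗ[ℝ] E y :=
  LinearEquiv.cast (M := E) h

theorem iterate_card [Finite X] (hT : IsCyclic T) (x : X) : T^[Nat.card X] x = x := by
  classical
  have := Fintype.ofFinite X
  have h : T.IsCycleOn ((Finset.univ : Finset X) : Set X) := by
    simpa using (show T.IsCycleOn Set.univ from hT)
  have := h.pow_card_apply (Finset.mem_univ x)
  rw [Finset.card_univ, Equiv.Perm.coe_pow] at this
  rwa [Nat.card_eq_fintype_card]

/-- The first-return map `A^n(x) : E x → E x`, where `n = #X` is the period. -/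
noncomputable def returnMap [Finite X] (hT : IsCyclic T) (A : Cocycle T E) (x : X) :
    E x ≃ₗ[ℝ] E x :=
  (iter A (Nat.card X) x).toLinearEquiv.trans (fibreCast (iterate_card hT x))

/-- The eigenvalues of a cyclic cocycle, computed at the point `x`: the complex roots of the
characteristic polynomial of `A^n(x)`, with multiplicity. -/
noncomputable def eigenvalues [Finite X] [∀ x, FiniteDimensional ℝ (E x)]
    (hT : IsCyclic T) (A : Cocycle T E) (x : X) : Multiset ℂ :=
  ((returnMap hT A x : E x →ₗ[ℝ] E x).charpoly.map (algebraMap ℝ ℂ)).roots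

/-- The Lyapunov exponents, repeated according to multiplicity and listed in non-decreasing
order. -/
noncomputable def lyapunovExponents [Finite X] [∀ x, FiniteDimensional ℝ (E x)]
    (hT : IsCyclic T) (A : Cocycle T E) (x : X) : List ℝ :=
  ((eigenvalues hT A x).map fun z => Real.log ‖z‖ / (Nat.card X : ℝ)).sort (· ≤ ·)

theorem iter_comm (A : Cocycle T E) (n : ℕ) (x : X) (v : E x) :
    iter A n (T x) (A x v) =
      fibreCast (Function.iterate_succ_apply' T n x).symm (A (T^[n] x) (iter A n x v)) := by
  induction n generalizing x with
  | zero => rfl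
  | succ n ih => exact ih (T x) (A x v)

theorem cocycle_fibreCast (A : Cocycle T E) {x y : X} (h : x = y) (v : E x) :
    A y (fibreCast h v) = fibreCast (congrArg T h) (A x v) := by
  subst h; rfl

theorem fibreCast_trans {x y z : X} (h : x = y) (h' : y = z) (v : E x) :
    fibreCast h' (fibreCast h v) = fibreCast (h.trans h') v := by
  subst h; subst h'; rfl

theorem returnMap_comm [Finite X] (hT : IsCyclic T) (A : Cocycle T E) (x : X) (v : E x) :
    returnMap hT A (T x) (A x v) = A x (returnMap hT A x v) := by
  change fibreCast (iterate_card hT (T x)) (iter A _ (T x) (A x v)) =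
    A x (fibreCast (iterate_card hT x) (iter A _ x v))
  rw [iter_comm, cocycle_fibreCast]
  exact fibreCast_trans _ _ _

/-- The eigenvalues do not depend on the base point. -/
theorem eigenvalues_eq [Finite X] [∀ x, FiniteDimensional ℝ (E x)]
    (hT : IsCyclic T) (A : Cocycle T E) (x y : X) :
    eigenvalues hT A x = eigenvalues hT A y := by
  have step : ∀ x, eigenvalues hT A (T x) = eigenvalues hT A x := by
    intro x
    have h : (returnMap hT A (T x) : E (T x) →ₗ[ℝ] E (T x)) =
        (A x).toLinearEquiv.conj (returnMap hT A x : E x →ₗ[ℝ] E x) := by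
      ext w
      obtain ⟨v, rfl⟩ := (A x).surjective w
      simp [LinearEquiv.conj_apply, returnMap_comm]
    unfold eigenvalues
    rw [h, LinearEquiv.charpoly_conj]
  have := Fintype.ofFinite X
  obtain ⟨k, -, hk⟩ := (show T.IsCycleOn ((Finset.univ : Finset X) : Set X) by
    simpa using (show T.IsCycleOn Set.univ from hT)).exists_pow_eq (Finset.mem_univ x) (Finset.mem_univ y)
  rw [← hk]
  clear hk
  induction k with
  | zero => rfl
  | succ k ih => rw [ih, pow_succ', Equiv.Perm.mul_apply, step]

/-- The Lyapunov graph `(σ_0(A), …, σ_d(A))` of a cyclic cocycle of dimension `d`, where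
`σ_i(A)` is the sum of the `i` smallest Lyapunov exponents. -/
noncomputable def lyapunovGraph [Finite X] [Nonempty X] [∀ x, FiniteDimensional ℝ (E x)]
    (d : ℕ) (hT : IsCyclic T) (A : Cocycle T E) : Fin (d + 1) → ℝ :=
  fun i => ((lyapunovExponents hT A (Classical.arbitrary X)).take i).sum

theorem lyapunovGraph_eq [Finite X] [Nonempty X] [∀ x, FiniteDimensional ℝ (E x)]
    (d : ℕ) (hT : IsCyclic T) (A : Cocycle T E) (x : X) (i : Fin (d + 1)) :
    lyapunovGraph d hT A i = ((lyapunovExponents hT A x).take i).sum := by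
  unfold lyapunovGraph lyapunovExponents
  rw [eigenvalues_eq hT A _ x]

end Basic

/-- The set `S_d` of convex graphs `(σ_0, …, σ_d)` with `σ_0 = 0`. -/
def convexGraphs (d : ℕ) : Set (Fin (d + 1) → ℝ) :=
  {σ | σ 0 = 0 ∧ ∀ i j k : Fin (d + 1), (j : ℕ) = i + 1 → (k : ℕ) = j + 1 →
    σ j - σ i ≤ σ k - σ j}

/-- A continuous non-decreasing path of graphs. -/
def IsNondecreasingPath {d : ℕ} (γ : unitInterval → Fin (d + 1) → ℝ) : Prop :=
  Continuous γ ∧ Monotone γ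

end CyclicCocycle

open CyclicCocycle

/-! Orthonormal bases identify all fibres with one Euclidean space, so the work is done for maps `X
→ V →L[ℝ] V`. The graph is raised by repeated mixing. When two consecutive exponents have a gap, a
small perturbation brings them together, keeping their sum and the other exponents. This raises
exactly one `σ_k` and keeps the graph convex.

Mixing is possible for the following reasons. (1) If two eigenvectors of the return map are almost
parallel at one site, a perturbation at that site, of the size of the angle, changes the trace on
their plane and not the determinant (`mixable_of_close`). (2) If an eigenline `w` does not dominate
an eigenline `u` over `ℓ` steps, then boosting `u` slightly along these steps and tilting `w`
slightly towards `u` at the start makes them almost parallel at the end, without changing the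
spectrum (`exists_close_of_not_dominated`). (3) These lines need not belong to the two eigenvalues
next to the gap. A shear along the line of an intermediate eigenvalue turns the closeness of the
outer lines into closeness with the intermediate one, modulo an outer line (`exists_close_modulo`).
Perturbations of a quotient cocycle lift without growing, so the mixing may be done in the quotient.
(4) Domination between sums of eigenspaces follows from domination between lines in successive
quotients (`ExpDom.extend_left`, `ExpDom.extend_right`). So if the spectral splitting at the gap is
not dominated with uniform constants, some pair of lines in some quotient is not, and (2) and (3)
apply to it (`exists_mergeable_of_not_expDom`). (5) Dominated splittings persist under perturbation
(`exists_splits_of_near`). If the gap of a cocycle close to `A` were dominated with uniform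
constants, `A` would have an `N`-dominated splitting for every large `N`. Hence (4) applies at every
moment of the construction.

The whole path consists of three pieces. The spectrum is first made real with unchanged moduli
(`exists_path_to_real_spectrum`): a complex pair is brought to the real axis by small rotations
spread over the long period or, if its planes are badly distorted somewhere, by one shear. Then come
mixings of a fixed size `η`, whose number is bounded in terms of `d`, `K`, `η`. Once no useful gap
of size `2η` is left, a discrete maximum principle (`le_of_almost_convex`) shows that the graph is
within `O(η)` of the target, and a triangular rescaling of the eigenvalues ends the path. The number
of mixings is fixed before their tolerances, so that all of them stay close to `A`. -/

set_option linter.unusedSectionVars false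

section

open Polynomial CyclicCocycle

namespace FibreCocycle

/-! ### Cocycles with constant fibre: iterates, two-sided bounds, products along orbits -/

section Iterates

variable {X : Type*} {V : Type*} [NormedAddCommGroup V] [InnerProductSpace ℝ V]

/-- The iterates of a cocycle with constant fibre. -/
noncomputable def cp (T : Equiv.Perm X) (A : X → V →L[ℝ] V) : ℕ → X → V →L[ℝ] V
  | 0, _ => 1
  | n + 1, x => cp T A n (T x) * A x

variable {T : Equiv.Perm X} {A B : X → V →L[ℝ] V}

theorem cp_succ_apply (n : ℕ) (x : X) (v : V) : cp T A (n + 1) x v = cp T A n (T x) (A x v) := rfl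

theorem cp_add (m n : ℕ) (x : X) : cp T A (m + n) x = cp T A m (T^[n] x) * cp T A n x := by
  induction n generalizing x with
  | zero => simp [cp]
  | succ n ih =>
    have : cp T A (m + (n + 1)) x = cp T A (m + n) (T x) * A x := rfl
    rw [this, ih, mul_assoc]
    rfl

theorem cp_one (x : X) : cp T A 1 x = A x := by simp [cp]

theorem cp_succ' (n : ℕ) (x : X) : cp T A (n + 1) x = A (T^[n] x) * cp T A n x := by
  rw [add_comm, cp_add, cp_one]

theorem cp_succ_apply' (n : ℕ) (x : X) (v : V) :
    cp T A (n + 1) x v = A (T^[n] x) (cp T A n x v) := by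
  rw [cp_succ']; rfl

theorem cp_add_apply (m n : ℕ) (x : X) (v : V) :
    cp T A (m + n) x v = cp T A m (T^[n] x) (cp T A n x v) := by
  rw [cp_add]; rfl

theorem cp_congr {n : ℕ} {x : X} (h : ∀ j < n, A (T^[j] x) = B (T^[j] x)) :
    cp T A n x = cp T B n x := by
  induction n with
  | zero => rfl
  | succ n ih => rw [cp_succ', cp_succ', ih fun j hj => h j (by omega), h n (by omega)]

/-- Two-sided boundedness of a cocycle. -/
def Bdd (A : X → V →L[ℝ] V) (K : ℝ) : Prop :=
  ∀ x v, ‖A x v‖ ≤ K * ‖v‖ ∧ ‖v‖ ≤ K * ‖A x v‖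

theorem Bdd.mono {K K' : ℝ} (h : Bdd A K) (hK : K ≤ K') : Bdd A K' := fun x v =>
  ⟨(h x v).1.trans (by gcongr), (h x v).2.trans (by gcongr)⟩

theorem Bdd.norm_le {K : ℝ} (h : Bdd A K) (hK : 0 ≤ K) (x : X) : ‖A x‖ ≤ K :=
  ContinuousLinearMap.opNorm_le_bound _ hK fun v => (h x v).1

theorem Bdd.cp {K : ℝ} (h : Bdd A K) (hK : 0 ≤ K) (N : ℕ) (x : X) (v : V) :
    ‖cp T A N x v‖ ≤ K ^ N * ‖v‖ ∧ ‖v‖ ≤ K ^ N * ‖cp T A N x v‖ := by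
  induction N generalizing x v with
  | zero => simp [FibreCocycle.cp]
  | succ N ih =>
    rw [cp_succ_apply]
    constructor
    · refine (ih _ _).1.trans ?_
      rw [pow_succ, mul_assoc]
      exact mul_le_mul_of_nonneg_left (h x v).1 (by positivity)
    · refine (h x v).2.trans ?_
      rw [pow_succ', mul_assoc]
      exact mul_le_mul_of_nonneg_left (ih _ _).2 hK

theorem Bdd.ne_zero {K : ℝ} (h : Bdd A K) (x : X) {v : V} (hv : v ≠ 0) : A x v ≠ 0 := by
  intro h0
  have := (h x v).2
  rw [h0, norm_zero, mul_zero] at this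
  exact hv (norm_le_zero_iff.1 this)

theorem Bdd.injective {K : ℝ} (h : Bdd A K) (x : X) : Function.Injective (A x) := by
  rw [injective_iff_map_eq_zero]
  intro v hv
  by_contra h0
  exact h.ne_zero x h0 hv

theorem Bdd.near {K K' e : ℝ} (h : Bdd A K) (hK : 0 < K) (hB : ∀ x, ‖B x - A x‖ ≤ e)
    (h1 : K + e ≤ K') (h2 : K ≤ K' * (1 - K * e)) (he : K * e < 1): Bdd B K' := by
  intro x v
  have h3 : ‖B x v - A x v‖ ≤ e * ‖v‖ := by
    have := (B x - A x).le_opNorm v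
    exact this.trans (mul_le_mul_of_nonneg_right (hB x) (norm_nonneg v))
  obtain ⟨h4, h5⟩ := h x v
  have he0 : 0 ≤ e := (norm_nonneg _).trans (hB x)
  constructor
  · have := norm_le_norm_add_norm_sub' (B x v) (A x v)
    nlinarith [norm_nonneg v]
  · have h6 := norm_le_norm_add_norm_sub' (A x v) (B x v)
    rw [norm_sub_rev] at h6
    have h7 : ‖v‖ * (1 - K * e) ≤ K * ‖B x v‖ := by nlinarith [norm_nonneg v]
    have h8 : K * ‖B x v‖ ≤ K' * (1 - K * e) * ‖B x v‖ := by gcongr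
    have h9 : 0 < 1 - K * e := by linarith
    have : ‖v‖ * (1 - K * e) ≤ (K' * ‖B x v‖) * (1 - K * e) := by linarith
    exact le_of_mul_le_mul_right this h9

/-- Products of a scalar cocycle along an orbit. -/
noncomputable def pp (T : Equiv.Perm X) (p : X → ℝ) (N : ℕ) (x : X) : ℝ :=
  ∏ j ∈ Finset.range N, p (T^[j] x)

theorem pp_zero (p : X → ℝ) (x : X) : pp T p 0 x = 1 := by simp [pp]

theorem pp_succ (p : X → ℝ) (N : ℕ) (x : X) : pp T p (N + 1) x = pp T p N x * p (T^[N] x) := by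
  simp [pp, Finset.prod_range_succ]

theorem pp_add (p : X → ℝ) (m N : ℕ) (x : X) :
    pp T p (m + N) x = pp T p m x * pp T p N (T^[m] x) := by
  simp only [pp, Finset.prod_range_add]
  congr 1
  refine Finset.prod_congr rfl fun j _ => ?_
  rw [add_comm, Function.iterate_add_apply]

end Iterates

/-! ### Sites of a cycle as iterates of a point -/

section Cyclic

variable {X : Type*} [Fintype X] {T : Equiv.Perm X}

theorem iter_card (hT : IsCyclic T) (x : X) : T^[Fintype.card X] x = x := by
  rw [← Nat.card_eq_fintype_card]; exact iterate_card hT x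

theorem isCycleOn_finset (hT : IsCyclic T) :
    T.IsCycleOn ((Finset.univ : Finset X) : Set X) := by
  simpa using (show T.IsCycleOn Set.univ from hT)

theorem exists_iter_eq (hT : IsCyclic T) (x y : X) : ∃ k < Fintype.card X, T^[k] x = y := by
  obtain ⟨k, hk, h⟩ := (isCycleOn_finset hT).exists_pow_eq (Finset.mem_univ x) (Finset.mem_univ y)
  exact ⟨k, by simpa using hk, by rw [← h, ← Equiv.Perm.coe_pow]⟩

theorem iter_surj (hT : IsCyclic T) (x : X) :
    Function.Bijective (fun k : Fin (Fintype.card X) => T^[(k : ℕ)] x) := by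
  rw [Fintype.bijective_iff_surjective_and_card]
  refine ⟨fun y => ?_, by simp⟩
  obtain ⟨k, hk, h⟩ := exists_iter_eq hT x y
  exact ⟨⟨k, hk⟩, h⟩

theorem iter_inj (hT : IsCyclic T) {x : X} {i j : ℕ} (hi : i < Fintype.card X)
    (hj : j < Fintype.card X) (h : T^[i] x = T^[j] x) : i = j := by
  have := (iter_surj hT x).1 (a₁ := ⟨i, hi⟩) (a₂ := ⟨j, hj⟩) h
  simpa using this

theorem prod_iter {M : Type*} [CommMonoid M] (hT : IsCyclic T) (f : X → M) (x : X) :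
    ∏ j ∈ Finset.range (Fintype.card X), f (T^[j] x) = ∏ y, f y := by
  rw [Finset.prod_range]
  exact (iter_surj hT x).prod_comp f

theorem pp_card (hT : IsCyclic T) (p : X → ℝ) (x : X) :
    pp T p (Fintype.card X) x = ∏ y, p y := prod_iter hT p x

/-- Induction along the cycle. -/
theorem cyclic_induction (hT : IsCyclic T) {P : X → Prop} (x : X) (h0 : P x)
    (h : ∀ y, P y → P (T y)) (y : X) : P y := by
  obtain ⟨k, -, rfl⟩ := exists_iter_eq hT x y
  induction k with
  | zero => exact h0
  | succ k ih => rw [Function.iterate_succ_apply']; exact h _ ih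

end Cyclic

/-! ### Return map, characteristic polynomial, fields of eigenlines -/

section Spectrum

variable {X : Type*} [Fintype X] {T : Equiv.Perm X}
variable {V : Type*} [NormedAddCommGroup V] [InnerProductSpace ℝ V]
  {A B : X → V →L[ℝ] V} {K : ℝ}

/-- The return map. -/
noncomputable def ret (T : Equiv.Perm X) (A : X → V →L[ℝ] V) (x : X) : Module.End ℝ V :=
  (cp T A (Fintype.card X) x : V →ₗ[ℝ] V)

theorem ret_apply (x : X) (v : V) : ret T A x v = cp T A (Fintype.card X) x v := rfl

theorem ret_comm (hT : IsCyclic T) (x : X) (v : V) :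
    ret T A (T x) (A x v) = A x (ret T A x v) := by
  rw [ret_apply, ret_apply, ← cp_succ_apply, cp_succ_apply', iter_card hT]

theorem aeval_ret_comm (hT : IsCyclic T) (q : ℝ[X]) (x : X) (v : V) :
    aeval (ret T A (T x)) q (A x v) = A x (aeval (ret T A x) q v) := by
  have key : ∀ n : ℕ, ∀ v, (ret T A (T x) ^ n) (A x v) = A x ((ret T A x ^ n) v) := by
    intro n
    induction n with
    | zero => intro v; rfl
    | succ n ih => intro v; rw [pow_succ, pow_succ, Module.End.mul_apply, Module.End.mul_apply,
        ret_comm hT, ih]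
  induction q using Polynomial.induction_on' with
  | add p q hp hq => simp [hp, hq]
  | monomial n a => simp [aeval_monomial, key, Module.algebraMap_end_apply]

variable [FiniteDimensional ℝ V]

/-- The characteristic polynomial of the return map at `x`. -/
noncomputable def chi (T : Equiv.Perm X) (A : X → V →L[ℝ] V) (x : X) : ℝ[X] :=
  (ret T A x).charpoly

theorem chi_eq (hT : IsCyclic T) (hA : Bdd A K) (x y : X) : chi T A y = chi T A x := by
  refine cyclic_induction hT (P := fun y => chi T A y = chi T A x) x rfl (fun y hy => ?_) y
  rw [← hy]
  let e : V ≃ₗ[ℝ] V := LinearEquiv.ofInjectiveEndo (A y : V →ₗ[ℝ] V) (hA.injective y)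
  have he : ∀ v, e v = A y v := fun v => rfl
  have : ret T A (T y) = e.conj (ret T A y) := by
    ext w
    obtain ⟨v, rfl⟩ := e.surjective w
    rw [LinearEquiv.conj_apply_apply, e.symm_apply_apply, he, he, ret_comm hT]
  unfold chi
  rw [this, LinearEquiv.charpoly_conj]

/-- A field of unit eigenvectors of a cocycle. -/
structure IsEig (T : Equiv.Perm X) (A : X → V →L[ℝ] V) (u : X → V) (p : X → ℝ) (μ : ℝ) :
    Prop where
  unit : ∀ x, ‖u x‖ = 1
  map : ∀ x, A x (u x) = p x • u (T x)
  prod : ∏ x, p x = μ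

theorem IsEig.cp {u : X → V} {p : X → ℝ} {μ : ℝ} (h : IsEig T A u p μ) (N : ℕ) (x : X) :
    cp T A N x (u x) = pp T p N x • u (T^[N] x) := by
  induction N with
  | zero => simp [FibreCocycle.cp, pp_zero]
  | succ N ih =>
    rw [cp_succ_apply', ih, map_smul, h.map, smul_smul, pp_succ, Function.iterate_succ_apply']

theorem IsEig.ne_zero {u : X → V} {p : X → ℝ} {μ : ℝ} (h : IsEig T A u p μ) (x : X) :
    u x ≠ 0 := by
  intro h0; have := h.unit x; simp [h0] at this

theorem IsEig.ret {u : X → V} {p : X → ℝ} {μ : ℝ} (h : IsEig T A u p μ) (hT : IsCyclic T) (x : X) :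
    ret T A x (u x) = μ • u x := by
  rw [ret_apply, h.cp, pp_card hT, h.prod, iter_card hT]

theorem IsEig.abs_eq {u : X → V} {p : X → ℝ} {μ : ℝ} (h : IsEig T A u p μ) (x : X) :
    |p x| = ‖A x (u x)‖ := by
  rw [h.map, norm_smul, h.unit, mul_one, Real.norm_eq_abs]

theorem IsEig.abs_pp_eq {u : X → V} {p : X → ℝ} {μ : ℝ} (h : IsEig T A u p μ) (N : ℕ) (x : X) :
    |pp T p N x| = ‖FibreCocycle.cp T A N x (u x)‖ := by
  rw [h.cp, norm_smul, h.unit, mul_one, Real.norm_eq_abs]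

theorem IsEig.neg {u : X → V} {p : X → ℝ} {μ : ℝ} (h : IsEig T A u p μ) :
    IsEig T A (fun x => - u x) p μ :=
  ⟨fun x => by rw [norm_neg, h.unit], fun x => by rw [map_neg, h.map, smul_neg], h.prod⟩

theorem IsEig.bounds {u : X → V} {p : X → ℝ} {μ : ℝ} (h : IsEig T A u p μ) (hA : Bdd A K) (x : X) :
    |p x| ≤ K ∧ 1 ≤ K * |p x| := by
  have := hA x (u x)
  rwa [h.unit, ← h.abs_eq, mul_one] at this

theorem IsEig.pp_ne {u : X → V} {p : X → ℝ} {μ : ℝ} (h : IsEig T A u p μ) (hA : Bdd A K)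
    (N : ℕ) (x : X) : pp T p N x ≠ 0 := by
  refine Finset.prod_ne_zero_iff.2 fun j _ h0 => ?_
  have := (h.bounds hA (T^[j] x)).2
  rw [h0, abs_zero, mul_zero] at this
  linarith

/-- The eigenvector is pushed once around the cycle and normalised. Before normalisation every
multiplier is `1`, except at the site preceding `y`, where closing the cycle yields `μ`. The
normalising factors telescope in the product. -/
theorem exists_isEig_of_eigenvector (hT : IsCyclic T) (hA : Bdd A K) {y : X} {v : V} {μ : ℝ}
    (hv : v ≠ 0) (h : ret T A y v = μ • v) :
    ∃ u p, IsEig T A u p μ ∧ u y = ‖v‖⁻¹ • v := by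
  classical
  choose k hk hky using exists_iter_eq hT y
  have hinj : ∀ N x, ∀ w : V, w ≠ 0 → cp T A N x w ≠ 0 := by
    intro N
    induction N with
    | zero => intro x w hw; exact hw
    | succ N ih => intro x w hw; rw [cp_succ_apply]; exact ih _ _ (hA.ne_zero x hw)
  let z : X → V := fun x => cp T A (k x) y v
  have hz : ∀ x, z x ≠ 0 := fun x => hinj _ _ _ hv
  have hmap : ∀ x, ∃ c : ℝ, A x (z x) = c • z (T x) := by
    intro x
    have h1 : A x (z x) = cp T A (k x + 1) y v := by rw [cp_succ_apply', hky]
    have h2 : T^[k x + 1] y = T x := by rw [Function.iterate_succ_apply', hky]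
    rcases (Nat.succ_le_of_lt (hk x)).lt_or_eq with h3 | h3
    · refine ⟨1, ?_⟩
      have : k (T x) = k x + 1 := iter_inj hT (hk _) h3 (by rw [hky, h2])
      rw [h1, one_smul]
      simp only [z, this]
    · refine ⟨μ, ?_⟩
      have h4 : k x + 1 = Fintype.card X := h3
      have h5 : T x = y := by rw [← h2, h4, iter_card hT]
      have h6 : k y = 0 := iter_inj hT (hk _) (by omega) (hky y)
      rw [h1, h4, h5, ← ret_apply, h]
      simp only [z, h6]
      rfl
  choose c hc using hmap
  have hky0 : k y = 0 :=
    iter_inj hT (hk _) (Fintype.card_pos_iff.2 ⟨y⟩) (hky y)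
  let u : X → V := fun x => ‖z x‖⁻¹ • z x
  let p : X → ℝ := fun x => ‖z x‖⁻¹ * c x * ‖z (T x)‖
  have hu : ∀ x, ‖u x‖ = 1 := fun x => norm_smul_inv_norm (𝕜 := ℝ) (hz x)
  have hp : ∀ x, A x (u x) = p x • u (T x) := by
    intro x
    have := norm_ne_zero_iff.2 (hz (T x))
    simp only [u, p, map_smul, hc, smul_smul]
    congr 1
    field_simp
  have huy : u y = ‖v‖⁻¹ • v := by simp only [u, z, hky0]; rfl
  have h0 : IsEig T A u p (∏ x, p x) := ⟨hu, hp, rfl⟩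
  refine ⟨u, p, ⟨hu, hp, ?_⟩, huy⟩
  have h1 := h0.ret hT y
  have h2 : ret T A y (u y) = μ • u y := by
    rw [huy, map_smul, h, smul_comm]
  rw [h2] at h1
  exact (smul_left_injective ℝ (h0.ne_zero y) h1).symm

theorem exists_isEig (hT : IsCyclic T) (hA : Bdd A K) {x : X} {μ : ℝ}
    (h : (chi T A x).IsRoot μ) : ∃ u p, IsEig T A u p μ := by
  have : (ret T A x).HasEigenvalue μ := by
    rw [Module.End.hasEigenvalue_iff_isRoot_charpoly]; exact h
  obtain ⟨v, hv⟩ := this.exists_hasEigenvector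
  obtain ⟨u, p, h, -⟩ := exists_isEig_of_eigenvector hT hA hv.2 hv.apply_eq_smul
  exact ⟨u, p, h⟩

theorem IsEig.isRoot {u : X → V} {p : X → ℝ} {μ : ℝ} (h : IsEig T A u p μ) (hT : IsCyclic T)
    (x : X) : (chi T A x).IsRoot μ := by
  have : (FibreCocycle.ret T A x).HasEigenvalue μ :=
    Module.End.hasEigenvalue_of_hasEigenvector (x := u x)
      (Module.End.hasEigenvector_iff.2 ⟨Module.End.mem_eigenspace_iff.2 (h.ret hT x), h.ne_zero x⟩)
  rw [Module.End.hasEigenvalue_iff_isRoot_charpoly] at this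
  exact this

end Spectrum

end FibreCocycle

namespace FibreCocycle

/-! ### Characteristic polynomials: rank-one perturbations, subspaces, quotients -/

section RankOne

variable {V : Type*} [AddCommGroup V] [Module ℝ V] [FiniteDimensional ℝ V]

/-- The matrix determinant lemma. If `(t - M) z = a`, then `t - M' = (t - M)(1 - φ ⊗ z)`, whose
determinant is `det (t - M) · (1 - φ z)`, with `φ z = N(t) / D(t)`. Knowing `z` for the infinitely
many `t` with `D(t) ≠ 0` is enough for a polynomial identity. -/
theorem charpoly_rankOne {M M' : Module.End ℝ V} {φ : Module.Dual ℝ V} {a : V} {D N : ℝ[X]}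
    (hM : ∀ v, M' v = M v + φ v • a) (hD : D ≠ 0)
    (h : ∀ t, D.eval t ≠ 0 → ∃ z, t • z - M z = a ∧ D.eval t * φ z = N.eval t) :
    M'.charpoly * D = M.charpoly * (D - N) := by
  refine Polynomial.eq_of_infinite_eval_eq _ _ ?_
  refine Set.Infinite.mono (s := {t | D.eval t ≠ 0}) (fun t ht => ?_) ?_
  · obtain ⟨z, hz, hN⟩ := h t ht
    have h1 : algebraMap ℝ (Module.End ℝ V) t - M' =
        (algebraMap ℝ (Module.End ℝ V) t - M) * LinearMap.transvection (-φ) z := by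
      ext v
      simp only [LinearMap.sub_apply, Module.algebraMap_end_apply, hM, Module.End.mul_apply,
        LinearMap.transvection.apply, map_add, map_smul, LinearMap.neg_apply, ← hz]
      module
    simp only [Set.mem_ofPred_eq, eval_mul, eval_sub, LinearMap.eval_charpoly, h1, map_mul,
      LinearMap.transvection.det, LinearMap.neg_apply, ← hN]
    ring
  · have : {t | D.eval t ≠ 0} = {t | D.IsRoot t}ᶜ := by ext t; simp [IsRoot]
    rw [this]
    exact (Polynomial.finite_setOfPred_isRoot hD).infinite_compl

theorem charpoly_line {M M' : Module.End ℝ V} {u : V} {φ : Module.Dual ℝ V} {μ μ' : ℝ}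
    (hu : u ≠ 0) (hM : M u = μ • u) (hM' : M' u = μ' • u) (h : ∀ v, M' v = M v + φ v • u) :
    M'.charpoly * (X - C μ) = M.charpoly * (X - C μ') := by
  have hφ : φ u = μ' - μ := by
    have := h u
    rw [hM, hM', ← add_smul] at this
    have := smul_left_injective ℝ hu this
    linarith
  have : (X - C μ : ℝ[X]) - C (μ' - μ) = X - C μ' := by rw [C_sub]; ring
  rw [← this]
  refine charpoly_rankOne h (X_sub_C_ne_zero μ) fun t ht => ?_
  have ht' : t - μ ≠ 0 := by simpa using ht
  refine ⟨(t - μ)⁻¹ • u, ?_, ?_⟩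
  · rw [map_smul, hM, smul_comm t, ← smul_sub, ← sub_smul, smul_smul, inv_mul_cancel₀ ht', one_smul]
  · simp only [eval_sub, eval_X, eval_C, map_smul, hφ, smul_eq_mul]; field_simp

/-- The perturbation multiplies `M` on the left by `1 + τ (u - w) ⊗ φ`, which is unipotent because
`φ (u - w) = 0`. So the product `μν` is kept and the trace moves by `τ (μ - ν)`. The vector required
by `charpoly_rankOne` is `u / (t - μ) - w / (t - ν)`. -/
theorem charpoly_plane {M M' : Module.End ℝ V} {u w : V} {φ : Module.Dual ℝ V} {μ ν τ : ℝ}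
    (hMu : M u = μ • u) (hMw : M w = ν • w) (hu : φ u = 1) (hw : φ w = 1)
    (h : ∀ v, M' v = M v + (τ * φ (M v)) • (u - w)) :
    M'.charpoly * ((X - C μ) * (X - C ν)) =
      M.charpoly * (X ^ 2 - C (μ + ν + τ * (μ - ν)) * X + C (μ * ν)) := by
  have e : (X ^ 2 - C (μ + ν + τ * (μ - ν)) * X + C (μ * ν) : ℝ[X]) =
      (X - C μ) * (X - C ν) - C (τ * (μ - ν)) * X := by
    simp only [C_add, C_mul, C_sub]; ring
  rw [e]
  refine charpoly_rankOne (φ := τ • (φ ∘ₗ M)) (a := u - w) (fun v => by simp [h])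
    (mul_ne_zero (X_sub_C_ne_zero μ) (X_sub_C_ne_zero ν)) fun t ht => ?_
  have ht' : t - μ ≠ 0 ∧ t - ν ≠ 0 := by simpa using ht
  obtain ⟨h1, h2⟩ := ht'
  refine ⟨(t - μ)⁻¹ • u - (t - ν)⁻¹ • w, ?_, ?_⟩
  · simp only [map_sub, map_smul, hMu, hMw]
    match_scalars <;> field_simp
    ring
  · simp [hMu, hMw, hu, hw]
    field_simp
    ring

/-- Characteristic polynomials of two operators inducing the same operator on a quotient. -/
theorem charpoly_subspace {M M' : Module.End ℝ V} {W : Submodule ℝ V}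
    (hW : ∀ w ∈ W, M w ∈ W) (hW' : ∀ w ∈ W, M' w ∈ W) (h : ∀ v, M' v - M v ∈ W) :
    M'.charpoly * (M.restrict hW).charpoly = M.charpoly * (M'.restrict hW').charpoly := by
  refine Polynomial.eq_of_infinite_eval_eq _ _ ?_
  refine Set.Infinite.mono (s := Set.univ) (fun t _ => ?_) Set.infinite_univ
  have k : ∀ N : Module.End ℝ V, (∀ w ∈ W, N w ∈ W) →
      W ≤ W.comap (algebraMap ℝ (Module.End ℝ V) t - N) := fun N hN w hw =>
    W.sub_mem (W.smul_mem t hw) (hN w hw)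
  have e : ∀ N : Module.End ℝ V, ∀ hN : ∀ w ∈ W, N w ∈ W,
      LinearMap.restrict (p := W) (q := W) (algebraMap ℝ (Module.End ℝ V) t - N) (k N hN) =
      algebraMap ℝ (Module.End ℝ W) t - N.restrict hN := by
    intro N hN; ext w; rfl
  simp only [Set.mem_ofPred_eq, eval_mul, LinearMap.eval_charpoly]
  rw [LinearMap.det_eq_det_mul_det W _ (k M hW), LinearMap.det_eq_det_mul_det W _ (k M' hW'),
    e M hW, e M' hW']
  have : W.mapQ W _ (k M hW) = W.mapQ W _ (k M' hW') := by
    ext v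
    simp only [LinearMap.comp_apply, Submodule.mkQ_apply, Submodule.mapQ_apply]
    rw [Submodule.Quotient.eq]
    simpa using h v
  rw [this]; ring

theorem charpoly_quotient_line {V' : Type*} [AddCommGroup V'] [Module ℝ V'] [FiniteDimensional ℝ V']
    {M : Module.End ℝ V} {M' : Module.End ℝ V'} {w : V} {μ : ℝ} (hw : w ≠ 0) (hM : M w = μ • w)
    (q : V →ₗ[ℝ] V') (hq : Function.Surjective q) (hker : LinearMap.ker q = ℝ ∙ w)
    (h : ∀ v, q (M v) = M' (q v)) :
    M.charpoly = (X - C μ) * M'.charpoly := by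
  refine Polynomial.eq_of_infinite_eval_eq _ _ ?_
  refine Set.Infinite.mono (s := Set.univ) (fun t _ => ?_) Set.infinite_univ
  · let S := algebraMap ℝ (Module.End ℝ V) t - M
    have hSw : S w = (t - μ) • w := by
      simp [S, hM, sub_smul]
    have k : (ℝ ∙ w) ≤ (ℝ ∙ w).comap S := by
      rw [Submodule.span_singleton_le_iff_mem, Submodule.mem_comap, hSw]
      exact Submodule.smul_mem _ _ (Submodule.mem_span_singleton_self w)
    simp only [Set.mem_ofPred_eq, eval_mul, LinearMap.eval_charpoly]
    change LinearMap.det S = _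
    rw [LinearMap.det_eq_det_mul_det _ _ k]
    have e1 : LinearMap.restrict (p := ℝ ∙ w) (q := ℝ ∙ w) S k = (t - μ) • LinearMap.id := by
      ext ⟨v, hv⟩
      obtain ⟨c, rfl⟩ := Submodule.mem_span_singleton.1 hv
      change S (c • w) = (t - μ) • c • w
      rw [map_smul, hSw, smul_comm]
    have e2 : LinearMap.det (LinearMap.restrict (p := ℝ ∙ w) (q := ℝ ∙ w) S k) = t - μ := by
      rw [e1, LinearMap.det_smul, finrank_span_singleton hw, LinearMap.det_id]; simp
    let e : (V ⧸ (ℝ ∙ w)) ≃ₗ[ℝ] V' :=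
      (Submodule.quotEquivOfEq _ _ hker.symm).trans (q.quotKerEquivOfSurjective hq)
    have he : ∀ v, e (Submodule.Quotient.mk v) = q v := fun v => rfl
    have e3 : algebraMap ℝ (Module.End ℝ V') t - M' = e.conj ((ℝ ∙ w).mapQ (ℝ ∙ w) S k) := by
      ext v'
      obtain ⟨v, rfl⟩ := hq v'
      rw [LinearEquiv.conj_apply_apply, ← he, e.symm_apply_apply, Submodule.mapQ_apply, he, he]
      simp [S, h]
    rw [e2, e3, LinearEquiv.conj_apply, LinearMap.comp_assoc, LinearMap.det_conj]
    simp

end RankOne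

section Cocycles

variable {X : Type*} [Fintype X] {T : Equiv.Perm X}
variable {V : Type*} [NormedAddCommGroup V] [InnerProductSpace ℝ V]
  {A B : X → V →L[ℝ] V} {K : ℝ}

theorem cp_sub_mem {P : X → Submodule ℝ V} (hB : ∀ x, ∀ v ∈ P x, B x v ∈ P (T x))
    (h : ∀ x v, B x v - A x v ∈ P (T x)) (N : ℕ) (x : X) (v : V) :
    cp T B N x v - cp T A N x v ∈ P (T^[N] x) := by
  induction N with
  | zero => simp [cp]
  | succ N ih =>
    rw [cp_succ_apply', cp_succ_apply', Function.iterate_succ_apply']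
    have := (P _).add_mem (hB _ _ ih) (h (T^[N] x) (cp T A N x v))
    rw [map_sub] at this
    simpa using this

/-- The base point is `T x₀` so that `x₀` is the last site of the turn: a change at `x₀` then acts
once, on the left of the return map. -/
theorem ret_update (hT : IsCyclic T) {x₀ : X} (hB : ∀ x, x ≠ x₀ → B x = A x)
    {R : V →L[ℝ] V} (hR : ∀ v, B x₀ v = R (A x₀ v)) (v : V) :
    ret T B (T x₀) v = R (ret T A (T x₀) v) := by
  obtain ⟨m, hm⟩ : ∃ m, Fintype.card X = m + 1 :=
    Nat.exists_eq_add_one_of_ne_zero (Fintype.card_pos_iff.2 ⟨x₀⟩).ne'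
  have h0 : T^[m] (T x₀) = x₀ := by
    rw [← Function.iterate_succ_apply, Nat.succ_eq_add_one, ← hm, iter_card hT]
  rw [ret_apply, ret_apply, hm, cp_succ_apply', cp_succ_apply', h0, hR]
  congr 3
  refine cp_congr fun j hj => hB _ fun h => ?_
  have := iter_inj hT (x := T x₀) (i := j) (j := m) (by omega) (by omega) (by rw [h, h0])
  omega

variable [FiniteDimensional ℝ V]

/-- Both return maps induce the same map modulo the common invariant line, so only the factor of
this line can differ. -/
theorem chi_line (hT : IsCyclic T) {u : X → V} {p p' : X → ℝ} {μ μ' : ℝ} (h : IsEig T A u p μ)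
    (h' : IsEig T B u p' μ') (hAB : ∀ x v, B x v - A x v ∈ ℝ ∙ u (T x)) (x : X) :
    chi T B x * (Polynomial.X - C μ) = chi T A x * (Polynomial.X - C μ') := by
  have key : ∀ v, ret T B x v - ret T A x v ∈ ℝ ∙ u x := by
    intro v
    have := cp_sub_mem (P := fun x => ℝ ∙ u x) (A := A) (B := B) (T := T) ?_ hAB
      (Fintype.card X) x v
    · rwa [iter_card hT] at this
    · intro x v hv
      obtain ⟨c, rfl⟩ := Submodule.mem_span_singleton.1 hv
      rw [map_smul, h'.map]
      exact Submodule.smul_mem _ _ (Submodule.smul_mem _ _ (Submodule.mem_span_singleton_self _))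
  refine charpoly_line (φ := (innerₗ V (u x)) ∘ₗ (ret T B x - ret T A x)) (h.ne_zero x)
    (h.ret hT x) (h'.ret hT x) fun v => ?_
  obtain ⟨c, hc⟩ := Submodule.mem_span_singleton.1 (key v)
  have : ret T B x v = ret T A x v + c • u x := by rw [hc]; abel
  simp [this, h.unit]

end Cocycles

/-! ### Quotient of a cocycle by a field of eigenlines -/

section Quotient

variable {X : Type*} [Fintype X] {T : Equiv.Perm X}
variable {V : Type*} [NormedAddCommGroup V] [InnerProductSpace ℝ V]
variable {V' : Type*} [NormedAddCommGroup V'] [InnerProductSpace ℝ V']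

/-- Coordinates on the orthogonal complements of a field of unit vectors. -/
structure Compl (w : X → V) (V' : Type*) [NormedAddCommGroup V'] [InnerProductSpace ℝ V'] where
  J : X → V' →ₗᵢ[ℝ] V
  Q : X → V →L[ℝ] V'
  Q_J : ∀ x v, Q x (J x v) = v
  Q_w : ∀ x, Q x (w x) = 0
  decomp : ∀ x v, v = inner ℝ (w x) v • w x + J x (Q x v)
  norm_Q : ∀ x v, ‖Q x v‖ ≤ ‖v‖

theorem exists_compl {d : ℕ} {w : X → EuclideanSpace ℝ (Fin (d + 1))} (hw : ∀ x, ‖w x‖ = 1) :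
    Nonempty (Compl w (EuclideanSpace ℝ (Fin d))) := by
  have : Fact (Module.finrank ℝ (EuclideanSpace ℝ (Fin (d + 1))) = d + 1) := ⟨by simp⟩
  have hw0 : ∀ x, w x ≠ 0 := fun x h => by have := hw x; simp [h] at this
  let b := fun x => OrthonormalBasis.fromOrthogonalSpanSingleton (𝕜 := ℝ) d (hw0 x)
  refine ⟨{
    J := fun x => (Submodule.subtypeₗᵢ _).comp (b x).repr.symm.toLinearIsometry
    Q := fun x => ((b x).repr.toContinuousLinearEquiv : _ →L[ℝ] _).comp
      ((ℝ ∙ w x)ᗮ.orthogonalProjectionOnto)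
    Q_J := fun x v => ?_
    Q_w := fun x => ?_
    decomp := fun x v => ?_
    norm_Q := fun x v => ?_ }⟩
  · simp
  · have : (ℝ ∙ w x)ᗮ.orthogonalProjectionOnto (w x) = 0 :=
      Submodule.orthogonalProjectionOnto_orthogonalComplement_singleton_eq_zero _
    simp [this]
  · have h := (ℝ ∙ w x).starProjection_add_starProjection_orthogonal v
    rw [Submodule.starProjection_unit_singleton ℝ (hw x)] at h
    conv_lhs => rw [← h]
    congr 1
    change _ = (((b x).repr.symm ((b x).repr ((ℝ ∙ w x)ᗮ.orthogonalProjectionOnto v)) :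
      (ℝ ∙ w x)ᗮ) : EuclideanSpace ℝ (Fin (d + 1)))
    rw [LinearIsometryEquiv.symm_apply_apply]
    rfl
  · simp only [ContinuousLinearMap.comp_apply]
    refine le_trans (le_of_eq ((b x).repr.norm_map _)) ?_
    exact Submodule.norm_orthogonalProjectionOnto_apply_le _ v

namespace Compl

variable {w : X → V} (c : Compl w V')

/-- The cocycle induced on the quotient by a line field. -/
noncomputable def quot (T : Equiv.Perm X) (A : X → V →L[ℝ] V) : X → V' →L[ℝ] V' :=
  fun x => (c.Q (T x)).comp ((A x).comp (c.J x).toContinuousLinearMap)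

/-- Lifting a perturbation of the quotient cocycle. -/
noncomputable def lift (T : Equiv.Perm X) (A : X → V →L[ℝ] V) (B : X → V' →L[ℝ] V') :
    X → V →L[ℝ] V :=
  fun x => A x + (c.J (T x)).toContinuousLinearMap.comp ((B x - c.quot T A x).comp (c.Q x))

theorem norm_sq (hw : ∀ x, ‖w x‖ = 1) (x : X) (a : ℝ) (v : V') :
    ‖a • w x + c.J x v‖ ^ 2 = a ^ 2 + ‖v‖ ^ 2 := by
  have h := c.decomp x (c.J x v)
  rw [c.Q_J] at h
  have h0 : inner ℝ (w x) (c.J x v) = 0 := by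
    have : inner ℝ (w x) (c.J x v) • w x = 0 := by simpa using h
    rcases smul_eq_zero.1 this with h1 | h1
    · exact h1
    · have := hw x; simp [h1] at this
  rw [norm_add_sq_real, inner_smul_left, h0, norm_smul, hw, (c.J x).norm_map]
  simp

theorem norm_Q_le_add_smul (x : X) (v : V) (a : ℝ) : ‖c.Q x v‖ ≤ ‖v + a • w x‖ := by
  have := c.norm_Q x (v + a • w x)
  rwa [map_add, map_smul, c.Q_w, smul_zero, add_zero] at this

theorem norm_Q_eq (x : X) (v : V) : ‖c.Q x v‖ = ‖v + (-inner ℝ (w x) v) • w x‖ := by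
  have h := c.decomp x v
  have : v + (-inner ℝ (w x) v) • w x = c.J x (c.Q x v) := by
    rw [neg_smul, ← sub_eq_add_neg, sub_eq_iff_eq_add']; exact h
  rw [this, (c.J x).norm_map]

theorem Q_surjective (x : X) : Function.Surjective (c.Q x) := fun v => ⟨_, c.Q_J x v⟩

theorem ker_Q (x : X) : LinearMap.ker (c.Q x : V →ₗ[ℝ] V') = ℝ ∙ w x := by
  ext v
  rw [LinearMap.mem_ker, Submodule.mem_span_singleton]
  constructor
  · intro h
    refine ⟨inner ℝ (w x) v, ?_⟩
    conv_rhs => rw [c.decomp x v]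
    have h' : c.Q x v = 0 := h
    rw [h', map_zero, add_zero]
  · rintro ⟨a, rfl⟩
    change c.Q x (a • w x) = 0
    rw [map_smul, c.Q_w, smul_zero]

variable {A : X → V →L[ℝ] V} {p : X → ℝ} {ω : ℝ} {K : ℝ}

theorem quot_Q (h : ∀ x, A x (w x) = p x • w (T x)) (x : X) (v : V) :
    c.quot T A x (c.Q x v) = c.Q (T x) (A x v) := by
  conv_rhs => rw [c.decomp x v, map_add, map_smul, h, map_add, map_smul, map_smul, c.Q_w]
  simp [quot]

theorem cp_quot_Q (h : ∀ x, A x (w x) = p x • w (T x)) (N : ℕ) (x : X) (v : V) :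
    cp T (c.quot T A) N x (c.Q x v) = c.Q (T^[N] x) (cp T A N x v) := by
  induction N with
  | zero => rfl
  | succ N ih => rw [cp_succ_apply', ih, cp_succ_apply', c.quot_Q h, Function.iterate_succ_apply']

/-- The norm of `Q v` is the distance from `v` to the line of `w`, and `A` maps cosets of this line
onto cosets. Both bounds therefore pass to the quotient with the same constant. -/
theorem bdd_quot (h : ∀ x, A x (w x) = p x • w (T x)) (hp : ∀ x, p x ≠ 0)
    (hA : Bdd A K) :
    Bdd (c.quot T A) K := by
  intro x v
  constructor
  · refine (c.norm_Q _ _).trans ?_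
    have := (hA x (c.J x v)).1
    rwa [(c.J x).norm_map] at this
  · obtain ⟨z, rfl⟩ := c.Q_surjective x v
    rw [c.quot_Q h, c.norm_Q_eq (T x) (A x z)]
    set a := -inner ℝ (w (T x)) (A x z)
    have h1 : A x z + a • w (T x) = A x (z + (a / p x) • w x) := by
      rw [map_add, map_smul, h, smul_smul, div_mul_cancel₀ _ (hp x)]
    rw [h1]
    exact (c.norm_Q_le_add_smul x z _).trans (hA x _).2

theorem ret_quot_Q (hT : IsCyclic T) (h : ∀ x, A x (w x) = p x • w (T x)) (x : X) (v : V) :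
    ret T (c.quot T A) x (c.Q x v) = c.Q x (ret T A x v) := by
  rw [ret_apply, c.cp_quot_Q h, iter_card hT]; rfl

theorem aeval_ret_quot_Q (hT : IsCyclic T) (h : ∀ x, A x (w x) = p x • w (T x)) (q : ℝ[X]) (x : X)
    (v : V) : aeval (ret T (c.quot T A) x) q (c.Q x v) = c.Q x (aeval (ret T A x) q v) := by
  have key : ∀ n : ℕ, ∀ v, (ret T (c.quot T A) x ^ n) (c.Q x v) = c.Q x ((ret T A x ^ n) v) := by
    intro n
    induction n with
    | zero => intro v; rfl
    | succ n ih => intro v; rw [pow_succ, pow_succ, Module.End.mul_apply, Module.End.mul_apply,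
        c.ret_quot_Q hT h, ih]
  induction q using Polynomial.induction_on' with
  | add p q hp hq => simp [hp, hq]
  | monomial n a => simp [aeval_monomial, key, Module.algebraMap_end_apply]

theorem chi_quot [FiniteDimensional ℝ V] [FiniteDimensional ℝ V'] (hT : IsCyclic T)
    (h : IsEig T A w p ω) (x : X) :
    chi T A x = (Polynomial.X - C ω) * chi T (c.quot T A) x :=
  charpoly_quotient_line (h.ne_zero x) (h.ret hT x) (c.Q x : V →ₗ[ℝ] V') (c.Q_surjective x)
    (c.ker_Q x) fun v => (c.ret_quot_Q hT h.map x v).symm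

theorem lift_w (B : X → V' →L[ℝ] V') (x : X) : c.lift T A B x (w x) = A x (w x) := by
  simp [lift, c.Q_w]

theorem isEig_lift (h : IsEig T A w p ω) (B : X → V' →L[ℝ] V') :
    IsEig T (c.lift T A B) w p ω :=
  ⟨h.unit, fun x => by rw [c.lift_w, h.map], h.prod⟩

theorem quot_lift (B : X → V' →L[ℝ] V') : c.quot T (c.lift T A B) = B := by
  funext x
  ext1 v
  simp only [quot, lift, ContinuousLinearMap.comp_apply, add_apply,
    LinearIsometry.coe_toContinuousLinearMap, map_add, c.Q_J, sub_apply]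
  abel

theorem lift_quot : c.lift T A (c.quot T A) = A := by
  funext x; simp [lift]

theorem norm_lift_sub_le (B : X → V' →L[ℝ] V') (x : X) :
    ‖c.lift T A B x - A x‖ ≤ ‖B x - c.quot T A x‖ := by
  refine ContinuousLinearMap.opNorm_le_bound _ (norm_nonneg _) fun v => ?_
  have : (c.lift T A B x - A x) v = c.J (T x) ((B x - c.quot T A x) (c.Q x v)) := by
    simp [lift]
  rw [this, (c.J (T x)).norm_map]
  exact ((B x - c.quot T A x).le_opNorm _).trans
    (mul_le_mul_of_nonneg_left (c.norm_Q x v) (norm_nonneg _))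

theorem continuous_lift {P : ℝ → X → V' →L[ℝ] V'} (hP : ∀ x, Continuous fun t => P t x) (x : X) :
    Continuous fun t => c.lift T A (P t) x := by
  unfold lift
  have := hP x
  fun_prop

/-- Projecting an eigenfield to the quotient. -/
theorem exists_isEig_quot [FiniteDimensional ℝ V] (h : ∀ x, A x (w x) = p x • w (T x))
    {m : X → V} {r : X → ℝ} {μ : ℝ} (hm : IsEig T A m r μ) (hne : ∀ x, c.Q x (m x) ≠ 0) :
    ∃ r', IsEig T (c.quot T A) (fun x => ‖c.Q x (m x)‖⁻¹ • c.Q x (m x)) r' μ := by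
  refine ⟨fun x => ‖c.Q x (m x)‖⁻¹ * r x * ‖c.Q (T x) (m (T x))‖, ?_, ?_, ?_⟩
  · intro x; exact norm_smul_inv_norm (𝕜 := ℝ) (hne x)
  · intro x
    have := norm_ne_zero_iff.2 (hne (T x))
    rw [map_smul, c.quot_Q h, hm.map, map_smul, smul_smul, smul_smul]
    congr 1
    field_simp
  · rw [← hm.prod, Finset.prod_mul_distrib, Finset.prod_mul_distrib,
      Equiv.prod_comp T (fun x => ‖c.Q x (m x)‖), Finset.prod_inv_distrib]
    have : ∏ x, ‖c.Q x (m x)‖ ≠ 0 := Finset.prod_ne_zero_iff.2 fun x _ => norm_ne_zero_iff.2 (hne x)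
    field_simp

end Compl

end Quotient

end FibreCocycle

namespace FibreCocycle

/-- Keeps every perturbed cocycle of the construction uniformly bounded: a perturbation of size at
most `1 / (2K)` at most doubles the bound. -/
theorem Bdd.near_two {X V : Type*} [NormedAddCommGroup V] [InnerProductSpace ℝ V]
    {A B : X → V →L[ℝ] V} {K e : ℝ} (h : Bdd A K) (hK : 1 ≤ K) (hKe : K * e ≤ 1 / 2)
    (hB : ∀ x, ‖B x - A x‖ ≤ e) : Bdd B (2 * K) :=
  h.near (by linarith) hB (by nlinarith) (by nlinarith) (by linarith)

/-! ### Short paths with controlled spectrum, and mixing of two eigenvalues -/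

section Paths

variable {X : Type*} [Fintype X] {T : Equiv.Perm X}
variable {V : Type*} [NormedAddCommGroup V] [InnerProductSpace ℝ V] [FiniteDimensional ℝ V]
  {A B C' : X → V →L[ℝ] V} {K e e₁ e₂ μ ν : ℝ}

/-- `B` is reached from `A` by an `e`-short path with constant characteristic polynomial. -/
def CReach (T : Equiv.Perm X) (A B : X → V →L[ℝ] V) (e : ℝ) : Prop :=
  ∃ P : ℝ → X → V →L[ℝ] V, (∀ x, Continuous fun t => P t x) ∧ P 0 = A ∧ P 1 = B ∧
    (∀ t ∈ Set.Icc (0 : ℝ) 1, ∀ x, ‖P t x - A x‖ < e) ∧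
    ∀ t ∈ Set.Icc (0 : ℝ) 1, ∀ x, chi T (P t) x = chi T A x

/-- The eigenvalues `μ`, `ν` of `A` can be brought together by an `e`-short path which keeps
their product and the other eigenvalues. -/
def Mixable (T : Equiv.Perm X) (A : X → V →L[ℝ] V) (μ ν e : ℝ) : Prop :=
  ∀ δ, 0 ≤ δ → |μ| * Real.exp δ ≤ |ν| * Real.exp (-δ) →
    ∃ (P : ℝ → X → V →L[ℝ] V) (θ : ℝ → ℝ), (∀ x, Continuous fun t => P t x) ∧ P 0 = A ∧
      (∀ t ∈ Set.Icc (0 : ℝ) 1, ∀ x, ‖P t x - A x‖ < e) ∧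
      Continuous θ ∧ Monotone θ ∧ θ 0 = 0 ∧ θ 1 = 1 ∧
      ∀ t ∈ Set.Icc (0 : ℝ) 1, ∀ x,
        chi T (P t) x * ((Polynomial.X - C μ) * (Polynomial.X - C ν)) =
          chi T A x * ((Polynomial.X - C (μ * Real.exp (θ t * δ))) *
            (Polynomial.X - C (ν * Real.exp (-(θ t * δ)))))

theorem CReach.refl (he : 0 < e) : CReach T A A e :=
  ⟨fun _ => A, fun _ => continuous_const, rfl, rfl, fun _ _ x => by simpa using he,
    fun _ _ _ => rfl⟩

theorem Mixable.mono (h : Mixable T A μ ν e₁) (he : e₁ ≤ e₂) : Mixable T A μ ν e₂ := by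
  intro δ h0 hδ
  obtain ⟨P, θ, h1, h2, h3, h4⟩ := h δ h0 hδ
  exact ⟨P, θ, h1, h2, fun t ht x => (h3 t ht x).trans_le he, h4⟩

theorem CReach.chi_eq (h : CReach T A B e) (x : X) : chi T B x = chi T A x := by
  obtain ⟨P, -, -, h3, -, h5⟩ := h
  rw [← h3, h5 1 (by simp)]

theorem CReach.norm_sub (h : CReach T A B e) (x : X) : ‖B x - A x‖ < e := by
  obtain ⟨P, -, -, h3, h4, -⟩ := h
  rw [← h3]; exact h4 1 (by simp) x

/-- Concatenation of two families of cocycles. -/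
noncomputable def concat (P Q : ℝ → X → V →L[ℝ] V) : ℝ → X → V →L[ℝ] V :=
  fun t => if t ≤ 1 / 2 then P (2 * t) else Q (2 * t - 1)

theorem continuous_concat {P Q : ℝ → X → V →L[ℝ] V} (hP : ∀ x, Continuous fun t => P t x)
    (hQ : ∀ x, Continuous fun t => Q t x) (h : P 1 = Q 0) (x : X) :
    Continuous fun t => concat P Q t x := by
  have h' : (fun t => concat P Q t x) =
      fun t => if t ≤ 1 / 2 then P (2 * t) x else Q (2 * t - 1) x := by
    funext t; unfold concat; split_ifs <;> rfl
  rw [h']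
  refine Continuous.if_le ((hP x).comp (by fun_prop)) ((hQ x).comp (by fun_prop)) continuous_id
    continuous_const fun t ht => ?_
  subst ht
  norm_num [h]

theorem concat_zero (P Q : ℝ → X → V →L[ℝ] V) : concat P Q 0 = P 0 := by simp [concat]

theorem concat_one (P Q : ℝ → X → V →L[ℝ] V) : concat P Q 1 = Q 1 := by norm_num [concat]

theorem concat_cases {P Q : ℝ → X → V →L[ℝ] V} {t : ℝ} (ht : t ∈ Set.Icc (0 : ℝ) 1) :
    (t ≤ 1 / 2 ∧ 2 * t ∈ Set.Icc (0 : ℝ) 1 ∧ concat P Q t = P (2 * t)) ∨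
    (1 / 2 < t ∧ 2 * t - 1 ∈ Set.Icc (0 : ℝ) 1 ∧ concat P Q t = Q (2 * t - 1)) := by
  obtain ⟨h0, h1⟩ := ht
  rcases le_or_gt t (1 / 2) with h | h
  · exact Or.inl ⟨h, ⟨by linarith, by linarith⟩, by simp only [concat, if_pos h]⟩
  · exact Or.inr ⟨h, ⟨by linarith, by linarith⟩, by simp only [concat, if_neg (not_le.2 h)]⟩

theorem norm_concat {P Q : ℝ → X → V →L[ℝ] V}
    (hP : ∀ t ∈ Set.Icc (0 : ℝ) 1, ∀ x, ‖P t x - A x‖ < e₁)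
    (hQ : ∀ t ∈ Set.Icc (0 : ℝ) 1, ∀ x, ‖Q t x - P 1 x‖ < e₂) {t : ℝ}
    (ht : t ∈ Set.Icc (0 : ℝ) 1) (x : X) : ‖concat P Q t x - A x‖ < e₁ + e₂ := by
  have he2 : 0 < e₂ := (norm_nonneg _).trans_lt (hQ 0 (by simp) x)
  rcases concat_cases (P := P) (Q := Q) ht with ⟨-, h, h'⟩ | ⟨-, h, h'⟩
  · rw [h']; linarith [hP _ h x]
  · rw [h']
    have := norm_sub_le_norm_sub_add_norm_sub (Q (2 * t - 1) x) (P 1 x) (A x)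
    linarith [hP 1 (by simp) x, hQ _ h x]

theorem CReach.trans (h₁ : CReach T A B e₁) (h₂ : CReach T B C' e₂) :
    CReach T A C' (e₁ + e₂) := by
  obtain ⟨P, h1, h2, h3, h4, h5⟩ := h₁
  obtain ⟨Q, k1, k2, k3, k4, k5⟩ := h₂
  refine ⟨concat P Q, continuous_concat h1 k1 (h3.trans k2.symm), by rw [concat_zero, h2],
    by rw [concat_one, k3], fun t ht x => norm_concat h4 (by rw [h3]; exact k4) ht x,
    fun t ht x => ?_⟩
  rcases concat_cases (P := P) (Q := Q) ht with ⟨-, h, h'⟩ | ⟨-, h, h'⟩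
  · rw [h', h5 _ h]
  · rw [h', k5 _ h, ← h3, h5 1 (by simp)]

theorem CReach.mixable (h₁ : CReach T A B e₁) (h₂ : Mixable T B μ ν e₂) :
    Mixable T A μ ν (e₁ + e₂) := by
  have hAB := h₁.chi_eq
  obtain ⟨P, h1, h2, h3, h4, h5⟩ := h₁
  intro δ h0 hδ
  obtain ⟨Q, θ, k1, k2, k3, k4, k5, k6, k7, k8⟩ := h₂ δ h0 hδ
  -- The parameter rests at `0` while the first path runs. This is why `Mixable` allows a change of
  -- time `θ`.
  refine ⟨concat P Q, fun t => θ (max 0 (2 * t - 1)), continuous_concat h1 k1 (h3.trans k2.symm),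
    by rw [concat_zero, h2], fun t ht x => norm_concat h4 (by rw [h3]; exact k3) ht x,
    k4.comp (by fun_prop), fun s t hst => k5 (max_le_max le_rfl (by linarith)), by norm_num [k6],
    by norm_num [k7], fun t ht x => ?_⟩
  rcases concat_cases (P := P) (Q := Q) ht with ⟨ht2, h, h'⟩ | ⟨ht2, h, h'⟩
  · rw [h', h5 _ h]
    have : max 0 (2 * t - 1) = 0 := max_eq_left (by linarith)
    simp [this, k6]
  · have : max 0 (2 * t - 1) = 2 * t - 1 := max_eq_right h.1
    simp only [this]
    rw [h', k8 _ h, hAB]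

variable {V' : Type*} [NormedAddCommGroup V'] [InnerProductSpace ℝ V'] [FiniteDimensional ℝ V']
  {w : X → V} {p : X → ℝ} {ω : ℝ}

theorem Mixable.lift (c : Compl w V') (hT : IsCyclic T) (hw : IsEig T A w p ω)
    (h : Mixable T (c.quot T A) μ ν e) : Mixable T A μ ν e := by
  intro δ h0 hδ
  obtain ⟨P, θ, k1, k2, k3, k4, k5, k6, k7, k8⟩ := h δ h0 hδ
  refine ⟨fun t => c.lift T A (P t), θ, c.continuous_lift k1, by simp only [k2, c.lift_quot],
    fun t ht x => (c.norm_lift_sub_le _ x).trans_lt (k3 t ht x), k4, k5, k6, k7,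
    fun t ht x => ?_⟩
  rw [c.chi_quot hT hw, c.chi_quot hT (c.isEig_lift hw (P t)), c.quot_lift, mul_assoc, k8 t ht,
    mul_assoc]

open Classical in
/-- A perturbation at a single site. -/
noncomputable def bump (A : X → V →L[ℝ] V) (x₀ : X) (R : V →L[ℝ] V) : X → V →L[ℝ] V :=
  Function.update A x₀ (A x₀ + R * A x₀)

theorem bump_self (x₀ : X) (R : V →L[ℝ] V) : bump A x₀ R x₀ = A x₀ + R * A x₀ := by
  simp [bump]

theorem bump_of_ne {x₀ x : X} (h : x ≠ x₀) (R : V →L[ℝ] V) : bump A x₀ R x = A x := by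
  simp [bump, h]

theorem bump_zero (x₀ : X) : bump A x₀ 0 = A := by
  simp [bump]

theorem ret_bump (hT : IsCyclic T) (x₀ : X) (R : V →L[ℝ] V) (v : V) :
    ret T (bump A x₀ R) (T x₀) v = ret T A (T x₀) v + R (ret T A (T x₀) v) := by
  rw [ret_update hT (A := A) (B := bump A x₀ R) (x₀ := x₀) (R := 1 + R)
    (fun x hx => bump_of_ne hx R)]
  · simp
  · intro v; rw [bump_self]; simp

theorem norm_bump_sub (hA : Bdd A K) (hK : 0 ≤ K) {x₀ : X} {R : V →L[ℝ] V} {r : ℝ}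
    (hR : ‖R‖ ≤ r) (x : X) : ‖bump A x₀ R x - A x‖ ≤ r * K := by
  have hr := (norm_nonneg R).trans hR
  by_cases h : x = x₀
  · subst h
    rw [bump_self, add_sub_cancel_left]
    exact (norm_mul_le _ _).trans (mul_le_mul hR (hA.norm_le hK x) (norm_nonneg _) hr)
  · rw [bump_of_ne h, sub_self, norm_zero]; positivity

theorem continuous_bump {R : ℝ → V →L[ℝ] V} (hR : Continuous R) (x₀ x : X) :
    Continuous fun t => bump A x₀ (R t) x := by
  by_cases h : x = x₀
  · subst h; simp only [bump_self]; fun_prop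
  · simp only [bump_of_ne h]; fun_prop

/-- The left side is the change of trace that turns the eigenvalues `μ, ν` into `μx, νy`; the right
side is what `charpoly_plane` provides with `|τ| ≤ 1`. For `μ, ν ≥ 0` the change is `-(x - 1)(νy -
μ)`, which is controlled as long as the moduli have not crossed. For opposite signs both terms move
monotonically. -/
theorem mixing_parameter_le {μ ν x y : ℝ} (hx : 1 ≤ x) (hy : 0 ≤ y) (hxy : x * y = 1)
    (h : |μ| * x ≤ |ν| * y) : |μ * x + ν * y - μ - ν| ≤ |μ - ν| := by
  have hy1 : y ≤ 1 := by nlinarith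
  have key : ∀ μ ν : ℝ, 0 ≤ ν → |μ| * x ≤ |ν| * y → |μ * x + ν * y - μ - ν| ≤ |μ - ν| := by
    intro μ ν hν h
    rw [abs_of_nonneg hν] at h
    rcases le_total 0 μ with hμ | hμ
    · rw [abs_of_nonneg hμ] at h
      have h1 : μ ≤ μ * x := by nlinarith
      have h2 : ν * y ≤ ν := by nlinarith
      have h3 : μ * x + ν * y - μ - ν = -((x - 1) * (ν * y - μ)) := by linear_combination ν * hxy
      rw [h3, abs_neg, abs_of_nonneg (mul_nonneg (by linarith) (by linarith)),
        abs_sub_comm, abs_of_nonneg (by linarith)]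
      linarith
    · rw [abs_of_nonpos hμ] at h
      have h2 : ν * y ≤ ν := by nlinarith
      have h3 : μ * x ≤ μ := by nlinarith
      rw [abs_sub_comm μ ν, abs_of_nonneg (show 0 ≤ ν - μ by linarith), abs_le]
      constructor <;> linarith
  rcases le_total 0 ν with hν | hν
  · exact key μ ν hν h
  · have := key (-μ) (-ν) (by linarith) (by rwa [abs_neg, abs_neg])
    rw [← abs_neg, ← abs_neg (μ - ν)]
    convert this using 2 <;> ring

/-- Two eigenfields which are close at one site can be mixed by a perturbation at that site. -/
theorem mixable_of_close (hT : IsCyclic T) (hA : Bdd A K) (hK1 : 1 ≤ K) {u w : X → V}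
    {p q : X → ℝ} (hu : IsEig T A u p μ) (hw : IsEig T A w q ν) (hμν : |μ| < |ν|) {y : X} {α : ℝ}
    (hα1 : α ≤ 1) (hc : ‖u y - w y‖ ≤ α) (he : 2 * α * K < e) (hKe : K * e ≤ 1 / 2) : Mixable T A μ ν e := by
  have hα0 : 0 ≤ α := (norm_nonneg _).trans hc
  have hK : 0 < K := by linarith
  obtain ⟨x₀, rfl⟩ : ∃ x₀, T x₀ = y := T.surjective y
  set a := u (T x₀) with ha
  set b := w (T x₀) with hb
  have ha1 : ‖a‖ = 1 := hu.unit _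
  have hb1 : ‖b‖ = 1 := hw.unit _
  have haa : inner ℝ a a = (1 : ℝ) := by rw [real_inner_self_eq_norm_sq, ha1]; norm_num
  have hbb : inner ℝ b b = (1 : ℝ) := by rw [real_inner_self_eq_norm_sq, hb1]; norm_num
  have hsub := norm_sub_sq_real a b
  rw [ha1, hb1] at hsub
  have hadd := norm_add_sq_real a b
  rw [ha1, hb1] at hadd
  set i := inner ℝ a b with hi
  have hi2 : 1 / 2 ≤ i := by nlinarith [norm_nonneg (a - b)]
  have hi1 : 0 < 1 + i := by linarith
  -- The functional equal to `1` on both unit vectors. It has norm at most `2` since their inner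
  -- product is at least `1 / 2`.
  let φ : V →L[ℝ] ℝ := (1 + i)⁻¹ • innerSL ℝ (a + b)
  have hφ : ∀ v, φ v = (1 + i)⁻¹ * inner ℝ (a + b) v := fun v => rfl
  have hφa : φ a = 1 := by
    rw [hφ, inner_add_left, haa, real_inner_comm, ← hi]; field_simp
  have hφb : φ b = 1 := by
    rw [hφ, inner_add_left, hbb, ← hi, add_comm i]; field_simp
  have hφn : ‖φ‖ ≤ 2 := by
    rw [norm_smul, innerSL_apply_norm, Real.norm_eq_abs, abs_of_pos (inv_pos.2 hi1),
      inv_mul_le_iff₀ hi1]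
    nlinarith [norm_nonneg (a + b)]
  have hμν' : μ - ν ≠ 0 := by
    intro h; rw [sub_eq_zero.1 h] at hμν; exact lt_irrefl _ hμν
  intro δ hδ0 hδ
  -- The coefficient for which the new trace `μ + ν + τ (μ - ν)` equals `μ e^{tδ} + ν e^{-tδ}`. The
  -- determinant is unchanged, so these are the new eigenvalues.
  let τ : ℝ → ℝ := fun t =>
    (μ * Real.exp (t * δ) + ν * Real.exp (-(t * δ)) - μ - ν) / (μ - ν)
  have hτ : ∀ t ∈ Set.Icc (0 : ℝ) 1, |τ t| ≤ 1 := by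
    intro t ht
    have htδ : t * δ ≤ δ := by nlinarith [ht.2]
    have ht0 : 0 ≤ t * δ := mul_nonneg ht.1 hδ0
    rw [abs_div, div_le_one (abs_pos.2 hμν')]
    refine mixing_parameter_le (Real.one_le_exp ht0) (Real.exp_pos _).le
      (by rw [← Real.exp_add]; simp) ?_
    calc |μ| * Real.exp (t * δ) ≤ |μ| * Real.exp δ := by gcongr
      _ ≤ |ν| * Real.exp (-δ) := hδ
      _ ≤ |ν| * Real.exp (-(t * δ)) := by gcongr
  have hτc : Continuous τ := by
    refine Continuous.div_const ?_ _
    fun_prop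
  let R : ℝ → V →L[ℝ] V := fun t => τ t • φ.smulRight (a - b)
  have hRn : ∀ t ∈ Set.Icc (0 : ℝ) 1, ‖R t‖ ≤ 2 * α := by
    intro t ht
    rw [norm_smul, ContinuousLinearMap.norm_smulRight_apply, Real.norm_eq_abs]
    calc |τ t| * (‖φ‖ * ‖a - b‖) ≤ 1 * (2 * α) := by
          gcongr
          exact hτ t ht
      _ = 2 * α := one_mul _
  refine ⟨fun t => bump A x₀ (R t), id, fun x => continuous_bump (hτc.smul continuous_const) x₀ x,
    ?_, fun t ht x => (norm_bump_sub hA hK.le (hRn t ht) x).trans_lt he, continuous_id,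
    monotone_id, rfl, rfl, fun t ht x => ?_⟩
  · have : τ 0 = 0 := by simp [τ]
    simp only [R, this, zero_smul, bump_zero]
  · have h2 : Bdd (bump A x₀ (R t)) (2 * K) :=
      hA.near_two hK1 hKe fun x => ((norm_bump_sub hA hK.le (hRn t ht) x).trans_lt he).le
    have key := charpoly_plane (M := ret T A (T x₀)) (M' := ret T (bump A x₀ (R t)) (T x₀))
      (u := a) (w := b) (φ := (φ : V →ₗ[ℝ] ℝ)) (τ := τ t) (hu.ret hT _) (hw.ret hT _) hφa hφb
      (fun v => by
        rw [ret_bump hT]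
        simp only [R, smul_apply, ContinuousLinearMap.smulRight_apply, smul_smul]
        rfl)
    change chi T _ _ * _ = chi T _ _ * _ at key
    rw [chi_eq hT h2 x, chi_eq hT hA x] at key
    rw [key]
    congr 1
    have e1 : μ + ν + τ t * (μ - ν) = μ * Real.exp (t * δ) + ν * Real.exp (-(t * δ)) := by
      simp only [τ]; field_simp; ring
    have e2 : μ * ν = (μ * Real.exp (t * δ)) * (ν * Real.exp (-(t * δ))) := by
      rw [mul_mul_mul_comm, ← Real.exp_add]; simp
    rw [e1, e2]
    simp only [id, C_add, C_mul]
    ring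

end Paths

end FibreCocycle

namespace FibreCocycle

/-! ### Angles between unit vectors and dual functionals -/

section Close

variable {V : Type*} [NormedAddCommGroup V] [InnerProductSpace ℝ V]

/-- Two vectors are `α`-close up to sign. -/
def Close (α : ℝ) (a b : V) : Prop := ‖a - b‖ ≤ α ∨ ‖a + b‖ ≤ α

theorem Close.symm {α : ℝ} {a b : V} (h : Close α a b) : Close α b a := by
  rcases h with h | h
  · left; rwa [norm_sub_rev]
  · right; rwa [add_comm]

theorem Close.mono {α β : ℝ} {a b : V} (h : Close α a b) (hαβ : α ≤ β) : Close β a b :=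
  h.imp (fun h => h.trans hαβ) fun h => h.trans hαβ

/-- After division by `x`, the vector `a` is within `ρ` of the multiple `(c / x) b`. Since both
vectors are unit, `|c / x|` is within `ρ` of `1`, and replacing it by a sign costs another `ρ`. -/
theorem close_of_parallel {a b z : V} {c x ρ : ℝ} (ha : ‖a‖ = 1) (hb : ‖b‖ = 1) (hx : x ≠ 0)
    (h : c • b = x • a + z) (hz : ‖z‖ ≤ ρ * |x|) : Close (2 * ρ) a b := by
  have hx' : 0 < |x| := abs_pos.2 hx
  have h1 : ‖a - (c / x) • b‖ ≤ ρ := by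
    have : a - (c / x) • b = -(x⁻¹ • z) := by
      have : z = c • b - x • a := by rw [h]; abel
      rw [this]
      match_scalars <;> field_simp
    rw [this, norm_neg, norm_smul, norm_inv, Real.norm_eq_abs, inv_mul_le_iff₀ hx']
    linarith
  set k := c / x
  have h2 : |1 - abs k| ≤ ρ := by
    have := abs_norm_sub_norm_le a (k • b)
    rw [norm_smul, ha, hb, mul_one, Real.norm_eq_abs] at this
    exact this.trans h1
  rcases le_total 0 k with hk | hk
  · left
    rw [abs_of_nonneg hk] at h2
    have : a - b = (a - k • b) + (-(1 - k)) • b := by module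
    rw [this]
    refine (norm_add_le _ _).trans ?_
    rw [norm_smul, hb, mul_one, norm_neg, Real.norm_eq_abs]
    linarith
  · right
    rw [abs_of_nonpos hk] at h2
    have : a + b = (a - k • b) + (1 - -k) • b := by module
    rw [this]
    refine (norm_add_le _ _).trans ?_
    rw [norm_smul, hb, mul_one, Real.norm_eq_abs]
    linarith

theorem norm_perp_sq {a b : V} (hb : ‖b‖ = 1) :
    ‖a - inner ℝ b a • b‖ ^ 2 = ‖a‖ ^ 2 - inner ℝ b a ^ 2 := by
  rw [norm_sub_sq_real, inner_smul_right, norm_smul, hb, real_inner_comm, Real.norm_eq_abs,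
    mul_one, sq_abs, real_inner_comm]
  ring

theorem norm_perp_le {a b : V} (hb : ‖b‖ = 1) : ‖a - inner ℝ b a • b‖ ≤ ‖a‖ := by
  have := norm_perp_sq (a := a) hb
  nlinarith [norm_nonneg (a - inner ℝ b a • b), norm_nonneg a, sq_nonneg (inner ℝ b a : ℝ)]

/-- The functional is the inner product with the component `v` of `a` orthogonal to `b`, divided by
`‖v‖²`; its norm is `1 / ‖v‖`. A lower bound on the angle thus makes the perturbations built from
`φ` small. -/
theorem exists_dual {a b : V} {β : ℝ} (hb : ‖b‖ = 1) (hβ : 0 < β)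
    (h : β ≤ ‖a - inner ℝ b a • b‖) :
    ∃ φ : V →L[ℝ] ℝ, φ a = 1 ∧ φ b = 0 ∧ ‖φ‖ ≤ β⁻¹ := by
  set v := a - inner ℝ b a • b with hv
  have hv0 : 0 < ‖v‖ := hβ.trans_le h
  have hvb : inner ℝ v b = (0 : ℝ) := by
    rw [hv, inner_sub_left, inner_smul_left, real_inner_self_eq_norm_sq, hb, real_inner_comm]
    simp
  have hva : inner ℝ v a = ‖v‖ ^ 2 := by
    have : a = v + inner ℝ b a • b := by rw [hv]; abel
    conv_lhs => rw [this]
    rw [inner_add_right, inner_smul_right, hvb, real_inner_self_eq_norm_sq]; ring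
  refine ⟨(‖v‖ ^ 2)⁻¹ • innerSL ℝ v, ?_, ?_, ?_⟩
  · simp [hva, hv0.ne']
  · simp [hvb]
  · rw [norm_smul, innerSL_apply_norm, norm_inv, norm_pow, norm_norm, inv_mul_le_iff₀ (by positivity),
      sq, mul_assoc]
    rw [le_mul_iff_one_le_right hv0, ← div_eq_mul_inv, one_le_div hβ]
    exact h

theorem norm_perp_of_not_close {a b : V} {α : ℝ} (hα : 0 < α) (ha : ‖a‖ = 1) (hb : ‖b‖ = 1)
    (h : ¬ Close α a b) : α / 2 ≤ ‖a - inner ℝ b a • b‖ := by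
  obtain ⟨h1, h2⟩ := not_or.1 h
  push Not at h1 h2
  have h3 := norm_perp_sq (a := a) hb
  have h4 := norm_sub_sq_real a b
  have h5 := norm_add_sq_real a b
  rw [ha, hb] at h4 h5
  rw [ha, real_inner_comm] at h3
  rw [real_inner_comm]
  set i : ℝ := inner ℝ a b
  have h6 : α ^ 2 < 2 - 2 * i := by nlinarith
  have h7 : α ^ 2 < 2 + 2 * i := by nlinarith
  have h8 : (α / 2) ^ 2 ≤ ‖a - i • b‖ ^ 2 := by
    rw [h3]
    rcases le_total 0 i with hi | hi <;> nlinarith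
  exact le_of_sq_le_sq h8 (norm_nonneg _)
where
  le_of_sq_le_sq {x y : ℝ} (h : x ^ 2 ≤ y ^ 2) (hy : 0 ≤ y) : x ≤ y := by
    by_contra! h'
    nlinarith

end Close

/-! ### Shears along an eigenline -/

section Shear

variable {X : Type*} [Fintype X] {T : Equiv.Perm X}
variable {V : Type*} [NormedAddCommGroup V] [InnerProductSpace ℝ V] [FiniteDimensional ℝ V]
  {A B : X → V →L[ℝ] V} {K e : ℝ} {m : X → V} {r : X → ℝ} {μ : ℝ}

theorem chi_eq_of_line (hT : IsCyclic T) {p p' : X → ℝ} (h : IsEig T A m p μ)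
    (h' : IsEig T B m p' μ) (hAB : ∀ x v, B x v - A x v ∈ ℝ ∙ m (T x)) (x : X) :
    chi T B x = chi T A x :=
  mul_right_cancel₀ (X_sub_C_ne_zero μ) (chi_line hT h h' hAB x)

/-- The shear at a single site along an eigenfield. -/
noncomputable def shear (T : Equiv.Perm X) (A : X → V →L[ℝ] V) (m : X → V) (x₀ : X)
    (φ : V →L[ℝ] ℝ) (c : ℝ) : X → V →L[ℝ] V :=
  bump A x₀ (c • φ.smulRight (m (T x₀)))

theorem shear_apply_self (x₀ : X) (φ : V →L[ℝ] ℝ) (c : ℝ) (v : V) :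
    shear T A m x₀ φ c x₀ v = A x₀ v + (c * φ (A x₀ v)) • m (T x₀) := by
  rw [shear, bump_self]; simp [smul_smul]

theorem shear_apply_of_ne {x₀ x : X} (h : x ≠ x₀) (φ : V →L[ℝ] ℝ) (c : ℝ) :
    shear T A m x₀ φ c x = A x := bump_of_ne h _

theorem isEig_shear (hm : IsEig T A m r μ) {x₀ : X} {φ : V →L[ℝ] ℝ} (hφ : φ (m (T x₀)) = 0)
    (c : ℝ) : IsEig T (shear T A m x₀ φ c) m r μ := by
  refine ⟨hm.unit, fun x => ?_, hm.prod⟩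
  by_cases h : x = x₀
  · subst h; rw [shear_apply_self, hm.map, map_smul, hφ]; simp
  · rw [shear_apply_of_ne h, hm.map]

/-- The shear fixes the line of `m` with its multipliers, since `φ` vanishes on it, and changes
nothing modulo that line. Hence the whole spectrum is kept. -/
theorem creach_shear (hT : IsCyclic T) (hA : Bdd A K) (hK : 0 ≤ K) (hm : IsEig T A m r μ) {x₀ : X}
    {φ : V →L[ℝ] ℝ} (hφ : φ (m (T x₀)) = 0) {b : ℝ} (hb : ‖φ‖ ≤ b) {c : ℝ}
    (hc : |c| * b * K < e) : CReach T A (shear T A m x₀ φ c) e := by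
  refine ⟨fun t => shear T A m x₀ φ (t * c), fun x => continuous_bump (by fun_prop) x₀ x, ?_,
    by simp, fun t ht x => ?_, fun t ht x => ?_⟩
  · simp [shear, bump_zero]
  · refine (norm_bump_sub hA hK (r := |c| * b) ?_ x).trans_lt hc
    rw [norm_smul, ContinuousLinearMap.norm_smulRight_apply, hm.unit, mul_one, norm_mul,
      Real.norm_eq_abs, Real.norm_eq_abs, abs_of_nonneg ht.1]
    have : t * |c| ≤ |c| := by nlinarith [ht.2, abs_nonneg c]
    gcongr
  · refine chi_eq_of_line hT hm (isEig_shear hm hφ _) (fun x v => ?_) x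
    by_cases h : x = x₀
    · subst h
      rw [shear_apply_self, add_sub_cancel_left]
      exact Submodule.smul_mem _ _ (Submodule.mem_span_singleton_self _)
    · rw [shear_apply_of_ne h, sub_self]; exact Submodule.zero_mem _

/-- How a shear tilts the other eigenvectors towards `m`: the relation between `s` and `c` is the
eigenvector equation for `v + s m`. -/
theorem ret_shear (hT : IsCyclic T) (hm : IsEig T A m r μ) {x₀ : X}
    {φ : V →L[ℝ] ℝ} (hφ : φ (m (T x₀)) = 0) {c s ω : ℝ} {v : V}
    (hv : ret T A (T x₀) v = ω • v) (hs : s * (ω - μ) = c * ω * φ v) :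
    ret T (shear T A m x₀ φ c) (T x₀) (v + s • m (T x₀)) = ω • (v + s • m (T x₀)) := by
  rw [shear, ret_bump hT, map_add, map_smul, hv, hm.ret hT]
  simp only [smul_apply, ContinuousLinearMap.smulRight_apply, map_add, map_smul, hφ, smul_add,
    smul_smul, mul_zero]
  have : ω * s = s * μ + c * (ω * φ v) := by linear_combination hs
  rw [this]
  module

end Shear

/-! ### Creating a small angle from the lack of domination -/

section AngleCreation

variable {X : Type*} [Fintype X] {T : Equiv.Perm X}
variable {V : Type*} [NormedAddCommGroup V] [InnerProductSpace ℝ V] [FiniteDimensional ℝ V]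
  {A B : X → V →L[ℝ] V} {K e : ℝ} {u w : X → V} {p q : X → ℝ} {μ ω : ℝ}

/-- Scaling along an eigenfield, relatively to a field of functionals. -/
noncomputable def scale (A : X → V →L[ℝ] V) (u : X → V) (φ : X → V →L[ℝ] ℝ) (h : X → ℝ) :
    X → V →L[ℝ] V :=
  fun x => A x + (Real.exp (h x) - 1) • (φ x).smulRight (A x (u x))

theorem scale_apply (φ : X → V →L[ℝ] ℝ) (h : X → ℝ) (x : X) (v : V) :
    scale A u φ h x v = A x v + ((Real.exp (h x) - 1) * φ x v) • A x (u x) := by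
  simp [scale, smul_smul]

theorem isEig_scale (hu : IsEig T A u p μ) {φ : X → V →L[ℝ] ℝ} (hφ : ∀ x, φ x (u x) = 1)
    (h : X → ℝ) :
    IsEig T (scale A u φ h) u (fun x => Real.exp (h x) * p x) (Real.exp (∑ x, h x) * μ) := by
  refine ⟨hu.unit, fun x => ?_, ?_⟩
  · rw [scale_apply, hφ, hu.map]; module
  · rw [Finset.prod_mul_distrib, hu.prod, Real.exp_sum]

theorem scale_sub_mem (hu : IsEig T A u p μ) (φ : X → V →L[ℝ] ℝ) (h : X → ℝ) (x : X) (v : V) :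
    scale A u φ h x v - A x v ∈ ℝ ∙ u (T x) := by
  rw [scale_apply, add_sub_cancel_left, hu.map]
  exact Submodule.smul_mem _ _ (Submodule.smul_mem _ _ (Submodule.mem_span_singleton_self _))

theorem abs_exp_sub_one_le {x y : ℝ} (h : |x| ≤ y) : |Real.exp x - 1| ≤ Real.exp y - 1 := by
  obtain ⟨h1, h2⟩ := abs_le.1 h
  rw [abs_le]
  constructor
  · have := Real.add_one_le_exp (-y)
    have h3 : Real.exp (-y) ≤ Real.exp x := Real.exp_le_exp.2 h1
    have h4 : 1 ≤ Real.exp (-y) * Real.exp y := by rw [← Real.exp_add]; simp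
    nlinarith [sq_nonneg (Real.exp y - 1), Real.exp_pos y]
  · linarith [Real.exp_le_exp.2 h2]

theorem norm_scale_sub (hA : Bdd A K) (hu : IsEig T A u p μ) {φ : X → V →L[ℝ] ℝ}
    {b η : ℝ} (hb : ∀ x, ‖φ x‖ ≤ b) {h : X → ℝ} (hh : ∀ x, |h x| ≤ η) (x : X) :
    ‖scale A u φ h x - A x‖ ≤ (Real.exp η - 1) * (b * K) := by
  rw [scale, add_sub_cancel_left, norm_smul, ContinuousLinearMap.norm_smulRight_apply,
    Real.norm_eq_abs]
  have h1 := abs_exp_sub_one_le (hh x)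
  have h2 : ‖A x (u x)‖ ≤ K := by simpa [hu.unit] using (hA x (u x)).1
  have h3 : 0 ≤ b := (norm_nonneg _).trans (hb x)
  have h4 : 0 ≤ Real.exp η - 1 := (abs_nonneg _).trans h1
  have := hb x
  gcongr

/-- Only the multiplier of the line `u` could change, and it is multiplied by `exp (∑ h) = 1`. -/
theorem creach_scale (hT : IsCyclic T) (hA : Bdd A K) (hu : IsEig T A u p μ)
    {φ : X → V →L[ℝ] ℝ} (hφ : ∀ x, φ x (u x) = 1) {b η : ℝ} (hb : ∀ x, ‖φ x‖ ≤ b) {h : X → ℝ}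
    (hh : ∀ x, |h x| ≤ η) (hs : ∑ x, h x = 0) (he : (Real.exp η - 1) * (b * K) < e) :
    CReach T A (scale A u φ h) e := by
  refine ⟨fun t => scale A u φ fun x => t * h x, fun x => ?_, ?_, by simp, fun t ht x => ?_,
    fun t ht x => ?_⟩
  · unfold scale; fun_prop
  · funext x; simp [scale]
  · refine (norm_scale_sub hA hu hb (fun x => ?_) x).trans_lt he
    rw [abs_mul, abs_of_nonneg ht.1]
    have := hh x
    nlinarith [ht.2, abs_nonneg (h x)]
  · have h0 := isEig_scale hu hφ (fun x => t * h x)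
    rw [← Finset.mul_sum, hs, mul_zero, Real.exp_zero, one_mul] at h0
    exact chi_eq_of_line hT hu h0 (scale_sub_mem hu _ _) x

/-- A weight equal to `η` on an orbit segment of length `ℓ` and to `-η` on the next one. -/
theorem exists_weight (hT : IsCyclic T) (x : X) {ℓ : ℕ} (hℓ : 2 * ℓ ≤ Fintype.card X) (η : ℝ)
    (hη : 0 ≤ η) :
    ∃ h : X → ℝ, (∀ y, |h y| ≤ η) ∧ ∑ y, h y = 0 ∧ ∀ j < ℓ, h (T^[j] x) = η := by
  choose k hk hkx using exists_iter_eq hT x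
  have hk' : ∀ j < Fintype.card X, k (T^[j] x) = j := fun j hj =>
    iter_inj hT (hk _) hj (hkx _)
  let g : ℕ → ℝ := fun j => if j < ℓ then η else if j < ℓ + ℓ then -η else 0
  refine ⟨fun y => g (k y), fun y => ?_, ?_, fun j hj => ?_⟩
  · simp only [g]
    split_ifs
    · rw [abs_of_nonneg hη]
    · rw [abs_neg, abs_of_nonneg hη]
    · simpa using hη
  · rw [← (iter_surj hT x).sum_comp (fun y => g (k y))]
    have : ∀ j : Fin (Fintype.card X), g (k (T^[(j : ℕ)] x)) = g j := fun j => by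
      rw [hk' j j.2]
    simp only [this]
    rw [← Finset.sum_range (fun j => g j)]
    obtain ⟨c, hc⟩ := Nat.exists_eq_add_of_le hℓ
    rw [hc, two_mul, Finset.sum_range_add, Finset.sum_range_add]
    have e1 : ∑ j ∈ Finset.range ℓ, g j = ∑ j ∈ Finset.range ℓ, η :=
      Finset.sum_congr rfl fun j hj => by simp [g, Finset.mem_range.1 hj]
    have e2 : ∑ j ∈ Finset.range ℓ, g (ℓ + j) = ∑ j ∈ Finset.range ℓ, -η :=
      Finset.sum_congr rfl fun j hj => by simp [g, Finset.mem_range.1 hj]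
    have e3 : ∑ j ∈ Finset.range c, g (ℓ + ℓ + j) = ∑ j ∈ Finset.range c, 0 :=
      Finset.sum_congr rfl fun j hj => by
        have : ¬ (ℓ + ℓ + j < ℓ) := by omega
        simp [g, this]
    rw [e1, e2, e3]
    simp
  · simp only []
    rw [hk' j (by omega)]
    simp [g, hj]

/-- Absence of domination between two eigenfields allows, keeping the spectrum, to create a
small angle between them. -/
theorem exists_close_of_not_dominated (hT : IsCyclic T) (hA : Bdd A K) (hK1 : 1 ≤ K)
    (hKe : K * e ≤ 1 / 2) (he0 : 0 < e) (hu : IsEig T A u p μ) (hw : IsEig T A w q ω)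
    (hμω : |μ| < |ω|)
    {α η s : ℝ} (hα : 0 < α) (hη : 0 ≤ η) (hs : 0 < s)
    (hcη : (Real.exp η - 1) * (2 / α * K) < e / 2)
    (hcs : 2 * s * (2 / α) * (2 * K) < e / 2) {ℓ : ℕ}
    (hℓn : 2 * ℓ ≤ Fintype.card X) (hℓ : 4 ≤ s * α * Real.exp (η * ℓ)) {x : X}
    (hx : |pp T q ℓ x| ≤ 2 * |pp T p ℓ x|) :
    ∃ B w' p' q', CReach T A B e ∧ IsEig T B u p' μ ∧ IsEig T B w' q' ω ∧
      ∃ y, ‖u y - w' y‖ ≤ α := by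
  -- If the lines are nowhere `α`-close, the dual functionals of the pair have norm at most `2 / α`
  -- at every site. This bounds the perturbations below.
  by_cases hclose : ∃ y, Close α (u y) (w y)
  · obtain ⟨y, h | h⟩ := hclose
    · exact ⟨A, w, p, q, CReach.refl he0, hu, hw, y, h⟩
    · exact ⟨A, fun x => - w x, p, q, CReach.refl he0, hu, hw.neg, y, by simpa using h⟩
  push Not at hclose
  have hα2 : 0 < α / 2 := by linarith
  have hd : ∀ y, ∃ φ : V →L[ℝ] ℝ, φ (u y) = 1 ∧ φ (w y) = 0 ∧ ‖φ‖ ≤ (α / 2)⁻¹ := fun y =>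
    exists_dual (hw.unit y) hα2 (norm_perp_of_not_close hα (hu.unit y) (hw.unit y) (hclose y))
  choose φ hφu hφw hφn using hd
  rw [inv_div] at hφn
  obtain ⟨h, hh, hsum, hhη⟩ := exists_weight hT x hℓn η hη
  -- The line `u` is boosted by `e^η` at each of the `ℓ` sites starting at `x`, and the boost is
  -- undone later. The line `w` is untouched because `φ` vanishes on it.
  have r1 : CReach T A (scale A u φ h) (e / 2) :=
    creach_scale hT hA hu hφu hφn hh hsum hcη
  set A₁ := scale A u φ h with hA₁
  have hu1 := isEig_scale hu hφu h
  rw [hsum, Real.exp_zero, one_mul, ← hA₁] at hu1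
  have hw1 : IsEig T A₁ w q ω := ⟨hw.unit, fun x => by
    rw [hA₁, scale_apply, hφw, mul_zero, zero_smul, add_zero, hw.map], hw.prod⟩
  have hB1 : Bdd A₁ (2 * K) := hA.near_two hK1 hKe fun x => by linarith [r1.norm_sub x]
  obtain ⟨ψ, hψw, hψu, hψn⟩ := exists_dual (hu.unit x) hα2
    (norm_perp_of_not_close hα (hw.unit x) (hu.unit x) fun h => hclose x h.symm)
  rw [inv_div] at hψn
  obtain ⟨x₀, rfl⟩ : ∃ x₀, T x₀ = x := T.surjective x
  -- The value for which `ret_shear` turns the `ω`-eigenvector at `x` into exactly `w + s u`.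
  set c := s * (1 - μ / ω) with hc
  have hω0 : ω ≠ 0 := by
    intro h0; rw [h0, abs_zero] at hμω; exact absurd (abs_nonneg μ) (not_le.2 hμω)
  have hcabs : |c| ≤ 2 * s := by
    rw [hc, abs_mul, abs_of_pos hs]
    have : |μ / ω| ≤ 1 := by rw [abs_div]; exact (div_le_one (abs_pos.2 hω0)).2 hμω.le
    have : |1 - μ / ω| ≤ 2 := (abs_sub _ _).trans (by rw [abs_one]; linarith)
    nlinarith
  have r2 : CReach T A₁ (shear T A₁ u x₀ ψ c) (e / 2) := by
    refine creach_shear hT hB1 (by linarith) hu1 hψu hψn ?_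
    calc |c| * (2 / α) * (2 * K) ≤ 2 * s * (2 / α) * (2 * K) := by gcongr
      _ < e / 2 := hcs
  have hre := ret_shear hT hu1 hψu (c := c) (s := s) (hw1.ret hT (T x₀))
    (by rw [hψw, hc]; field_simp)
  have r12 := r1.trans r2
  rw [add_halves] at r12
  have hu2 := isEig_shear hu1 hψu c
  set A₂ := shear T A₁ u x₀ ψ c with hA₂
  have hB2 : Bdd A₂ (2 * K) := hA.near_two hK1 hKe fun x => (r12.norm_sub x).le
  have hne : w (T x₀) + s • u (T x₀) ≠ 0 := by
    intro h0
    have := congrArg ψ h0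
    simp [hψw, hψu] at this
  obtain ⟨w', q', hw', hw'x⟩ := exists_isEig_of_eigenvector hT hB2 hne hre
  -- The sheared site precedes `x`, so the `ℓ` steps that start at `x` do not meet it.
  have hcp : cp T A₂ ℓ (T x₀) = cp T A₁ ℓ (T x₀) := by
    refine cp_congr fun j hj => shear_apply_of_ne (fun h0 => ?_) _ _
    have h1 : T^[j + 1] (T x₀) = T^[0] (T x₀) := by rw [Function.iterate_succ_apply', h0]; rfl
    have := iter_inj hT (by omega) (by omega) h1
    omega
  have h1 := hw'.cp ℓ (T x₀)
  have hpp1 : pp T (fun x => Real.exp (h x) * p x) ℓ (T x₀) =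
      Real.exp (η * ℓ) * pp T p ℓ (T x₀) := by
    simp only [pp]
    rw [Finset.prod_mul_distrib]
    congr 1
    rw [Finset.prod_congr rfl fun j hj => by rw [hhη j (Finset.mem_range.1 hj)]]
    rw [Finset.prod_const, Finset.card_range, ← Real.exp_nat_mul, mul_comm]
  rw [hcp, hw'x, map_smul, map_add, map_smul, hw1.cp, hu1.cp, hpp1] at h1
  set y := T^[ℓ] (T x₀) with hy
  set P := pp T p ℓ (T x₀) with hP
  set Q := pp T q ℓ (T x₀) with hQ
  have hP0 : P ≠ 0 := hu.pp_ne hA _ _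
  have hn0 : ‖w (T x₀) + s • u (T x₀)‖ ≠ 0 := norm_ne_zero_iff.2 hne
  -- After `ℓ` steps the component on `u` is `s e^{ηℓ} P` and the one on `w` is `Q`, with `|Q| ≤
  -- 2|P|`. By the choice of `ℓ` their ratio is at most `α / 2`.
  have h2 : (‖w (T x₀) + s • u (T x₀)‖ * pp T q' ℓ (T x₀)) • w' y =
      (s * (Real.exp (η * ℓ) * P)) • u y + Q • w y := by
    rw [mul_smul, ← h1, smul_smul, mul_inv_cancel₀ hn0]
    module
  have hcl : Close (2 * (α / 2)) (u y) (w' y) := by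
    refine close_of_parallel (hu.unit y) (hw'.unit y) ?_ h2 ?_
    · have := Real.exp_pos (η * ℓ); positivity
    · rw [norm_smul, hw.unit, mul_one, Real.norm_eq_abs, abs_mul, abs_mul, abs_of_pos hs,
        abs_of_pos (Real.exp_pos _)]
      nlinarith [abs_nonneg P]
  rw [mul_div_cancel₀ _ two_ne_zero] at hcl
  rcases hcl with hcl | hcl
  · exact ⟨A₂, w', _, q', r12, hu2, hw', y, hcl⟩
  · exact ⟨A₂, fun x => - w' x, _, q', r12, hu2, hw'.neg, y, by simpa using hcl⟩

end AngleCreation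

end FibreCocycle

namespace FibreCocycle

/-! ### Transferring closeness to an intermediate eigenline -/

section Transfer

/-- Used with `a = μ / ν` and `b = ν / ω`. The two terms are close to `-1/2` and `1/2` when `a` and
`b` are both close to `-1`, and would then cancel. A factor `4` in one of the ratios excludes this.
-/
theorem transfer_bounds {a b f : ℝ} (ha : |a| < 1) (hb : |b| < 1) (hf : |f - 1| ≤ 1 / 10)
    (hab : |a| ≤ 1 / 4 ∨ |b| ≤ 1 / 4) :
    0 < f / (1 - b) ∧ 1 / 5 ≤ f / (1 - b) + a / (1 - a) ∧
      f / (1 - b) ≤ 4 * (f / (1 - b) + a / (1 - a)) := by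
  obtain ⟨ha1, ha2⟩ := abs_lt.1 ha
  obtain ⟨hb1, hb2⟩ := abs_lt.1 hb
  obtain ⟨hf1, hf2⟩ := abs_le.1 hf
  have hR : -(1 / 2) ≤ a / (1 - a) := by
    rw [le_div_iff₀ (by linarith)]; linarith
  have hS : 9 / 20 ≤ f / (1 - b) := by
    rw [le_div_iff₀ (by linarith)]; linarith
  rcases hab with h | h
  · obtain ⟨h1, h2⟩ := abs_le.1 h
    have hR' : -(1 / 5) ≤ a / (1 - a) := by
      rw [le_div_iff₀ (by linarith)]; linarith
    exact ⟨by linarith, by linarith, by linarith⟩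
  · obtain ⟨h1, h2⟩ := abs_le.1 h
    have hS' : 18 / 25 ≤ f / (1 - b) := by
      rw [le_div_iff₀ (by linarith)]; linarith
    exact ⟨by linarith, by linarith, by linarith⟩

variable {V : Type*} [NormedAddCommGroup V] [InnerProductSpace ℝ V]

/-- For small `|k|` the term `m` prevails, and for large `|k|` the part of `k z` orthogonal to `m`
does. The two estimates `1 ≤ E + (5/4)|k|` and `|k| β ≤ E` combine to the claim. -/
theorem norm_add_smul_perturbed_ge {m z : V} (hm : ‖m‖ = 1) (hz : ‖z‖ = 1) {β s : ℝ}
    (hβ0 : 0 < β)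
    (hβ : β ≤ ‖z - inner ℝ m z • m‖) (hs : |s| ≤ 1 / 4) (k : ℝ) :
    β / 3 ≤ ‖m + k • (z + s • m)‖ := by
  set E := ‖m + k • (z + s • m)‖ with hE
  have hE0 : 0 ≤ E := norm_nonneg _
  have hmm : inner ℝ m m = (1 : ℝ) := by rw [real_inner_self_eq_norm_sq, hm]; norm_num
  have h1 : |k| * β ≤ E := by
    have := norm_perp_le (a := m + k • (z + s • m)) hm
    have e : (m + k • (z + s • m)) - inner ℝ m (m + k • (z + s • m)) • m =
        k • (z - inner ℝ m z • m) := by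
      simp only [inner_add_right, inner_smul_right, hmm]
      module
    rw [e, norm_smul, Real.norm_eq_abs] at this
    exact (mul_le_mul_of_nonneg_left hβ (abs_nonneg k)).trans this
  have h2 : 1 ≤ E + |k| * (5 / 4) := by
    have h3 := abs_real_inner_le_norm m (m + k • (z + s • m))
    rw [hm, one_mul] at h3
    have h4 : |inner ℝ m z| ≤ (1 : ℝ) := by
      have := abs_real_inner_le_norm m z
      rwa [hm, hz, one_mul] at this
    have e : (1 : ℝ) = inner ℝ m (m + k • (z + s • m)) - k * (inner ℝ m z + s) := by
      simp only [inner_add_right, inner_smul_right, hmm]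
      ring
    have h5 : |k * (inner ℝ m z + s)| ≤ |k| * (5 / 4) := by
      rw [abs_mul]
      refine mul_le_mul_of_nonneg_left ((abs_add_le _ _).trans ?_) (abs_nonneg k)
      linarith
    have h6 : inner ℝ m (m + k • (z + s • m)) ≤ E := (le_abs_self _).trans h3
    have h7 := (abs_le.1 h5).1
    linarith
  have hβ1 : β ≤ 1 := hβ.trans ((norm_perp_le hm).trans hz.le)
  nlinarith [abs_nonneg k]

variable {V' : Type*} [NormedAddCommGroup V'] [InnerProductSpace ℝ V']
variable {X : Type*} [Fintype X] {T : Equiv.Perm X}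

/-- After a perturbation, two vectors become close modulo a third one. -/
theorem close_quotient {w' : X → V} (c : Compl w' V') {y : X} {a b m : V} {s t σ β α N N' : ℝ}
    (hm : ‖m‖ = 1) (hb : ‖b‖ = 1) (hβ0 : 0 < β) (hβ : β ≤ ‖b - inner ℝ m b • m‖)
    (hs : |s| ≤ 1 / 4) (hst : |t - s| = σ) (hσ : 0 < σ) (hab : ‖a - b‖ ≤ α)
    (hN : N ≠ 0) (hN' : N' ≠ 0)
    (hw' : w' y = N • (b + s • m)) {u' : V} (hu' : u' = N' • (a + t • m)) (hQu : c.Q y u' ≠ 0) :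
    Close (6 * α / (σ * β)) (‖c.Q y u'‖⁻¹ • c.Q y u') (‖c.Q y m‖⁻¹ • c.Q y m) := by
  have h1 : β / 3 ≤ ‖c.Q y m‖ := by
    rw [c.norm_Q_eq, hw', smul_smul]
    exact norm_add_smul_perturbed_ge hm hb hβ0 hβ hs _
  have h0 : 0 < ‖c.Q y m‖ := by linarith
  have h2 : c.Q y (b + s • m) = 0 := by
    have := c.Q_w y
    rw [hw', map_smul, smul_eq_zero] at this
    exact this.resolve_left hN
  -- Modulo `b + s m`, the vector `a + t m` equals `(t - s) m + (a - b)`. The direction of `m`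
  -- prevails, as `‖a - b‖ ≤ α` is to be compared with `σβ / 3`.
  have h3 : c.Q y (a + t • m) = (t - s) • c.Q y m + c.Q y (a - b) := by
    rw [← sub_zero (c.Q y (a + t • m)), ← h2, ← map_sub, ← map_smul, ← map_add]
    congr 1
    module
  have h4 : (N'⁻¹ * ‖c.Q y u'‖) • (‖c.Q y u'‖⁻¹ • c.Q y u') =
      ((t - s) * ‖c.Q y m‖) • (‖c.Q y m‖⁻¹ • c.Q y m) + c.Q y (a - b) := by
    rw [smul_smul, smul_smul, mul_assoc, mul_inv_cancel₀ (norm_ne_zero_iff.2 hQu), mul_one,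
      mul_assoc, mul_inv_cancel₀ h0.ne', mul_one, ← h3, ← map_smul]
    congr 1
    rw [hu', smul_smul, inv_mul_cancel₀ hN', one_smul]
  have hα0 : 0 ≤ α := (norm_nonneg _).trans hab
  have h5 := close_of_parallel (ρ := 3 * α / (σ * β))
    (a := ‖c.Q y m‖⁻¹ • c.Q y m) (b := ‖c.Q y u'‖⁻¹ • c.Q y u')
    (norm_smul_inv_norm (𝕜 := ℝ) (norm_pos_iff.1 h0)) (norm_smul_inv_norm (𝕜 := ℝ) hQu)
    (mul_ne_zero (fun h => by rw [h, abs_zero] at hst; linarith) h0.ne') h4 (by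
      rw [abs_mul, hst, abs_of_pos h0]
      refine (c.norm_Q y _).trans (hab.trans ?_)
      rw [div_mul_eq_mul_div, le_div_iff₀ (by positivity)]
      nlinarith [mul_nonneg hα0 hσ.le])
  refine h5.symm.mono (le_of_eq ?_)
  ring

variable [FiniteDimensional ℝ V] {A B : X → V →L[ℝ] V} {K e : ℝ}

theorem Compl.Q_ne_zero {w m : X → V} (c : Compl w V') (hT : IsCyclic T) {q r : X → ℝ} {ω μ : ℝ}
    (hw : IsEig T A w q ω) (hm : IsEig T A m r μ) (hne : μ ≠ ω) (x : X) : c.Q x (m x) ≠ 0 := by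
  intro h
  have h1 : m x ∈ LinearMap.ker (c.Q x : V →ₗ[ℝ] V') := h
  rw [c.ker_Q, Submodule.mem_span_singleton] at h1
  obtain ⟨a, ha⟩ := h1
  have h2 := hm.ret hT x
  rw [← ha, map_smul, hw.ret hT, smul_comm, ← sub_eq_zero, ← sub_smul, ha] at h2
  rcases smul_eq_zero.1 h2 with h2 | h2
  · exact hne (by linarith)
  · exact hm.ne_zero x h2

/-- If two eigenfields are close at a site, then a perturbation which keeps the spectrum makes
each of them close to a third eigenfield of intermediate eigenvalue, modulo the other one. -/
theorem exists_close_modulo (hT : IsCyclic T) (hA : Bdd A K) (hK1 : 1 ≤ K)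
    (hKe : K * e ≤ 1 / 2) (he0 : 0 < e) {u m w : X → V} {p r q : X → ℝ} {μ ν ω : ℝ}
    (hu : IsEig T A u p μ) (hm : IsEig T A m r ν) (hw : IsEig T A w q ω)
    (hμν : |μ| < |ν|) (hνω : |ν| < |ω|) (hgap : 4 * |μ| ≤ |ν| ∨ 4 * |ν| ≤ |ω|)
    {β α : ℝ} (hβ0 : 0 < β) {y : X} (hβ : β ≤ ‖u y - inner ℝ (m y) (u y) • m y‖)
    (hα : ‖u y - w y‖ ≤ α) (hαβ : 10 * α ≤ β) :
    ∃ B u' w' p' q', CReach T A B e ∧ IsEig T B u' p' μ ∧ IsEig T B m r ν ∧ IsEig T B w' q' ω ∧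
      (∀ c : Compl w' V', Close (80 * K * α / (e * β ^ 2))
        (‖c.Q y (u' y)‖⁻¹ • c.Q y (u' y)) (‖c.Q y (m y)‖⁻¹ • c.Q y (m y))) ∧
      (∀ c : Compl u' V', Close (80 * K * α / (e * β ^ 2))
        (‖c.Q y (w' y)‖⁻¹ • c.Q y (w' y)) (‖c.Q y (m y)‖⁻¹ • c.Q y (m y))) := by
  have hα0 : 0 ≤ α := (norm_nonneg _).trans hα
  have hK : 0 < K := by linarith
  obtain ⟨φ, hφu, hφm, hφn⟩ := exists_dual (hm.unit y) hβ0 hβ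
  have hν0 : ν ≠ 0 := by
    intro h; rw [h, abs_zero] at hμν; exact absurd (abs_nonneg μ) (not_le.2 hμν)
  have hω0 : ω ≠ 0 := by
    intro h; rw [h, abs_zero] at hνω; exact absurd (abs_nonneg ν) (not_le.2 hνω)
  have hνp := abs_pos.2 hν0
  have hωp := abs_pos.2 hω0
  have hβ1 : β ≤ 1 := hβ.trans ((norm_perp_le (hm.unit y)).trans (hu.unit y).le)
  set f := φ (w y) with hf
  have hf1 : |f - 1| ≤ 1 / 10 := by
    have h1 : f - 1 = φ (w y - u y) := by rw [map_sub, hφu]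
    rw [h1]
    have h2 := φ.le_opNorm (w y - u y)
    rw [Real.norm_eq_abs, norm_sub_rev] at h2
    refine h2.trans ((mul_le_mul hφn hα (norm_nonneg _) (by positivity)).trans ?_)
    rw [inv_mul_le_iff₀ hβ0]; linarith
  obtain ⟨hS0, hΘ, hSΘ⟩ := transfer_bounds (a := μ / ν) (b := ν / ω) (f := f)
    (by rw [abs_div, div_lt_one hνp]; exact hμν) (by rw [abs_div, div_lt_one hωp]; exact hνω) hf1
    (hgap.imp (fun h => by rw [abs_div, div_le_iff₀ hνp]; linarith)
      (fun h => by rw [abs_div, div_le_iff₀ hωp]; linarith))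
  set S := f / (1 - ν / ω) with hS
  set R := μ / ν / (1 - μ / ν) with hR
  -- The relative displacement `s - t` of the two outer eigenvectors along `m`. Since the shear
  -- coefficient is at most `5σ`, the perturbation has size at most `e / 2`.
  set σ := e * β / (10 * K) with hσ
  have hσ0 : 0 < σ := by positivity
  have he1 : e ≤ 1 / 2 := by nlinarith
  have hσ1 : σ ≤ 1 / 20 := by
    rw [hσ, div_le_iff₀ (by positivity)]
    nlinarith
  set c₀ := σ / (S + R) with hc₀
  have hΘ0 : 0 < S + R := by linarith
  have hc₀p : 0 < c₀ := by positivity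
  have hc₀5 : c₀ ≤ 5 * σ := by rw [hc₀, div_le_iff₀ hΘ0]; nlinarith
  -- By `ret_shear`, the shear with coefficient `c₀` displaces `w` by `s` and `u` by `t` along `m`.
  -- The displacements differ because the eigenvalues do, and `c₀` makes the difference equal to
  -- `σ`.
  set s := c₀ * S with hs
  set t := -(c₀ * R) with ht
  have hst : s - t = σ := by
    rw [hs, ht, hc₀]; field_simp; ring
  have hs0 : 0 < s := mul_pos hc₀p hS0
  have hs4 : s ≤ 4 * σ := by
    rw [hs, hc₀, div_mul_eq_mul_div, div_le_iff₀ hΘ0]; nlinarith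
  have hsb : |s| ≤ 1 / 4 := by rw [abs_of_pos hs0]; linarith
  have htb : |t| ≤ 1 / 4 := by rw [abs_le]; constructor <;> linarith
  obtain ⟨x₀, rfl⟩ : ∃ x₀, T x₀ = y := T.surjective y
  have hων : ω - ν ≠ 0 := fun h => by
    rw [sub_eq_zero.1 h] at hνω; exact lt_irrefl _ hνω
  have hνμ : ν - μ ≠ 0 := fun h => by
    rw [sub_eq_zero.1 h] at hμν; exact lt_irrefl _ hμν
  have r1 : CReach T A (shear T A m x₀ φ c₀) e := by
    refine creach_shear hT hA hK.le hm hφm hφn ?_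
    rw [abs_of_pos hc₀p]
    calc c₀ * β⁻¹ * K ≤ 5 * σ * β⁻¹ * K := by gcongr
      _ = e / 2 := by rw [hσ]; field_simp; ring
      _ < e := by linarith
  have hB : Bdd (shear T A m x₀ φ c₀) (2 * K) := hA.near_two hK1 hKe fun x => (r1.norm_sub x).le
  have hm' := isEig_shear hm hφm c₀
  have ew : ret T (shear T A m x₀ φ c₀) (T x₀) (w (T x₀) + s • m (T x₀)) =
      ω • (w (T x₀) + s • m (T x₀)) :=
    ret_shear hT hm hφm (hw.ret hT _) (by
      have h1 : 1 - ν / ω = (ω - ν) / ω := by field_simp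
      rw [← hf, hs, hS, h1]; field_simp)
  have eu : ret T (shear T A m x₀ φ c₀) (T x₀) (u (T x₀) + t • m (T x₀)) =
      μ • (u (T x₀) + t • m (T x₀)) :=
    ret_shear hT hm hφm (hu.ret hT _) (by
      have h1 : 1 - μ / ν = (ν - μ) / ν := by field_simp
      rw [hφu, ht, hR, h1]; field_simp; ring)
  have hune : u (T x₀) + t • m (T x₀) ≠ 0 := fun h0 => by
    have := congrArg φ h0
    simp [hφu, hφm] at this
  have hwne : w (T x₀) + s • m (T x₀) ≠ 0 := fun h0 => by
    have := congrArg φ h0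
    simp only [map_add, map_smul, hφm, smul_zero, add_zero, map_zero, ← hf] at this
    rw [this] at hf1
    norm_num at hf1
  obtain ⟨u', p', hu', hu'y⟩ := exists_isEig_of_eigenvector hT hB hune eu
  obtain ⟨w', q', hw', hw'y⟩ := exists_isEig_of_eigenvector hT hB hwne ew
  have hωμ : ω ≠ μ := fun h => by rw [h] at hνω; exact lt_irrefl _ (hμν.trans hνω)
  have hβw : 9 / 10 * β ≤ ‖w (T x₀) - inner ℝ (m (T x₀)) (w (T x₀)) • m (T x₀)‖ := by
    have h1 := norm_perp_le (a := u (T x₀) - w (T x₀)) (hm.unit (T x₀))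
    have h2 : u (T x₀) - inner ℝ (m (T x₀)) (u (T x₀)) • m (T x₀) =
        (w (T x₀) - inner ℝ (m (T x₀)) (w (T x₀)) • m (T x₀)) +
        ((u (T x₀) - w (T x₀)) - inner ℝ (m (T x₀)) (u (T x₀) - w (T x₀)) • m (T x₀)) := by
      rw [inner_sub_right]; module
    have h3 := norm_add_le (w (T x₀) - inner ℝ (m (T x₀)) (w (T x₀)) • m (T x₀))
      ((u (T x₀) - w (T x₀)) - inner ℝ (m (T x₀)) (u (T x₀) - w (T x₀)) • m (T x₀))
    rw [← h2] at h3
    linarith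
  have hle : 6 * α / (σ * (9 / 10 * β)) ≤ 80 * K * α / (e * β ^ 2) := by
    rw [hσ, div_le_div_iff₀ (by positivity) (by positivity)]
    have : 6 * α * (e * β ^ 2) * (10 * K) ≤ 80 * K * α * (e * β * (9 / 10 * β)) := by
      nlinarith [show 0 ≤ α * e * β ^ 2 * K by positivity]
    calc 6 * α * (e * β ^ 2) = 6 * α * (e * β ^ 2) * (10 * K) / (10 * K) := by field_simp
      _ ≤ 80 * K * α * (e * β * (9 / 10 * β)) / (10 * K) := by gcongr
      _ = _ := by ring
  have hn1 : ‖u (T x₀) + t • m (T x₀)‖⁻¹ ≠ 0 := inv_ne_zero (norm_ne_zero_iff.2 hune)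
  have hn2 : ‖w (T x₀) + s • m (T x₀)‖⁻¹ ≠ 0 := inv_ne_zero (norm_ne_zero_iff.2 hwne)
  refine ⟨_, u', w', p', q', r1, hu', hm', hw', fun c => ?_, fun c => ?_⟩
  · exact (close_quotient c (hm.unit _) (hw.unit _) (by positivity) hβw hsb
      (by rw [abs_sub_comm, hst, abs_of_pos hσ0]) hσ0 hα hn2 hn1 hw'y hu'y
      (c.Q_ne_zero hT hw' hu' hωμ.symm _)).mono hle
  · refine (close_quotient c (hm.unit _) (hu.unit _) (β := 9 / 10 * β) (by positivity)
      (by linarith) htb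
      (by rw [hst, abs_of_pos hσ0]) hσ0 (by rwa [norm_sub_rev]) hn1 hn2 hu'y hw'y
      (c.Q_ne_zero hT hu' hw' hωμ _)).mono hle

end Transfer

end FibreCocycle

namespace FibreCocycle

/-! ### Exponential domination and its extension through quotients by lines -/

section Domination

variable {X : Type*} [Fintype X] {T : Equiv.Perm X}
variable {V : Type*} [NormedAddCommGroup V] [InnerProductSpace ℝ V] [FiniteDimensional ℝ V]
  {A B : X → V →L[ℝ] V} {K C κ κ' D : ℝ} {F G : X → Submodule ℝ V}

/-- Exponential domination of `F` by `G`. -/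
def ExpDom (T : Equiv.Perm X) (A : X → V →L[ℝ] V) (F G : X → Submodule ℝ V) (C κ : ℝ) : Prop :=
  ∀ N x, ∀ f ∈ F x, ∀ g ∈ G x, ‖cp T A N x f‖ * ‖g‖ ≤ C * κ ^ N * (‖cp T A N x g‖ * ‖f‖)

/-- A field of subspaces mapped into itself. -/
def Inv (T : Equiv.Perm X) (A : X → V →L[ℝ] V) (F : X → Submodule ℝ V) : Prop :=
  ∀ x, ∀ v ∈ F x, A x v ∈ F (T x)

theorem Inv.cp (h : Inv T A F) (N : ℕ) (x : X) {v : V} (hv : v ∈ F x) :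
    cp T A N x v ∈ F (T^[N] x) := by
  induction N with
  | zero => exact hv
  | succ N ih => rw [cp_succ_apply', Function.iterate_succ_apply']; exact h _ _ ih

/-- `F` is dominated by `G` at time `ℓ`. -/
def Dom (T : Equiv.Perm X) (A : X → V →L[ℝ] V) (F G : X → Submodule ℝ V) (ℓ : ℕ) : Prop :=
  ∀ x, ∀ f ∈ F x, ∀ g ∈ G x, 2 * (‖cp T A ℓ x f‖ * ‖g‖) ≤ ‖cp T A ℓ x g‖ * ‖f‖

/-- Each full block of `ℓ` steps gains a factor `2`. The incomplete block costs at most `K^{2ℓ}`,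
and the factor `2` in the constant makes up for its missing decay. -/
theorem Dom.expDom {ℓ : ℕ} (h : Dom T A F G ℓ) (hA : Bdd A K) (hK : 1 ≤ K) (hF : Inv T A F)
    (hG : Inv T A G) (hℓ : 0 < ℓ) (hκ : 0 ≤ κ) (hκ1 : κ ≤ 1) (hκℓ : κ ^ ℓ = 1 / 2) :
    ExpDom T A F G (2 * K ^ (2 * ℓ)) κ := by
  have key : ∀ a x, ∀ f ∈ F x, ∀ g ∈ G x,
      2 ^ a * (‖cp T A (ℓ * a) x f‖ * ‖g‖) ≤ ‖cp T A (ℓ * a) x g‖ * ‖f‖ := by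
    intro a x f hf g hg
    induction a with
    | zero => simp [cp, mul_comm]
    | succ a ih =>
      rcases eq_or_ne g 0 with rfl | hg0
      · simp
      have hℓa : ℓ * (a + 1) = ℓ + ℓ * a := by ring
      rw [hℓa, cp_add_apply, cp_add_apply]
      have h1 := h _ _ (hF.cp (ℓ * a) x hf) _ (hG.cp (ℓ * a) x hg)
      have h2 : 0 < ‖cp T A (ℓ * a) x g‖ := by
        have := (hA.cp (T := T) (by linarith) (ℓ * a) x g).2
        by_contra! h0
        have h3 := norm_le_zero_iff.1 h0
        rw [h3, norm_zero, mul_zero] at this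
        exact hg0 (norm_le_zero_iff.1 this)
      set f' := cp T A (ℓ * a) x f
      set g' := cp T A (ℓ * a) x g
      set y := T^[ℓ * a] x
      have h3 : (2 ^ (a + 1) * (‖cp T A ℓ y f'‖ * ‖g‖)) * ‖g'‖ ≤
          (‖cp T A ℓ y g'‖ * ‖f‖) * ‖g'‖ := by
        calc (2 ^ (a + 1) * (‖cp T A ℓ y f'‖ * ‖g‖)) * ‖g'‖
            = (2 * (‖cp T A ℓ y f'‖ * ‖g'‖)) * (2 ^ a * ‖g‖) := by ring
          _ ≤ (‖cp T A ℓ y g'‖ * ‖f'‖) * (2 ^ a * ‖g‖) := by gcongr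
          _ = ‖cp T A ℓ y g'‖ * (2 ^ a * (‖f'‖ * ‖g‖)) := by ring
          _ ≤ ‖cp T A ℓ y g'‖ * (‖g'‖ * ‖f‖) := by gcongr
          _ = _ := by ring
      exact le_of_mul_le_mul_right h3 h2
  intro N x f hf g hg
  obtain ⟨a, r, hr, rfl⟩ : ∃ a r, r < ℓ ∧ N = r + ℓ * a :=
    ⟨N / ℓ, N % ℓ, Nat.mod_lt _ hℓ, (Nat.mod_add_div N ℓ).symm⟩
  rw [cp_add_apply, cp_add_apply]
  have h1 := key a x f hf g hg
  set f' := cp T A (ℓ * a) x f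
  set g' := cp T A (ℓ * a) x g
  set y := T^[ℓ * a] x
  have h2 := (hA.cp (T := T) (by linarith) r y f').1
  have h3 := (hA.cp (T := T) (by linarith) r y g').2
  have h4 : (2 : ℝ) * κ ^ (r + ℓ * a) ≥ (1 / 2) ^ a := by
    rw [pow_add, pow_mul, hκℓ]
    have : κ ^ ℓ ≤ κ ^ r := pow_le_pow_of_le_one hκ hκ1 hr.le
    rw [hκℓ] at this
    nlinarith [show (0 : ℝ) < (1 / 2) ^ a by positivity]
  have h5 : K ^ r * K ^ r ≤ K ^ (2 * ℓ) := by
    rw [← pow_add]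
    exact pow_le_pow_right₀ hK (by omega)
  calc ‖cp T A r y f'‖ * ‖g‖ ≤ K ^ r * ‖f'‖ * ‖g‖ := by gcongr
    _ = K ^ r * (1 / 2) ^ a * (2 ^ a * (‖f'‖ * ‖g‖)) := by
        have : ((1 : ℝ) / 2) ^ a * 2 ^ a = 1 := by rw [← mul_pow]; norm_num
        linear_combination -(K ^ r * (‖f'‖ * ‖g‖)) * this
    _ ≤ K ^ r * (1 / 2) ^ a * (‖g'‖ * ‖f‖) := by gcongr
    _ ≤ K ^ r * (1 / 2) ^ a * (K ^ r * ‖cp T A r y g'‖ * ‖f‖) := by gcongr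
    _ = (K ^ r * K ^ r) * (1 / 2) ^ a * (‖cp T A r y g'‖ * ‖f‖) := by ring
    _ ≤ K ^ (2 * ℓ) * (2 * κ ^ (r + ℓ * a)) * (‖cp T A r y g'‖ * ‖f‖) := by gcongr
    _ = _ := by ring

theorem ExpDom.mono (h : ExpDom T A F G C κ) {C' κ' : ℝ} (hC : 0 ≤ C) (hCC : C ≤ C') (hκ : 0 ≤ κ)
    (hκκ : κ ≤ κ') : ExpDom T A F G C' κ' := by
  intro N x f hf g hg
  have := hC.trans hCC
  exact (h N x f hf g hg).trans (by gcongr)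

/-- Domination bounds the angle from below: if `f` and `g` were almost equal, so would be their
images after the bounded time `N`, whereas one is at most half the other relative to the initial
norms. -/
theorem ExpDom.angle (h : ExpDom T A F G C κ) (hA : Bdd A K) (hK : 1 ≤ K) {N : ℕ}
    (hN : C * κ ^ N ≤ 1 / 2) {x : X} {f g : V} (hf : f ∈ F x) (hg : g ∈ G x) :
    ‖f‖ ≤ 3 * K ^ (2 * N) * ‖f - g‖ := by
  rcases eq_or_ne f 0 with rfl | hf0
  · rw [norm_zero]; positivity
  have hfp := norm_pos_iff.2 hf0
  have h1 := h N x f hf g hg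
  obtain ⟨h2, h3⟩ := hA.cp (T := T) (by linarith) N x f
  have h4 := (hA.cp (T := T) (by linarith) N x (f - g)).1
  rw [map_sub] at h4
  have h5 := norm_sub_norm_le (cp T A N x g) (cp T A N x f)
  rw [norm_sub_rev] at h5
  have h6 := norm_sub_norm_le f g
  have h7 : ‖cp T A N x f‖ * ‖g‖ ≤ 1 / 2 * (‖cp T A N x g‖ * ‖f‖) :=
    h1.trans (by gcongr)
  have hKN : 0 < K ^ N := by positivity
  have h8 : ‖cp T A N x f‖ * ‖f‖ ≤ 3 * K ^ N * ‖f - g‖ * ‖f‖ := by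
    have e1 : ‖cp T A N x f‖ * (‖f‖ - ‖f - g‖) ≤
        1 / 2 * ((‖cp T A N x f‖ + K ^ N * ‖f - g‖) * ‖f‖) :=
      calc _ ≤ ‖cp T A N x f‖ * ‖g‖ := by gcongr; linarith
        _ ≤ 1 / 2 * (‖cp T A N x g‖ * ‖f‖) := h7
        _ ≤ _ := by gcongr; linarith
    have e2 : ‖cp T A N x f‖ * ‖f - g‖ ≤ K ^ N * ‖f‖ * ‖f - g‖ := by gcongr
    nlinarith
  have h9 := le_of_mul_le_mul_right h8 hfp
  calc ‖f‖ ≤ K ^ N * ‖cp T A N x f‖ := h3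
    _ ≤ K ^ N * (3 * K ^ N * ‖f - g‖) := by gcongr
    _ = _ := by rw [two_mul, pow_add]; ring

theorem ExpDom.angle_right (h : ExpDom T A F G C κ) (hA : Bdd A K) (hK : 1 ≤ K) {N : ℕ}
    (hN : C * κ ^ N ≤ 1 / 2) {x : X} {f g : V} (hf : f ∈ F x) (hg : g ∈ G x) :
    ‖g‖ ≤ (3 * K ^ (2 * N) + 1) * ‖f - g‖ := by
  have h1 := h.angle hA hK hN hf hg
  have h2 := norm_sub_norm_le g f
  rw [norm_sub_rev] at h2
  linarith

variable {w : X → V} {q : X → ℝ} {ω : ℝ}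

theorem expDom_line_iff (hw : IsEig T A w q ω) :
    ExpDom T A F (fun x => ℝ ∙ w x) C κ ↔
      ∀ N x, ∀ f ∈ F x, ‖cp T A N x f‖ ≤ C * κ ^ N * (|pp T q N x| * ‖f‖) := by
  constructor
  · intro h N x f hf
    have := h N x f hf (w x) (Submodule.mem_span_singleton_self _)
    rwa [hw.unit, mul_one, ← hw.abs_pp_eq] at this
  · intro h N x f hf g hg
    obtain ⟨b, rfl⟩ := Submodule.mem_span_singleton.1 hg
    rw [norm_smul, map_smul, norm_smul, hw.unit, ← hw.abs_pp_eq]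
    have := mul_le_mul_of_nonneg_right (h N x f hf) (norm_nonneg b)
    nlinarith

theorem inv_line (hw : IsEig T A w q ω) : Inv T A fun x => ℝ ∙ w x := by
  intro x v hv
  obtain ⟨b, rfl⟩ := Submodule.mem_span_singleton.1 hv
  rw [map_smul, hw.map]
  exact Submodule.smul_mem _ _ (Submodule.smul_mem _ _ (Submodule.mem_span_singleton_self _))

variable {V' : Type*} [NormedAddCommGroup V'] [InnerProductSpace ℝ V'] [FiniteDimensional ℝ V']
  {F' G' : X → Submodule ℝ V'}

/-- The coordinate along the eigenline is multiplied by `q` at each step, up to an error controlled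
by the quotient. Both extension results unroll this recursion. -/
theorem Compl.coord_succ (c : Compl w V') (hA : Bdd A K) (hw : IsEig T A w q ω) (x : X) (v : V) :
    |inner ℝ (w (T x)) (A x v) - inner ℝ (w x) v * q x| ≤ K * ‖c.Q x v‖ := by
  have h1 : inner ℝ (w (T x)) (A x v) - inner ℝ (w x) v * q x =
      inner ℝ (w (T x)) (A x (c.J x (c.Q x v))) := by
    conv_lhs => enter [1]; rw [c.decomp x v]
    rw [map_add, map_smul, hw.map, inner_add_right, inner_smul_right, inner_smul_right,
      real_inner_self_eq_norm_sq, hw.unit]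
    ring
  rw [h1]
  refine (abs_real_inner_le_norm _ _).trans ?_
  rw [hw.unit, one_mul]
  refine ((hA _ _).1).trans ?_
  rw [(c.J x).norm_map]

theorem Compl.norm_le_coord (c : Compl w V') (hw : ∀ x, ‖w x‖ = 1) (x : X) (v : V) :
    ‖v‖ ≤ |inner ℝ (w x) v| + ‖c.Q x v‖ := by
  conv_lhs => rw [c.decomp x v]
  refine (norm_add_le _ _).trans ?_
  rw [norm_smul, hw, mul_one, (c.J x).norm_map, Real.norm_eq_abs]

theorem Compl.abs_coord_le (hw : ∀ x, ‖w x‖ = 1) (x : X) (v : V) :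
    |inner ℝ (w x) v| ≤ ‖v‖ := by
  have := abs_real_inner_le_norm (w x) v
  rwa [hw, one_mul] at this

/-- The constant in the extension of domination. -/
noncomputable def extC (K C κ D : ℝ) (N : ℕ) : ℝ :=
  C + (3 * K ^ (2 * N) + 1) * C + D * ((3 * K ^ (2 * N) + 1) * C ^ 2 * K ^ 2 / κ)

/-- If `F` is dominated by a line of `G`, and by `G` modulo that line, then it is dominated
by `G`. -/
theorem ExpDom.extend_right (c : Compl w V') (hA : Bdd A K) (hK : 1 ≤ K) (hw : IsEig T A w q ω)
    (hF : Inv T A F) (hFF : ∀ x, ∀ v ∈ F x, c.Q x v ∈ F' x)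
    (hGG : ∀ x, ∀ v ∈ G x, c.Q x v ∈ G' x) (hG : Inv T A G)
    (h₁ : ExpDom T A F (fun x => ℝ ∙ w x) C κ) (h₂ : ExpDom T (c.quot T A) F' G' C κ)
    (hC : 0 ≤ C) (hκ : 0 < κ) (hκ1 : κ ≤ 1) {N₀ : ℕ} (hN₀ : C * κ ^ N₀ ≤ 1 / 2) (hκκ : κ ≤ κ')
    (hD : ∀ N : ℕ, N * κ ^ N ≤ D * κ' ^ N) :
    ExpDom T A F G (extC K C κ D N₀) κ' := by
  set M := 3 * K ^ (2 * N₀) + 1 with hM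
  have hM0 : 0 < M := by positivity
  -- By domination `F` makes a definite angle with the line of `w`, so on `F` the norm is comparable
  -- to that of the quotient.
  have hang : ∀ x, ∀ f ∈ F x, ‖f‖ ≤ M * ‖c.Q x f‖ := by
    intro x f hf
    have := h₁.angle hA hK hN₀ hf (Submodule.smul_mem (ℝ ∙ w x) (inner ℝ (w x) f)
      (Submodule.mem_span_singleton_self _))
    rw [c.norm_Q_eq, neg_smul, ← sub_eq_add_neg]
    refine this.trans ?_
    gcongr
    linarith
  rw [expDom_line_iff hw] at h₁
  intro N x f hf g hg
  set a : ℕ → ℝ := fun k => inner ℝ (w (T^[k] x)) (cp T A k x g) with ha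
  set gb : ℕ → ℝ := fun k => ‖c.Q (T^[k] x) (cp T A k x g)‖ with hgb
  have hq0 : ∀ k, 0 < |pp T q k x| := fun k => abs_pos.2 (hw.pp_ne hA k x)
  -- The recursion for the coordinate of `g` along `w`, divided by the multipliers and read from
  -- time `n` back to time `0`.
  have hsum : ∀ n, |a 0| ≤ |a n| / |pp T q n x| +
      ∑ k ∈ Finset.range n, K * gb k / |pp T q (k + 1) x| := by
    intro n
    induction n with
    | zero => simp [pp_zero]
    | succ n ih =>
      refine ih.trans ?_
      rw [Finset.sum_range_succ, add_comm (∑ k ∈ Finset.range n, _), ← add_assoc]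
      gcongr
      rw [← add_div, div_le_div_iff₀ (hq0 n) (hq0 (n + 1)), pp_succ, abs_mul]
      have h1 := c.coord_succ hA hw (T^[n] x) (cp T A n x g)
      rw [← cp_succ_apply', ← Function.iterate_succ_apply' T n x] at h1
      have h2 : |a n * q (T^[n] x)| ≤ |a (n + 1)| + K * gb n := by
        have := abs_sub_abs_le_abs_sub (a n * q (T^[n] x)) (a (n + 1))
        rw [abs_sub_comm] at this
        linarith
      rw [abs_mul] at h2
      calc |a n| * (|pp T q n x| * |q (T^[n] x)|) = (|a n| * |q (T^[n] x)|) * |pp T q n x| := by ring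
        _ ≤ _ := by gcongr
  have hgN : |a N| ≤ ‖cp T A N x g‖ := Compl.abs_coord_le hw.unit _ _
  have hgbN : gb N ≤ ‖cp T A N x g‖ := c.norm_Q _ _
  have hterm : ∀ k ≤ N, ‖cp T A N x f‖ * gb k ≤
      M * (C * κ ^ (N - k)) * (‖cp T A N x g‖ * ‖cp T A k x f‖) := by
    intro k hk
    obtain ⟨j, rfl⟩ := Nat.exists_eq_add_of_le' hk
    rw [Nat.add_sub_cancel]
    have hfk := hF.cp k x hf
    have hgk := hG.cp k x hg
    have h3 := h₂ j (T^[k] x) _ (hFF _ _ hfk) _ (hGG _ _ hgk)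
    rw [c.cp_quot_Q hw.map, c.cp_quot_Q hw.map, ← cp_add_apply, ← cp_add_apply,
      ← Function.iterate_add_apply] at h3
    have h4 := hang _ _ (hF.cp (j + k) x hf)
    calc ‖cp T A (j + k) x f‖ * gb k
        ≤ M * ‖c.Q (T^[j + k] x) (cp T A (j + k) x f)‖ * gb k := by gcongr
      _ = M * (‖c.Q (T^[j + k] x) (cp T A (j + k) x f)‖ * gb k) := by ring
      _ ≤ M * (C * κ ^ j * (gb (j + k) * ‖c.Q (T^[k] x) (cp T A k x f)‖)) := by gcongr
      _ ≤ M * (C * κ ^ j * (‖cp T A (j + k) x g‖ * ‖cp T A k x f‖)) := by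
          gcongr
          exact c.norm_Q _ _
      _ = _ := by ring
  -- Domination by the line is used before time `k`, domination in the quotient after it, so each of
  -- the `N` terms is `O(κ^N)`. The factor `N` is absorbed by passing to the rate `κ'`.
  have hterm' : ∀ k ∈ Finset.range N, ‖cp T A N x f‖ * (K * gb k / |pp T q (k + 1) x|) ≤
      M * C ^ 2 * K ^ 2 * κ ^ N * (‖cp T A N x g‖ * ‖f‖) := by
    intro k hk
    have hk := Finset.mem_range.1 hk
    have h1 := hterm k hk.le
    have h2 := h₁ k x f hf
    have h3 := (hw.bounds hA (T^[k] x)).2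
    have h4 : κ ^ (N - k) * κ ^ k = κ ^ N := by rw [← pow_add]; congr 1; omega
    rw [mul_div_assoc', div_le_iff₀ (hq0 _), pp_succ, abs_mul]
    calc ‖cp T A N x f‖ * (K * gb k) = K * (‖cp T A N x f‖ * gb k) := by ring
      _ ≤ K * (M * (C * κ ^ (N - k)) * (‖cp T A N x g‖ * ‖cp T A k x f‖)) := by gcongr
      _ ≤ K * (M * (C * κ ^ (N - k)) * (‖cp T A N x g‖ *
            (C * κ ^ k * (|pp T q k x| * ‖f‖)))) := by gcongr
      _ = K * M * C ^ 2 * (κ ^ (N - k) * κ ^ k) * (‖cp T A N x g‖ * ‖f‖) * |pp T q k x| * 1 := by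
          ring
      _ ≤ K * M * C ^ 2 * (κ ^ (N - k) * κ ^ k) * (‖cp T A N x g‖ * ‖f‖) * |pp T q k x| *
            (K * |q (T^[k] x)|) := by gcongr
      _ = _ := by rw [h4]; ring
  have hfirst : ‖cp T A N x f‖ * (|a N| / |pp T q N x|) ≤ C * κ ^ N * (‖cp T A N x g‖ * ‖f‖) := by
    rw [mul_div_assoc', div_le_iff₀ (hq0 _)]
    calc ‖cp T A N x f‖ * |a N| ≤ (C * κ ^ N * (|pp T q N x| * ‖f‖)) * ‖cp T A N x g‖ := by
          gcongr; exact h₁ N x f hf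
      _ = _ := by ring
  have hlast := hterm 0 (Nat.zero_le _)
  rw [Nat.sub_zero] at hlast
  have hg0 := c.norm_le_coord hw.unit x g
  have hκN : κ ^ N ≤ κ' ^ N := by gcongr
  set Z := ‖cp T A N x g‖ * ‖f‖ with hZ
  have hZ0 : 0 ≤ Z := by positivity
  have hKκ : K ^ 2 ≤ K ^ 2 / κ := by
    rw [le_div_iff₀ hκ]; nlinarith [sq_nonneg K]
  calc ‖cp T A N x f‖ * ‖g‖ ≤ ‖cp T A N x f‖ * (|a 0| + gb 0) := by gcongr; exact hg0
    _ ≤ ‖cp T A N x f‖ * ((|a N| / |pp T q N x| +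
          ∑ k ∈ Finset.range N, K * gb k / |pp T q (k + 1) x|) + gb 0) := by
        gcongr; exact hsum N
    _ = ‖cp T A N x f‖ * (|a N| / |pp T q N x|) +
          ∑ k ∈ Finset.range N, ‖cp T A N x f‖ * (K * gb k / |pp T q (k + 1) x|) +
          ‖cp T A N x f‖ * gb 0 := by rw [mul_add, mul_add, Finset.mul_sum]
    _ ≤ C * κ ^ N * Z + ∑ k ∈ Finset.range N, M * C ^ 2 * K ^ 2 * κ ^ N * Z +
          M * (C * κ ^ N) * Z := by
        refine add_le_add (add_le_add hfirst (Finset.sum_le_sum hterm')) ?_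
        simpa [cp] using hlast
    _ = (C * κ ^ N + M * C * κ ^ N + (N * κ ^ N) * (M * C ^ 2 * K ^ 2)) * Z := by
        rw [Finset.sum_const, Finset.card_range, nsmul_eq_mul]; ring
    _ ≤ (C * κ' ^ N + M * C * κ' ^ N + (D * κ' ^ N) * (M * C ^ 2 * (K ^ 2 / κ))) * Z := by
        have hDN := hD N
        have : 0 ≤ D * κ' ^ N := le_trans (by positivity) hDN
        gcongr
    _ = extC K C κ D N₀ * κ' ^ N * Z := by rw [extC, ← hM]; ring

variable {u : X → V} {p : X → ℝ} {μ : ℝ}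

/-- If a line of `F`, and `F` modulo that line, are dominated by a line, then so is `F`. -/
theorem ExpDom.extend_left (c : Compl u V') (hA : Bdd A K) (hK : 1 ≤ K) (hu : IsEig T A u p μ)
    (hw : IsEig T A w q ω) (hFF : ∀ x, ∀ v ∈ F x, c.Q x v ∈ F' x)
    (hGG : ∀ x, c.Q x (w x) ∈ G' x)
    (h₁ : ExpDom T A (fun x => ℝ ∙ u x) (fun x => ℝ ∙ w x) C κ)
    (h₂ : ExpDom T (c.quot T A) F' G' C κ)
    (hC : 0 ≤ C) (hκ : 0 < κ) {N₀ : ℕ} (hN₀ : C * κ ^ N₀ ≤ 1 / 2) (hκκ : κ ≤ κ')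
    (hD : ∀ N : ℕ, N * κ ^ N ≤ D * κ' ^ N) :
    ExpDom T A F (fun x => ℝ ∙ w x) (extC K C κ D N₀) κ' := by
  set M := 3 * K ^ (2 * N₀) + 1 with hM
  have hM0 : 0 < M := by positivity
  have hang : ∀ x, 1 ≤ M * ‖c.Q x (w x)‖ := by
    intro x
    have := h₁.angle_right hA hK hN₀ (x := x) (Submodule.smul_mem (ℝ ∙ u x) (inner ℝ (u x) (w x))
      (Submodule.mem_span_singleton_self _)) (Submodule.mem_span_singleton_self (w x))
    rw [c.norm_Q_eq, neg_smul, ← sub_eq_add_neg, norm_sub_rev, ← hw.unit x]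
    exact this
  rw [expDom_line_iff hw] at h₁ ⊢
  intro N x f hf
  set a : ℕ → ℝ := fun k => inner ℝ (u (T^[k] x)) (cp T A k x f) with ha
  set fb : ℕ → ℝ := fun k => ‖c.Q (T^[k] x) (cp T A k x f)‖ with hfb
  have hp : ∀ k y, |pp T p k y| ≤ C * κ ^ k * |pp T q k y| := by
    intro k y
    have := h₁ k y (u y) (Submodule.mem_span_singleton_self _)
    rwa [← hu.abs_pp_eq, hu.unit, mul_one] at this
  have hfbk : ∀ k, fb k ≤ M * (C * κ ^ k * |pp T q k x|) * ‖f‖ := by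
    intro k
    have h3 := h₂ k x _ (hFF _ _ hf) _ (hGG x)
    rw [c.cp_quot_Q hu.map, c.cp_quot_Q hu.map, hw.cp, map_smul, norm_smul, Real.norm_eq_abs] at h3
    have h4 : ‖c.Q (T^[k] x) (w (T^[k] x))‖ ≤ 1 := (c.norm_Q _ _).trans (hw.unit _).le
    calc fb k = fb k * 1 := (mul_one _).symm
      _ ≤ fb k * (M * ‖c.Q x (w x)‖) := by gcongr; exact hang x
      _ = M * (fb k * ‖c.Q x (w x)‖) := by ring
      _ ≤ M * (C * κ ^ k * (|pp T q k x| * ‖c.Q (T^[k] x) (w (T^[k] x))‖ * ‖c.Q x f‖)) := by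
          gcongr
      _ ≤ M * (C * κ ^ k * (|pp T q k x| * 1 * ‖f‖)) := by gcongr; exact c.norm_Q _ _
      _ = _ := by ring
  -- Variation of constants: an error made at time `k` travels along the line of `u` for the
  -- remaining `n - 1 - k` steps.
  have hsum : ∀ n, |a n| ≤ |pp T p n x| * |a 0| +
      ∑ k ∈ Finset.range n, K * fb k * |pp T p (n - 1 - k) (T^[k + 1] x)| := by
    intro n
    induction n with
    | zero => simp [pp_zero]
    | succ n ih =>
      have h1 := c.coord_succ hA hu (T^[n] x) (cp T A n x f)
      rw [← cp_succ_apply', ← Function.iterate_succ_apply' T n x] at h1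
      have h2 : |a (n + 1)| ≤ |a n| * |p (T^[n] x)| + K * fb n := by
        have := abs_sub_abs_le_abs_sub (a (n + 1)) (a n * p (T^[n] x))
        rw [abs_mul] at this
        linarith
      refine h2.trans ?_
      rw [Finset.sum_range_succ, ← add_assoc]
      have e0 : n + 1 - 1 - n = 0 := by omega
      rw [e0, pp_zero, abs_one, mul_one]
      gcongr
      refine (mul_le_mul_of_nonneg_right ih (abs_nonneg _)).trans (le_of_eq ?_)
      rw [add_mul, Finset.sum_mul, pp_succ, abs_mul]
      congr 1
      · ring
      · refine Finset.sum_congr rfl fun k hk => ?_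
        have hk := Finset.mem_range.1 hk
        have e1 : n + 1 - 1 - k = (n - 1 - k) + 1 := by omega
        rw [e1, pp_succ, ← Function.iterate_add_apply, abs_mul]
        have e2 : n - 1 - k + (k + 1) = n := by omega
        rw [e2]; ring
  -- The line of `w` dominates the quotient part up to time `k`, and the line of `u` afterwards. The
  -- one step in between accounts for the factor `1 / κ` and one factor `K`.
  have hterm : ∀ k ∈ Finset.range N, K * fb k * |pp T p (N - 1 - k) (T^[k + 1] x)| ≤
      M * C ^ 2 * (K ^ 2 / κ) * κ ^ N * (|pp T q N x| * ‖f‖) := by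
    intro k hk
    have hk := Finset.mem_range.1 hk
    have h1 := hfbk k
    have h2 := hp (N - 1 - k) (T^[k + 1] x)
    have h3 := (hw.bounds hA (T^[k] x)).2
    have h4 : κ ^ k * κ ^ (N - 1 - k) = κ ^ N / κ := by
      rw [eq_div_iff hκ.ne', ← pow_add, ← pow_succ]; congr 1; omega
    have h5 : |pp T q N x| =
        |pp T q k x| * |q (T^[k] x)| * |pp T q (N - 1 - k) (T^[k + 1] x)| := by
      rw [← abs_mul, ← abs_mul, ← pp_succ, ← pp_add]
      congr 2; omega
    calc K * fb k * |pp T p (N - 1 - k) (T^[k + 1] x)|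
        ≤ K * (M * (C * κ ^ k * |pp T q k x|) * ‖f‖) *
          (C * κ ^ (N - 1 - k) * |pp T q (N - 1 - k) (T^[k + 1] x)|) := by gcongr
      _ = K * M * C ^ 2 * (κ ^ k * κ ^ (N - 1 - k)) *
          (|pp T q k x| * |pp T q (N - 1 - k) (T^[k + 1] x)| * ‖f‖) * 1 := by ring
      _ ≤ K * M * C ^ 2 * (κ ^ k * κ ^ (N - 1 - k)) *
          (|pp T q k x| * |pp T q (N - 1 - k) (T^[k + 1] x)| * ‖f‖) * (K * |q (T^[k] x)|) := by
          gcongr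
      _ = _ := by rw [h4, h5]; ring
  have hf0 : |a 0| ≤ ‖f‖ := Compl.abs_coord_le hu.unit x f
  have hfN := c.norm_le_coord hu.unit (T^[N] x) (cp T A N x f)
  have hκN : κ ^ N ≤ κ' ^ N := by gcongr
  set Z := |pp T q N x| * ‖f‖ with hZ
  have hZ0 : 0 ≤ Z := by positivity
  calc ‖cp T A N x f‖ ≤ |a N| + fb N := hfN
    _ ≤ (|pp T p N x| * |a 0| +
          ∑ k ∈ Finset.range N, K * fb k * |pp T p (N - 1 - k) (T^[k + 1] x)|) +
          M * (C * κ ^ N * |pp T q N x|) * ‖f‖ := add_le_add (hsum N) (hfbk N)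
    _ ≤ ((C * κ ^ N * |pp T q N x|) * ‖f‖ +
          ∑ k ∈ Finset.range N, M * C ^ 2 * (K ^ 2 / κ) * κ ^ N * Z) +
          M * (C * κ ^ N * |pp T q N x|) * ‖f‖ := by
        exact add_le_add (add_le_add (mul_le_mul (hp N x) hf0 (abs_nonneg _)
          ((abs_nonneg _).trans (hp N x))) (Finset.sum_le_sum hterm)) le_rfl
    _ = (C * κ ^ N + M * C * κ ^ N + (N * κ ^ N) * (M * C ^ 2 * (K ^ 2 / κ))) * Z := by
        rw [Finset.sum_const, Finset.card_range, nsmul_eq_mul]; ring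
    _ ≤ (C * κ' ^ N + M * C * κ' ^ N + (D * κ' ^ N) * (M * C ^ 2 * (K ^ 2 / κ))) * Z := by
        have hDN := hD N
        gcongr
    _ = extC K C κ D N₀ * κ' ^ N * Z := by rw [extC, ← hM]; ring

end Domination

end FibreCocycle

namespace FibreCocycle

universe v

/-! ### Merging eigenvalues lying between two close or undominated eigenlines -/

section Merge

variable {X : Type v} [Fintype X] {T : Equiv.Perm X}

/-- The standard Euclidean space of dimension `d`. -/
abbrev Sp (d : ℕ) := EuclideanSpace ℝ (Fin d)

/-- Eigenvalues with the moduli of `μ` and `ν` can be brought together. -/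
def Mergeable {d : ℕ} (T : Equiv.Perm X) (A : X → Sp d →L[ℝ] Sp d) (μ ν e : ℝ) : Prop :=
  ∃ μ' ν', |μ'| = |μ| ∧ |ν'| = |ν| ∧ (∀ x, (chi T A x).IsRoot μ') ∧ (∀ x, (chi T A x).IsRoot ν') ∧
    Mixable T A μ' ν' e

variable {d : ℕ} {A B : X → Sp d →L[ℝ] Sp d} {μ ν e e' : ℝ}

theorem Mergeable.mono (h : Mergeable T A μ ν e) (he : e ≤ e') : Mergeable T A μ ν e' := by
  obtain ⟨μ', ν', h1, h2, h3, h4, h5⟩ := h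
  exact ⟨μ', ν', h1, h2, h3, h4, h5.mono he⟩

theorem CReach.mergeable (h₁ : CReach T A B e) (h₂ : Mergeable T B μ ν e') :
    Mergeable T A μ ν (e + e') := by
  obtain ⟨μ', ν', h1, h2, h3, h4, h5⟩ := h₂
  exact ⟨μ', ν', h1, h2, fun x => h₁.chi_eq x ▸ h3 x, fun x => h₁.chi_eq x ▸ h4 x, h₁.mixable h5⟩

theorem Mergeable.lift {d' : ℕ} {w : X → Sp d} {p : X → ℝ} {ω : ℝ} (c : Compl w (Sp d'))
    (hT : IsCyclic T) (hw : IsEig T A w p ω)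
    (h : Mergeable T (c.quot T A) μ ν e) : Mergeable T A μ ν e := by
  obtain ⟨μ', ν', h1, h2, h3, h4, h5⟩ := h
  refine ⟨μ', ν', h1, h2, fun x => ?_, fun x => ?_, h5.lift c hT hw⟩
  · rw [c.chi_quot hT hw]; exact Polynomial.root_mul_left_of_isRoot _ (h3 x)
  · rw [c.chi_quot hT hw]; exact Polynomial.root_mul_left_of_isRoot _ (h4 x)

theorem IsEig.exists_dim {w : X → Sp d} {p : X → ℝ} {ω : ℝ} (hw : IsEig T A w p ω) (x : X) :
    ∃ d', d = d' + 1 := by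
  rcases d with - | d
  · exact absurd (Subsingleton.elim _ _) (hw.ne_zero x)
  · exact ⟨d, rfl⟩

theorem Compl.isRoot_quot {d' : ℕ} {w : X → Sp d} {p : X → ℝ} {ω : ℝ} (c : Compl w (Sp d'))
    (hT : IsCyclic T) (hw : IsEig T A w p ω) (hμ : ∀ x, (chi T A x).IsRoot μ) (hne : μ ≠ ω) (x : X) :
    (chi T (c.quot T A) x).IsRoot μ := by
  have := hμ x
  rw [c.chi_quot hT hw, Polynomial.root_mul, Polynomial.root_X_sub_C] at this
  exact this.resolve_left fun h => hne h.symm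

theorem Compl.bdd {d' : ℕ} {w : X → Sp d} {p : X → ℝ} {ω K : ℝ} (c : Compl w (Sp d'))
    (hw : IsEig T A w p ω) (hA : Bdd A K) : Bdd (c.quot T A) K := by
  refine c.bdd_quot hw.map (fun x h => ?_) hA
  have := (hw.bounds hA x).2
  rw [h, abs_zero, mul_zero] at this
  linarith

theorem mergeable_of_close {K : ℝ} (hT : IsCyclic T) (hA : Bdd A K) (hK1 : 1 ≤ K) {u w : X → Sp d}
    {p q : X → ℝ} {μ' ν' : ℝ} (hu : IsEig T A u p μ') (hw : IsEig T A w q ν') (hμ : |μ'| = |μ|)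
    (hν : |ν'| = |ν|) (hμν : |μ| < |ν|) {y : X} {α : ℝ}
    (hα1 : α ≤ 1) (hc : Close α (u y) (w y)) (he : 2 * α * K < e) (hKe : K * e ≤ 1 / 2) :
    Mergeable T A μ ν e := by
  rw [← hμ, ← hν] at hμν
  refine ⟨μ', ν', hμ, hν, hu.isRoot hT, hw.isRoot hT, ?_⟩
  rcases hc with hc | hc
  · exact mixable_of_close hT hA hK1 hu hw hμν hα1 hc he hKe
  · exact mixable_of_close hT hA hK1 hu hw.neg hμν hα1 (by simpa using hc) he hKe

theorem Close.trans {V : Type*} [NormedAddCommGroup V] [InnerProductSpace ℝ V] {α β : ℝ}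
    {a b c : V} (h₁ : Close α a b) (h₂ : Close β b c) : Close (α + β) a c := by
  have e1 : a - c = (a - b) + (b - c) := by abel
  have e2 : a + c = (a - b) + (b + c) := by abel
  have e3 : a + c = (a + b) - (b - c) := by abel
  have e4 : a - c = (a + b) - (b + c) := by abel
  rcases h₁ with h | h <;> rcases h₂ with h' | h'
  · left; rw [e1]; exact (norm_add_le _ _).trans (add_le_add h h')
  · right; rw [e2]; exact (norm_add_le _ _).trans (add_le_add h h')
  · right; rw [e3]; exact (norm_sub_le _ _).trans (add_le_add h h')
  · left; rw [e4]; exact (norm_sub_le _ _).trans (add_le_add h h')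

/-- If an eigenfield `u` of small eigenvalue is close to one of eigenvalue `ν`, then any eigenvalue
`μ` in between, far from `ν`, can be merged with `ν`. -/
theorem exists_mergeable_of_close_right (K e : ℝ) (hK : 1 ≤ K) (he : 0 < e) :
    ∃ α > 0, ∀ (X : Type v) [Fintype X] (T : Equiv.Perm X) (_ : IsCyclic T) (d : ℕ)
      (A : X → Sp d →L[ℝ] Sp d) (_ : Bdd A K) (u w : X → Sp d) (p q : X → ℝ) (μ₀ μ ν ν₀ : ℝ)
      (_ : IsEig T A u p μ₀) (_ : IsEig T A w q ν₀) (_ : |ν₀| = |ν|)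
      (_ : ∀ x, (chi T A x).IsRoot μ) (_ : |μ₀| ≤ |μ|) (_ : |μ| < |ν|) (_ : 4 * |μ| ≤ |ν|) (y : X)
      (_ : Close α (u y) (w y)), Mergeable T A μ ν e := by
  -- A smaller tolerance gives a stronger conclusion, so `e` may be taken at most `1 / (2K)`, which
  -- keeps the bounds at `2K`.
  wlog hKe : K * e ≤ 1 / 2 generalizing e
  · obtain ⟨α, h0, h⟩ := this (1 / (2 * K)) (by positivity) (le_of_eq (by field_simp))
    refine ⟨α, h0, ?_⟩
    intro X _ T hT d A hA u w p q μ₀ μ ν ν₀ hu hw hν₀ hμ hμμ hμν hgap y hc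
    refine (h X T hT d A hA u w p q μ₀ μ ν ν₀ hu hw hν₀ hμ hμμ hμν hgap y hc).mono ?_
    rw [div_le_iff₀ (by positivity)]
    nlinarith
  have he1 : e ≤ 1 / 2 := by nlinarith
  -- Directions that are `2γ`-close can be mixed at once. In the quotient, where the bound is `2K`
  -- and the tolerance `e / 2`, closeness `γ / 2` suffices, and `α` is chosen so that
  -- `exists_close_modulo` delivers it.
  set γ := e / (8 * K) with hγ
  have hγ0 : 0 < γ := by positivity
  have hγK : γ * K = e / 8 := by rw [hγ]; field_simp
  have hγ1 : γ ≤ 1 / 16 := by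
    rw [hγ, div_le_iff₀ (by positivity)]; nlinarith
  set α := min (γ / 20) ((e / 2) * (γ / 2) ^ 2 * (γ / 2) / (80 * K)) with hα
  have hα0 : 0 < α := by positivity
  have hαγ : α ≤ γ / 20 := min_le_left _ _
  have hα2 : 80 * K * α / ((e / 2) * (γ / 2) ^ 2) ≤ γ / 2 := by
    rw [div_le_iff₀ (by positivity)]
    have := min_le_right (γ / 20) ((e / 2) * (γ / 2) ^ 2 * (γ / 2) / (80 * K))
    rw [← hα, le_div_iff₀ (by positivity)] at this
    linarith
  refine ⟨α, hα0, ?_⟩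
  intro X _ T hT d A hA u w p q μ₀ μ ν ν₀ hu hw hν₀ hμ hμμ hμν hgap y hc
  rcases hμμ.eq_or_lt with heq | hlt
  · exact mergeable_of_close hT hA hK hu hw heq hν₀ hμν (by linarith) hc (by nlinarith) hKe
  obtain ⟨m, r, hm⟩ := exists_isEig hT hA (hμ y)
  -- Let `m` be a `μ`-eigenvector. If `u` is close to `m`, so is `w`, and the mixing is direct.
  -- Otherwise a shear along `m` makes `w` close to `m` modulo `u`, and the mixing is done in the
  -- quotient by `u` and lifted.
  by_cases hum : Close γ (u y) (m y)
  · exact mergeable_of_close hT hA hK hm hw rfl hν₀ hμν (by linarith) (hum.symm.trans hc)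
      (by nlinarith) hKe
  have hβ := norm_perp_of_not_close (by positivity) (hu.unit y) (hm.unit y) hum
  wlog hc' : ‖u y - w y‖ ≤ α generalizing w
  · exact this (fun x => - w x) hw.neg (by rcases hc with h | h; exacts [absurd h hc', Or.inl (by simpa using h)])
      (by simpa using hc.resolve_left hc')
  obtain ⟨B, u', w', p', q', hAB, hu', hm', hw', -, hclose⟩ :=
    exists_close_modulo (V' := Sp (d - 1)) hT hA hK (e := e / 2) (by linarith) (by linarith) hu hm hw
      hlt (hν₀ ▸ hμν) (Or.inr (hν₀ ▸ hgap)) (by positivity) hβ hc' (by linarith)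
  obtain ⟨d, rfl⟩ := hu.exists_dim y
  obtain ⟨c⟩ := exists_compl hu'.unit
  have hB : Bdd B (2 * K) := hA.near_two hK (e := e / 2) (by linarith) fun x => (hAB.norm_sub x).le
  have hμμ₀ : μ ≠ μ₀ := fun h => by rw [h] at hlt; exact lt_irrefl _ hlt
  have hνμ₀ : ν₀ ≠ μ₀ := fun h => by rw [← h, hν₀] at hlt; exact lt_asymm hlt hμν
  obtain ⟨r₁, h₁⟩ := c.exists_isEig_quot hu'.map hm' (c.Q_ne_zero hT hu' hm' hμμ₀)
  obtain ⟨r₂, h₂⟩ := c.exists_isEig_quot hu'.map hw' (c.Q_ne_zero hT hu' hw' hνμ₀)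
  have := mergeable_of_close hT (c.bdd hu' hB) (by linarith) h₁ h₂ rfl hν₀ hμν (y := y) (α := γ / 2) (by linarith)
    ((hclose c).symm.mono hα2) (e := e / 2) (by nlinarith) (by linarith)
  simpa using hAB.mergeable (this.lift c hT hu')

/-- If an eigenfield of small eigenvalue is close to one of large eigenvalue, then eigenvalues in
between can be merged. -/
theorem exists_mergeable_of_close (K e : ℝ) (hK : 1 ≤ K) (he : 0 < e) :
    ∃ α > 0, ∀ (X : Type v) [Fintype X] (T : Equiv.Perm X) (_ : IsCyclic T) (d : ℕ)
      (A : X → Sp d →L[ℝ] Sp d) (_ : Bdd A K) (u w : X → Sp d) (p q : X → ℝ) (μ₀ μ ν ω : ℝ)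
      (_ : IsEig T A u p μ₀) (_ : IsEig T A w q ω) (_ : ∀ x, (chi T A x).IsRoot μ)
      (_ : ∀ x, (chi T A x).IsRoot ν) (_ : |μ₀| ≤ |μ|) (_ : |μ| < |ν|) (_ : 4 * |μ| ≤ |ν|)
      (_ : |ν| ≤ |ω|) (y : X) (_ : ‖u y - w y‖ ≤ α), Mergeable T A μ ν e := by
  wlog hKe : K * e ≤ 1 / 2 generalizing e
  · obtain ⟨α, h0, h⟩ := this (1 / (2 * K)) (by positivity) (le_of_eq (by field_simp))
    refine ⟨α, h0, ?_⟩
    intro X _ T hT d A hA u w p q μ₀ μ ν ω hu hw hμ hν hμμ hμν hgap hνω y hc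
    refine (h X T hT d A hA u w p q μ₀ μ ν ω hu hw hμ hν hμμ hμν hgap hνω y hc).mono ?_
    rw [div_le_iff₀ (by positivity)]
    nlinarith
  obtain ⟨α₁, hα₁, H₁⟩ := exists_mergeable_of_close_right.{v} K e hK he
  obtain ⟨α₂, hα₂, H₂⟩ := exists_mergeable_of_close_right.{v} (2 * K) (e / 2) (by linarith) (by linarith)
  set α := min (α₁ / 20) ((e / 2) * (α₁ / 2) ^ 2 * α₂ / (80 * K)) with hα
  have hα0 : 0 < α := by positivity
  have hαγ : α ≤ α₁ / 20 := min_le_left _ _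
  have hα2 : 80 * K * α / ((e / 2) * (α₁ / 2) ^ 2) ≤ α₂ := by
    rw [div_le_iff₀ (by positivity)]
    have := min_le_right (α₁ / 20) ((e / 2) * (α₁ / 2) ^ 2 * α₂ / (80 * K))
    rw [← hα, le_div_iff₀ (by positivity)] at this
    linarith
  refine ⟨α, hα0, ?_⟩
  intro X _ T hT d A hA u w p q μ₀ μ ν ω hu hw hμ hν hμμ hμν hgap hνω y hc
  rcases hνω.eq_or_lt with heq | hlt
  · exact H₁ X T hT d A hA u w p q μ₀ μ ν ω hu hw heq.symm hμ hμμ hμν hgap y (Or.inl (by linarith))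
  obtain ⟨m, r, hm⟩ := exists_isEig hT hA (hν y)
  -- Here `m` is a `ν`-eigenvector. If `u` is close to it, `ν` is already the upper eigenvalue of a
  -- close pair. Otherwise a shear along `m` produces such a pair modulo `w`. In both cases the
  -- one-sided statement applies.
  by_cases hum : Close α₁ (u y) (m y)
  · exact H₁ X T hT d A hA u m p r μ₀ μ ν ν hu hm rfl hμ hμμ hμν hgap y hum
  have hβ := norm_perp_of_not_close (by positivity) (hu.unit y) (hm.unit y) hum
  obtain ⟨B, u', w', p', q', hAB, hu', hm', hw', hclose, -⟩ :=
    exists_close_modulo (V' := Sp (d - 1)) hT hA hK (e := e / 2) (by linarith) (by linarith) hu hm hw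
      (hμμ.trans_lt hμν) hlt (Or.inl (by linarith)) (by positivity) hβ hc (by linarith)
  obtain ⟨d, rfl⟩ := hu.exists_dim y
  obtain ⟨c⟩ := exists_compl hw'.unit
  have hB : Bdd B (2 * K) := hA.near_two hK (e := e / 2) (by linarith) fun x => (hAB.norm_sub x).le
  have h3 : ν ≠ ω := fun h => by rw [h] at hlt; exact lt_irrefl _ hlt
  have h4 : μ₀ ≠ ω := fun h => by rw [← h] at hlt; linarith
  have h5 : μ ≠ ω := fun h => by rw [← h] at hlt; linarith
  obtain ⟨r₁, h₁⟩ := c.exists_isEig_quot hw'.map hm' (c.Q_ne_zero hT hw' hm' h3)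
  obtain ⟨r₂, h₂⟩ := c.exists_isEig_quot hw'.map hu' (c.Q_ne_zero hT hw' hu' h4)
  have := H₂ X T hT d (c.quot T B) (c.bdd hw' hB) _ _ _ _ μ₀ μ ν ν h₂ h₁ rfl
    (c.isRoot_quot hT hw' (fun x => by rw [hAB.chi_eq]; exact hμ x) h5) hμμ hμν hgap y
    ((hclose c).mono hα2)
  simpa using hAB.mergeable (this.lift c hT hw')

theorem exists_pow_eq_half {ℓ : ℕ} (hℓ : 0 < ℓ) : ∃ κ : ℝ, 0 < κ ∧ κ < 1 ∧ κ ^ ℓ = 1 / 2 := by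
  refine ⟨(1 / 2 : ℝ) ^ ((ℓ : ℝ)⁻¹), by positivity, ?_, ?_⟩
  · exact Real.rpow_lt_one (by norm_num) (by norm_num) (by positivity)
  · exact Real.rpow_inv_natCast_pow (by norm_num) hℓ.ne'

/-- If the line of an eigenfield is not dominated by another one, then eigenvalues in between can
be merged. -/
theorem exists_mergeable_of_pair (K e : ℝ) (hK : 1 ≤ K) (he : 0 < e) :
    ∃ (C κ : ℝ) (n₀ : ℕ), 0 ≤ C ∧ 0 < κ ∧ κ < 1 ∧
      ∀ (X : Type v) [Fintype X] (T : Equiv.Perm X) (_ : IsCyclic T) (d : ℕ)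
      (A : X → Sp d →L[ℝ] Sp d) (_ : Bdd A K) (_ : n₀ ≤ Fintype.card X)
      (u w : X → Sp d) (p q : X → ℝ) (μ₀ μ ν ω : ℝ)
      (_ : IsEig T A u p μ₀) (_ : IsEig T A w q ω) (_ : ∀ x, (chi T A x).IsRoot μ)
      (_ : ∀ x, (chi T A x).IsRoot ν) (_ : |μ₀| ≤ |μ|) (_ : |μ| < |ν|) (_ : 4 * |μ| ≤ |ν|)
      (_ : |ν| ≤ |ω|) (_ : ¬ ExpDom T A (fun x => ℝ ∙ u x) (fun x => ℝ ∙ w x) C κ),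
      Mergeable T A μ ν e := by
  wlog hKe : K * e ≤ 1 / 2 generalizing e
  · obtain ⟨C, κ, n₀, h1, h2, h3, h⟩ := this (1 / (2 * K)) (by positivity) (le_of_eq (by field_simp))
    refine ⟨C, κ, n₀, h1, h2, h3, ?_⟩
    intro X _ T hT d A hA hn u w p q μ₀ μ ν ω hu hw hμ hν hμμ hμν hgap hνω hE
    refine (h X T hT d A hA hn u w p q μ₀ μ ν ω hu hw hμ hν hμμ hμν hgap hνω hE).mono ?_
    rw [div_le_iff₀ (by positivity)]
    nlinarith
  obtain ⟨α, hα, H⟩ := exists_mergeable_of_close.{v} (2 * K) (e / 2) (by linarith) (by linarith)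
  have hK0 : 0 < K := by linarith
  -- Order of the constants: the angle `α` comes first, then the boost `η` and the tilt `s` that fit
  -- in the tolerance, and finally the time `ℓ` in which the boost makes up for `s` and `α`. The
  -- domination constants follow from `ℓ`, and the period must hold two segments of length `ℓ`.
  obtain ⟨η, hη, hcη⟩ : ∃ η > 0, (Real.exp η - 1) * (2 / α * K) < (e / 2) / 2 := by
    have hc : Filter.Tendsto (fun η : ℝ => (Real.exp η - 1) * (2 / α * K)) (nhdsWithin 0 (Set.Ioi 0))
        (nhds ((Real.exp 0 - 1) * (2 / α * K))) :=
      ((by fun_prop : Continuous fun η : ℝ => (Real.exp η - 1) * (2 / α * K)).tendsto 0).mono_left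
        nhdsWithin_le_nhds
    rw [Real.exp_zero, sub_self, zero_mul] at hc
    obtain ⟨η, h1, h2⟩ := ((hc.eventually_lt_const (show (0 : ℝ) < (e / 2) / 2 by positivity)).and
      self_mem_nhdsWithin).exists
    exact ⟨η, h2, h1⟩
  obtain ⟨s, hs, hcs⟩ : ∃ s > 0, 2 * s * (2 / α) * (2 * K) < (e / 2) / 2 := by
    refine ⟨e * α / (64 * K), by positivity, ?_⟩
    have : 2 * (e * α / (64 * K)) * (2 / α) * (2 * K) = e / 8 := by field_simp; norm_num
    rw [this]; linarith
  obtain ⟨ℓ, hℓ0, hℓ⟩ : ∃ ℓ : ℕ, 0 < ℓ ∧ 4 ≤ s * α * Real.exp (η * ℓ) := by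
    have : Filter.Tendsto (fun ℓ : ℕ => s * α * Real.exp (η * ℓ)) Filter.atTop Filter.atTop :=
      (Real.tendsto_exp_atTop.comp (tendsto_natCast_atTop_atTop.const_mul_atTop hη)).const_mul_atTop
        (by positivity)
    obtain ⟨ℓ, h1, h2⟩ := ((this.eventually_ge_atTop 4).and (Filter.eventually_gt_atTop 0)).exists
    exact ⟨ℓ, h2, h1⟩
  obtain ⟨κ, hκ0, hκ1, hκ⟩ := exists_pow_eq_half hℓ0
  refine ⟨2 * K ^ (2 * ℓ), κ, 2 * ℓ, by positivity, hκ0, hκ1, ?_⟩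
  intro X _ T hT d A hA hn u w p q μ₀ μ ν ω hu hw hμ hν hμμ hμν hgap hνω hE
  -- Otherwise the line of `u` would be dominated at time `ℓ`, hence exponentially with the chosen
  -- constants.
  obtain ⟨x, hx⟩ : ∃ x, |pp T q ℓ x| ≤ 2 * |pp T p ℓ x| := by
    by_contra! h
    refine hE (Dom.expDom ?_ hA hK (inv_line hu) (inv_line hw) hℓ0 hκ0.le hκ1.le hκ)
    intro x f hf g hg
    obtain ⟨a, rfl⟩ := Submodule.mem_span_singleton.1 hf
    obtain ⟨b, rfl⟩ := Submodule.mem_span_singleton.1 hg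
    simp only [map_smul, norm_smul, ← hu.abs_pp_eq, ← hw.abs_pp_eq, hu.unit, hw.unit, mul_one]
    nlinarith [h x, mul_nonneg (norm_nonneg a) (norm_nonneg b)]
  obtain ⟨B, w', p', q', hAB, hu', hw', y, hy⟩ := exists_close_of_not_dominated hT hA hK (e := e / 2)
    (by linarith) (by linarith) hu hw (by linarith) hα hη.le hs hcη hcs hn hℓ hx
  have hB : Bdd B (2 * K) := hA.near_two hK (e := e / 2) (by linarith) fun x => (hAB.norm_sub x).le
  have := H X T hT d B hB u w' p' q' μ₀ μ ν ω hu' hw' (fun x => by rw [hAB.chi_eq]; exact hμ x)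
    (fun x => by rw [hAB.chi_eq]; exact hν x) hμμ hμν hgap hνω y hy
  simpa using hAB.mergeable this

end Merge

end FibreCocycle

namespace FibreCocycle

universe v

/-! ### Spectral subspaces: from undominated sums of eigenspaces to undominated lines -/

section Spectral

variable {X : Type v} [Fintype X] {T : Equiv.Perm X}
variable {V : Type*} [NormedAddCommGroup V] [InnerProductSpace ℝ V] [FiniteDimensional ℝ V]
  {V' : Type*} [NormedAddCommGroup V'] [InnerProductSpace ℝ V'] [FiniteDimensional ℝ V']
  {A : X → V →L[ℝ] V}

/-- The monic polynomial with prescribed roots. -/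
noncomputable def rootsPoly (s : Multiset ℝ) : ℝ[X] := (s.map fun a => Polynomial.X - C a).prod

theorem rootsPoly_cons (a : ℝ) (s : Multiset ℝ) :
    rootsPoly (a ::ₘ s) = (Polynomial.X - C a) * rootsPoly s := by simp [rootsPoly]

theorem rootsPoly_zero : rootsPoly 0 = 1 := by simp [rootsPoly]

theorem rootsPoly_add (s t : Multiset ℝ) : rootsPoly (s + t) = rootsPoly s * rootsPoly t := by
  simp [rootsPoly]

theorem rootsPoly_erase {a : ℝ} {s : Multiset ℝ} (h : a ∈ s) :
    rootsPoly s = (Polynomial.X - C a) * rootsPoly (s.erase a) := by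
  rw [← rootsPoly_cons, Multiset.cons_erase h]

theorem rootsPoly_isRoot {a : ℝ} {s : Multiset ℝ} : (rootsPoly s).IsRoot a ↔ a ∈ s := by
  induction s using Multiset.induction_on with
  | empty => simp [rootsPoly_zero]
  | cons b s ih =>
    rw [rootsPoly_cons, Polynomial.root_mul, Polynomial.root_X_sub_C, ih, Multiset.mem_cons]
    tauto

theorem isCoprime_rootsPoly {s t : Multiset ℝ} (h : ∀ a ∈ s, ∀ b ∈ t, a ≠ b) :
    IsCoprime (rootsPoly s) (rootsPoly t) := by
  induction s using Multiset.induction_on with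
  | empty => rw [rootsPoly_zero]; exact isCoprime_one_left
  | cons a s ih =>
    rw [rootsPoly_cons]
    refine IsCoprime.mul_left ?_ (ih fun b hb => h b (Multiset.mem_cons_of_mem hb))
    clear ih
    replace h := h a (Multiset.mem_cons_self _ _)
    induction t using Multiset.induction_on with
    | empty => rw [rootsPoly_zero]; exact isCoprime_one_right
    | cons b t ih =>
      rw [rootsPoly_cons]
      exact IsCoprime.mul_right (Polynomial.isCoprime_X_sub_C_of_isUnit_sub
        (sub_ne_zero.2 (h b (Multiset.mem_cons_self _ _))).isUnit)
        (ih fun c hc => h c (Multiset.mem_cons_of_mem hc))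

/-- The field of kernels of a polynomial in the return map. -/
noncomputable def kerField (T : Equiv.Perm X) (A : X → V →L[ℝ] V) (f : ℝ[X]) (x : X) :
    Submodule ℝ V :=
  LinearMap.ker (aeval (ret T A x) f)

theorem inv_kerField (hT : IsCyclic T) (f : ℝ[X]) : Inv T A (kerField T A f) := by
  intro x v hv
  rw [kerField, LinearMap.mem_ker] at hv ⊢
  rw [aeval_ret_comm hT, hv, map_zero]

theorem kerField_one (x : X) : kerField T A 1 x = ⊥ := by
  simp [kerField, Module.End.one_eq_id]

variable {w : X → V} {q : X → ℝ} {ω : ℝ}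

theorem Compl.mem_kerField_quot (c : Compl w V') (hT : IsCyclic T) (hw : IsEig T A w q ω)
    {f : ℝ[X]} {x : X} {v : V} (hv : v ∈ kerField T A f x) :
    c.Q x v ∈ kerField T (c.quot T A) f x := by
  rw [kerField, LinearMap.mem_ker] at hv ⊢
  rw [c.aeval_ret_quot_Q hT hw.map, hv, map_zero]

/-- By Cayley–Hamilton `h g` vanishes on the quotient. A vector killed by `f` and by `h g`, with `f`
coprime to `g`, is killed by `h` (Bézout). So a spectral subspace loses exactly the factor of the
line divided out. -/
theorem Compl.mem_kerField_of_chi (c : Compl w V') (hT : IsCyclic T) (hw : IsEig T A w q ω)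
    {f g h : ℝ[X]} (hfg : IsCoprime f g) {x : X} (hχ : chi T (c.quot T A) x = h * g) {v : V}
    (hv : v ∈ kerField T A f x) : c.Q x v ∈ kerField T (c.quot T A) h x := by
  have hv' := c.mem_kerField_quot hT hw hv
  rw [kerField, LinearMap.mem_ker] at hv' ⊢
  obtain ⟨a, b, hab⟩ := hfg
  set M := ret T (c.quot T A) x
  have hCH : aeval M (h * g) = 0 := by
    rw [← hχ]; exact LinearMap.aeval_self_charpoly M
  have e : h = h * a * f + b * (h * g) := by linear_combination -h * hab
  rw [e, map_add, map_mul, map_mul (aeval M) b, hCH, mul_zero, add_zero, Module.End.mul_apply, hv',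
    map_zero]

end Spectral

/-- With `κ' = √κ` one has `N κ^N = (N κ'^N) κ'^N`, and `N κ'^N` is bounded. -/
theorem exists_ext_const (C κ : ℝ) (hκ : 0 < κ) (hκ1 : κ < 1) :
    ∃ (κ' D : ℝ) (N₀ : ℕ), κ ≤ κ' ∧ κ' < 1 ∧ 0 ≤ D ∧ C * κ ^ N₀ ≤ 1 / 2 ∧
      ∀ N : ℕ, N * κ ^ N ≤ D * κ' ^ N := by
  have hs0 : 0 < √κ := Real.sqrt_pos.2 hκ
  have hs1 : √κ < 1 := by rw [Real.sqrt_lt' one_pos]; simpa using hκ1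
  have hss : √κ * √κ = κ := Real.mul_self_sqrt hκ.le
  obtain ⟨D, hD⟩ := (tendsto_self_mul_const_pow_of_lt_one hs0.le hs1).bddAbove_range
  have h0 : Filter.Tendsto (fun N : ℕ => C * κ ^ N) Filter.atTop (nhds (C * 0)) :=
    (tendsto_pow_atTop_nhds_zero_of_lt_one hκ.le hκ1).const_mul C
  rw [mul_zero] at h0
  obtain ⟨N₀, hN₀⟩ := (h0.eventually_le_const (show (0 : ℝ) < 1 / 2 by norm_num)).exists
  have hD' : ∀ N : ℕ, N * √κ ^ N ≤ D := fun N => hD ⟨N, rfl⟩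
  refine ⟨√κ, D, N₀, by nlinarith, hs1, by simpa using hD' 0, hN₀, fun N => ?_⟩
  have : (N : ℝ) * κ ^ N = (N * √κ ^ N) * √κ ^ N := by rw [mul_assoc, ← mul_pow, hss]
  rw [this]
  exact mul_le_mul_of_nonneg_right (hD' N) (by positivity)

theorem extC_nonneg {K C κ D : ℝ} (hC : 0 ≤ C) (hκ : 0 < κ) (hD : 0 ≤ D) (N : ℕ) :
    0 ≤ extC K C κ D N := by
  have : 0 ≤ K ^ (2 * N) := by rw [pow_mul]; positivity
  unfold extC; positivity

/-- The eigenvalue to be divided out is chosen so that the extremal one, `μ`, survives in the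
quotient unless nothing does. -/
theorem exists_mem_erase {s : Multiset ℝ} {μ : ℝ} (h : μ ∈ s) :
    ∃ a ∈ s, s.erase a = 0 ∨ μ ∈ s.erase a := by
  obtain ⟨t, rfl⟩ := Multiset.exists_cons_of_mem h
  rcases Multiset.empty_or_exists_mem t with rfl | ⟨a, ha⟩
  · exact ⟨μ, by simp, by simp⟩
  · refine ⟨a, Multiset.mem_cons_of_mem ha, Or.inr ?_⟩
    rw [← Multiset.cons_erase ha, Multiset.cons_swap, Multiset.erase_cons_head]
    exact Multiset.mem_cons_self _ _

theorem expDom_of_left_bot {X : Type*} {T : Equiv.Perm X}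
    {V : Type*} [NormedAddCommGroup V] [InnerProductSpace ℝ V] {A : X → V →L[ℝ] V}
    {F G : X → Submodule ℝ V} {C κ : ℝ} (h : ∀ x, F x = ⊥) : ExpDom T A F G C κ := by
  intro N x f hf g hg
  rw [h, Submodule.mem_bot] at hf
  simp [hf]

theorem expDom_of_right_bot {X : Type*} {T : Equiv.Perm X}
    {V : Type*} [NormedAddCommGroup V] [InnerProductSpace ℝ V] {A : X → V →L[ℝ] V}
    {F G : X → Submodule ℝ V} {C κ : ℝ} (h : ∀ x, G x = ⊥) : ExpDom T A F G C κ := by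
  intro N x f hf g hg
  rw [h, Submodule.mem_bot] at hg
  simp [hg]

/-- If the spectral field of `s` is not dominated by an eigenline, the corresponding eigenvalues can
be merged. -/
theorem exists_mergeable_of_line (K e : ℝ) (hK : 1 ≤ K) (he : 0 < e) (j : ℕ) :
    ∃ (C κ : ℝ) (n₀ : ℕ), 0 ≤ C ∧ 0 < κ ∧ κ < 1 ∧
      ∀ (X : Type v) [Fintype X] (T : Equiv.Perm X) (_ : IsCyclic T) (d : ℕ)
      (A : X → Sp d →L[ℝ] Sp d) (_ : Bdd A K) (_ : n₀ ≤ Fintype.card X)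
      (s t : Multiset ℝ) (w : X → Sp d) (q : X → ℝ) (μ ν ω : ℝ)
      (_ : ∀ x, chi T A x = rootsPoly s * rootsPoly t) (_ : Multiset.card s ≤ j)
      (_ : IsEig T A w q ω) (_ : s = 0 ∨ μ ∈ s) (_ : ν ∈ t) (_ : ω ∈ t)
      (_ : ∀ a ∈ s, |a| ≤ |μ|) (_ : ∀ b ∈ t, |ν| ≤ |b|) (_ : |μ| < |ν|) (_ : 4 * |μ| ≤ |ν|)
      (_ : ¬ ExpDom T A (kerField T A (rootsPoly s)) (fun x => ℝ ∙ w x) C κ),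
      Mergeable T A μ ν e := by
  induction j with
  | zero =>
    refine ⟨0, 1 / 2, 0, le_rfl, by norm_num, by norm_num, ?_⟩
    intro X _ T hT d A hA hn s t w q μ ν ω hχ hj hw hs hν hω hsμ htν hμν hgap hE
    have : s = 0 := by simpa using hj
    subst this
    exact absurd (expDom_of_left_bot fun x => by rw [rootsPoly_zero, kerField_one]) hE
  | succ j ih =>
    obtain ⟨C₁, κ₁, n₁, hC₁, hκ₁, hκ₁1, H₁⟩ := exists_mergeable_of_pair.{v} K e hK he
    obtain ⟨C₂, κ₂, n₂, hC₂, hκ₂, hκ₂1, H₂⟩ := ih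
    set C := max C₁ C₂ with hC
    set κ := max κ₁ κ₂ with hκ
    have hC0 : 0 ≤ C := hC₁.trans (le_max_left _ _)
    have hκ0 : 0 < κ := hκ₁.trans_le (le_max_left _ _)
    obtain ⟨κ', D, N₀, hκκ, hκ'1, hD0, hN₀, hD⟩ := exists_ext_const C κ hκ0 (max_lt hκ₁1 hκ₂1)
    refine ⟨extC K C κ D N₀, κ', max n₁ n₂, extC_nonneg hC0 hκ0 hD0 _, hκ0.trans_le hκκ, hκ'1, ?_⟩
    intro X _ T hT d A hA hn s t w q μ ν ω hχ hj hw hs hν hω hsμ htν hμν hgap hE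
    rcases isEmpty_or_nonempty X with hX | ⟨⟨x₀⟩⟩
    · exact absurd (fun N x => (hX.false x).elim) hE
    rcases hs with rfl | hs
    · exact absurd (expDom_of_left_bot fun x => by rw [rootsPoly_zero, kerField_one]) hE
    obtain ⟨a, ha, hμa⟩ := exists_mem_erase hs
    have hst : ∀ a ∈ s, ∀ b ∈ t, a ≠ b := fun a ha b hb h => by
      have h1 := hsμ a ha
      have h2 := htν b hb
      rw [h] at h1; linarith
    have hroot : ∀ b, b ∈ s ∨ b ∈ t → ∀ x, (chi T A x).IsRoot b := by
      intro b hb x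
      rw [hχ, Polynomial.root_mul, rootsPoly_isRoot, rootsPoly_isRoot]; exact hb
    obtain ⟨u, p, hu⟩ := exists_isEig hT hA (hroot a (Or.inl ha) x₀)
    obtain ⟨d, rfl⟩ := hu.exists_dim x₀
    -- By `ExpDom.extend_left`, either the line `u` is not dominated by `w`, or the rest of `s` is
    -- not dominated in the quotient by `u`. The first case is the one of a pair of lines; the
    -- second is the induction hypothesis, whose conclusion lifts.
    by_cases hE₁ : ExpDom T A (fun x => ℝ ∙ u x) (fun x => ℝ ∙ w x) C₁ κ₁
    swap
    · exact H₁ X T hT _ A hA ((le_max_left _ _).trans hn) u w p q a μ ν ω hu hw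
        (hroot μ (Or.inl hs)) (hroot ν (Or.inr hν)) (hsμ a ha) hμν hgap (htν ω hω) hE₁
    obtain ⟨c⟩ := exists_compl hu.unit
    have hχ' : ∀ x, chi T (c.quot T A) x = rootsPoly (s.erase a) * rootsPoly t := by
      intro x
      have := hχ x
      rw [c.chi_quot hT hu, rootsPoly_erase ha, mul_assoc] at this
      exact mul_left_cancel₀ (Polynomial.X_sub_C_ne_zero a) this
    obtain ⟨q', hw'⟩ := c.exists_isEig_quot hu.map hw
      (c.Q_ne_zero hT hu hw (fun h => hst a ha ω hω h.symm))
    by_cases hE₂ : ExpDom T (c.quot T A) (kerField T (c.quot T A) (rootsPoly (s.erase a)))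
      (fun x => ℝ ∙ (‖c.Q x (w x)‖⁻¹ • c.Q x (w x))) C₂ κ₂
    swap
    · exact (H₂ X T hT _ (c.quot T A) (c.bdd hu hA) ((le_max_right _ _).trans hn) (s.erase a) t _ q' μ
        ν ω hχ' (by have := Multiset.card_erase_add_one ha; omega) hw' hμa hν hω
        (fun b hb => hsμ b (Multiset.mem_of_mem_erase hb)) htν hμν hgap hE₂).lift c hT hu
    refine absurd (ExpDom.extend_left c hA hK hu hw
      (fun x v hv => c.mem_kerField_of_chi hT hu (isCoprime_rootsPoly hst) (hχ' x) hv)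
      (fun x => ?_) (hE₁.mono hC₁ (le_max_left _ _) hκ₁.le (le_max_left _ _))
      (hE₂.mono hC₂ (le_max_right _ _) hκ₂.le (le_max_right _ _)) hC0 hκ0 hN₀ hκκ hD) hE
    refine Submodule.mem_span_singleton.2 ⟨‖c.Q x (w x)‖, ?_⟩
    rw [smul_smul, mul_inv_cancel₀, one_smul]
    exact norm_ne_zero_iff.2 (c.Q_ne_zero hT hu hw (fun h => hst a ha ω hω h.symm) x)

/-- If the spectral field of `s` is not dominated by that of `t`, the extremal eigenvalues can be
merged. -/
theorem exists_mergeable_of_not_expDom (K e : ℝ) (hK : 1 ≤ K) (he : 0 < e) (j k : ℕ) :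
    ∃ (C κ : ℝ) (n₀ : ℕ), 0 ≤ C ∧ 0 < κ ∧ κ < 1 ∧
      ∀ (X : Type v) [Fintype X] (T : Equiv.Perm X) (_ : IsCyclic T) (d : ℕ)
      (A : X → Sp d →L[ℝ] Sp d) (_ : Bdd A K) (_ : n₀ ≤ Fintype.card X)
      (s t : Multiset ℝ) (μ ν : ℝ)
      (_ : ∀ x, chi T A x = rootsPoly s * rootsPoly t) (_ : Multiset.card s ≤ j)
      (_ : Multiset.card t ≤ k) (_ : μ ∈ s) (_ : t = 0 ∨ ν ∈ t)
      (_ : ∀ a ∈ s, |a| ≤ |μ|) (_ : ∀ b ∈ t, |ν| ≤ |b|) (_ : |μ| < |ν|) (_ : 4 * |μ| ≤ |ν|)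
      (_ : ¬ ExpDom T A (kerField T A (rootsPoly s)) (kerField T A (rootsPoly t)) C κ),
      Mergeable T A μ ν e := by
  induction k with
  | zero =>
    refine ⟨0, 1 / 2, 0, le_rfl, by norm_num, by norm_num, ?_⟩
    intro X _ T hT d A hA hn s t μ ν hχ hj hk hμ hν hsμ htν hμν hgap hE
    have : t = 0 := by simpa using hk
    subst this
    exact absurd (expDom_of_right_bot fun x => by rw [rootsPoly_zero, kerField_one]) hE
  | succ k ih =>
    obtain ⟨C₁, κ₁, n₁, hC₁, hκ₁, hκ₁1, H₁⟩ := exists_mergeable_of_line.{v} K e hK he j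
    obtain ⟨C₂, κ₂, n₂, hC₂, hκ₂, hκ₂1, H₂⟩ := ih
    set C := max C₁ C₂ with hC
    set κ := max κ₁ κ₂ with hκ
    have hC0 : 0 ≤ C := hC₁.trans (le_max_left _ _)
    have hκ0 : 0 < κ := hκ₁.trans_le (le_max_left _ _)
    have hκ1 : κ < 1 := max_lt hκ₁1 hκ₂1
    obtain ⟨κ', D, N₀, hκκ, hκ'1, hD0, hN₀, hD⟩ := exists_ext_const C κ hκ0 hκ1
    refine ⟨extC K C κ D N₀, κ', max n₁ n₂, extC_nonneg hC0 hκ0 hD0 _, hκ0.trans_le hκκ, hκ'1, ?_⟩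
    intro X _ T hT d A hA hn s t μ ν hχ hj hk hμ hν hsμ htν hμν hgap hE
    rcases isEmpty_or_nonempty X with hX | ⟨⟨x₀⟩⟩
    · exact absurd (fun N x => (hX.false x).elim) hE
    rcases hν with rfl | hν
    · exact absurd (expDom_of_right_bot fun x => by rw [rootsPoly_zero, kerField_one]) hE
    obtain ⟨ω, hω, hνω⟩ := exists_mem_erase hν
    have hst : ∀ a ∈ s, ∀ b ∈ t, a ≠ b := fun a ha b hb h => by
      have h1 := hsμ a ha
      have h2 := htν b hb
      rw [h] at h1; linarith
    have hroot : (chi T A x₀).IsRoot ω := by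
      rw [hχ, Polynomial.root_mul, rootsPoly_isRoot, rootsPoly_isRoot]; exact Or.inr hω
    obtain ⟨w, q, hw⟩ := exists_isEig hT hA hroot
    obtain ⟨d, rfl⟩ := hw.exists_dim x₀
    -- The same dichotomy on the dominating side, through `ExpDom.extend_right`: either the line `w`
    -- of `t` fails to dominate, or the rest of `t` fails in the quotient by `w`.
    by_cases hE₁ : ExpDom T A (kerField T A (rootsPoly s)) (fun x => ℝ ∙ w x) C₁ κ₁
    swap
    · exact H₁ X T hT _ A hA ((le_max_left _ _).trans hn) s t w q μ ν ω hχ hj hw (Or.inr hμ) hν hω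
        hsμ htν hμν hgap hE₁
    obtain ⟨c⟩ := exists_compl hw.unit
    have hχ' : ∀ x, chi T (c.quot T A) x = rootsPoly s * rootsPoly (t.erase ω) := by
      intro x
      have := hχ x
      rw [c.chi_quot hT hw, rootsPoly_erase hω, mul_left_comm] at this
      exact mul_left_cancel₀ (Polynomial.X_sub_C_ne_zero ω) this
    by_cases hE₂ : ExpDom T (c.quot T A) (kerField T (c.quot T A) (rootsPoly s))
      (kerField T (c.quot T A) (rootsPoly (t.erase ω))) C₂ κ₂
    swap
    · exact (H₂ X T hT _ (c.quot T A) (c.bdd hw hA) ((le_max_right _ _).trans hn) s (t.erase ω) μ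
        ν hχ' hj (by have := Multiset.card_erase_add_one hω; omega) hμ hνω hsμ
        (fun b hb => htν b (Multiset.mem_of_mem_erase hb)) hμν hgap hE₂).lift c hT hw
    exact absurd (ExpDom.extend_right c hA hK hw (inv_kerField hT _)
      (fun x v hv => c.mem_kerField_quot hT hw hv)
      (fun x v hv => c.mem_kerField_of_chi hT hw (isCoprime_rootsPoly hst).symm
        ((hχ' x).trans (mul_comm _ _)) hv) (inv_kerField hT _)
      (hE₁.mono hC₁ (le_max_left _ _) hκ₁.le (le_max_left _ _))
      (hE₂.mono hC₂ (le_max_right _ _) hκ₂.le (le_max_right _ _)) hC0 hκ0 hκ1.le hN₀ hκκ hD) hE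

end FibreCocycle

namespace FibreCocycle

universe v

/-! ### Persistence of dominated splittings by graph transforms -/

section FixedPoint

variable {𝓑 : Type*} [NormedAddCommGroup 𝓑] [NormedSpace ℝ 𝓑] [CompleteSpace 𝓑]

/-- Solving `h = Ψ h + Q h` for a power-bounded linear `Ψ` and a small nonlinearity `Q`. -/
theorem exists_fixed (Ψ : 𝓑 →L[ℝ] 𝓑) {c κ q ρ : ℝ} (hκ0 : 0 ≤ κ) (hκ : κ < 1)
    (hΨ : ∀ N, ‖Ψ ^ N‖ ≤ c * κ ^ N) (Q : 𝓑 → 𝓑) (hρ : 0 ≤ ρ)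
    (hQ : ∀ h, ‖h‖ ≤ ρ → ‖Q h‖ ≤ q)
    (hQ' : ∀ h h', ‖h‖ ≤ ρ → ‖h'‖ ≤ ρ → ‖Q h - Q h'‖ ≤ q * ‖h - h'‖)
    (hq : c / (1 - κ) * q ≤ ρ) (hq' : c / (1 - κ) * q ≤ 1 / 2) :
    ∃ h, ‖h‖ ≤ ρ ∧ h = Ψ h + Q h := by
  have hgeo : HasSum (fun N => c * κ ^ N) (c / (1 - κ)) := by
    rw [div_eq_mul_inv]; exact (hasSum_geometric_of_lt_one hκ0 hκ).mul_left c
  have hsum : Summable (Ψ ^ · : ℕ → 𝓑 →L[ℝ] 𝓑) := Summable.of_norm_bounded hgeo.summable hΨ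
  -- The Neumann series inverts `1 - Ψ`. The equation becomes `h = S (Q h)`, a contraction of ratio
  -- `1 / 2` of the ball of radius `ρ`.
  set S := ∑' N, Ψ ^ N with hS
  have hSn : ‖S‖ ≤ c / (1 - κ) := tsum_of_norm_bounded hgeo hΨ
  have h1 : (1 - Ψ) * S = 1 := hsum.one_sub_mul_tsum_pow
  have hmaps : Set.MapsTo (fun h => S (Q h)) (Metric.closedBall 0 ρ) (Metric.closedBall 0 ρ) := by
    intro h hh
    rw [mem_closedBall_zero_iff] at hh ⊢
    exact (S.le_opNorm_of_le (hQ h hh)).trans ((mul_le_mul_of_nonneg_right hSn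
      ((norm_nonneg _).trans (hQ h hh))).trans hq)
  have hcontr : ContractingWith (1 / 2) (hmaps.restrict (fun h => S (Q h)) _ _) := by
    refine ⟨by rw [← NNReal.coe_lt_coe]; norm_num, LipschitzWith.of_dist_le_mul fun a b => ?_⟩
    have ha := mem_closedBall_zero_iff.1 a.2
    have hb := mem_closedBall_zero_iff.1 b.2
    rw [Subtype.dist_eq, Subtype.dist_eq, dist_eq_norm, dist_eq_norm]
    change ‖S (Q a) - S (Q b)‖ ≤ _
    rw [← map_sub]
    refine (S.le_opNorm_of_le (hQ' _ _ ha hb)).trans ?_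
    have h2 : 0 ≤ q * ‖(a : 𝓑) - b‖ := (norm_nonneg _).trans (hQ' _ _ ha hb)
    refine (mul_le_mul_of_nonneg_right hSn h2).trans ?_
    rw [← mul_assoc]
    exact mul_le_mul_of_nonneg_right (by simpa using hq') (norm_nonneg _)
  obtain ⟨h, hh, hfix, -⟩ := hcontr.exists_fixedPoint' Metric.isClosed_closedBall.isComplete hmaps
    (x := 0) (by simpa using hρ) (edist_ne_top _ _)
  refine ⟨h, mem_closedBall_zero_iff.1 hh, ?_⟩
  have h3 : S (Q h) = h := hfix
  have h4 : (1 - Ψ) (S (Q h)) = Q h := by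
    rw [← mul_apply_eq_comp, h1]; rfl
  rw [h3] at h4
  rw [← h4]; simp

end FixedPoint

section Graph

variable {X : Type*} [Fintype X]
variable {V : Type*} [NormedAddCommGroup V] [NormedSpace ℝ V] [CompleteSpace V]

/-- The operator `h ↦ (x ↦ l x ∘ h (φ x) ∘ r x)`. -/
noncomputable def transferOp (l r : X → V →L[ℝ] V) (φ : X → X) :
    (X → V →L[ℝ] V) →L[ℝ] (X → V →L[ℝ] V) :=
  ContinuousLinearMap.pi fun x =>
    ((ContinuousLinearMap.mul ℝ (V →L[ℝ] V)).flip (r x)).comp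
      ((ContinuousLinearMap.mul ℝ (V →L[ℝ] V) (l x)).comp (ContinuousLinearMap.proj (φ x)))

theorem transferOp_apply (l r : X → V →L[ℝ] V) (φ : X → X) (h : X → V →L[ℝ] V) (x : X) :
    transferOp l r φ h x = l x * h (φ x) * r x := rfl

theorem norm_mul_mul_le {a b c : V →L[ℝ] V} {s t u : ℝ} (ha : ‖a‖ ≤ s) (hb : ‖b‖ ≤ t)
    (hc : ‖c‖ ≤ u) : ‖a * b * c‖ ≤ s * t * u := by
  have hs := (norm_nonneg _).trans ha
  have ht := (norm_nonneg _).trans hb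
  exact (norm_mul_le _ _).trans (mul_le_mul ((norm_mul_le _ _).trans
    (mul_le_mul ha hb (norm_nonneg _) hs)) hc (norm_nonneg _) (mul_nonneg hs ht))

/-- The invariance equation of a graph in abstract form: linear transport by the unperturbed
cocycle, plus a term quadratic in `h` that contains the small factor `E`. The decay is assumed only
after one transport, when the maps go between the right subspaces; this first transport costs `s²`.
-/
theorem exists_graph_field {l r a b c E e : X → V →L[ℝ] V} {φ σ τ : X → X} {s δ κ C ρ : ℝ}
    (hs : 1 ≤ s) (hl : ∀ x, ‖l x‖ ≤ s) (hr : ∀ x, ‖r x‖ ≤ s) (ha : ∀ x, ‖a x‖ ≤ s)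
    (hb : ∀ x, ‖b x‖ ≤ s) (hc : ∀ x, ‖c x‖ ≤ s) (he : ∀ x, ‖e x‖ ≤ s) (hE : ∀ x, ‖E x‖ ≤ δ)
    (hδ : 0 ≤ δ) (hC : 0 ≤ C)
    (hκ0 : 0 < κ) (hκ : κ < 1) (hρ : 0 ≤ ρ) (hρ1 : ρ ≤ 1)
    (hpow : ∀ N h, ‖(transferOp l r φ ^ N) (transferOp l r φ h)‖ ≤
      C * κ ^ N * ‖transferOp l r φ h‖)
    (hsmall : (1 + C * s ^ 2 / κ) / (1 - κ) * (4 * s ^ 3 * δ) ≤ ρ)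
    (hsmall' : (1 + C * s ^ 2 / κ) / (1 - κ) * (4 * s ^ 3 * δ) ≤ 1 / 2) :
    ∃ h : X → V →L[ℝ] V, (∀ x, ‖h x‖ ≤ ρ) ∧ ∀ x, h x = l x * h (φ x) * r x +
      a x * (b x + h (σ x) * c x) * (E x * (1 + h (τ x)) * e x) := by
  have hs0 : 0 ≤ s := by linarith
  have hΨ1 : ∀ h, ‖transferOp l r φ h‖ ≤ s ^ 2 * ‖h‖ := by
    intro h
    rw [pi_norm_le_iff_of_nonneg (by positivity)]
    intro x
    rw [transferOp_apply]
    refine (norm_mul_mul_le (hl x) (norm_le_pi_norm h (φ x)) (hr x)).trans (le_of_eq (by ring))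
  have hΨ : ∀ N, ‖transferOp l r φ ^ N‖ ≤ (1 + C * s ^ 2 / κ) * κ ^ N := by
    intro N
    refine ContinuousLinearMap.opNorm_le_bound _ (by positivity) fun h => ?_
    rcases N with - | N
    · simp only [pow_zero, mul_one, one_apply_eq_self]
      exact le_mul_of_one_le_left (norm_nonneg _) (le_add_of_nonneg_right (by positivity))
    · rw [pow_succ, mul_apply_eq_comp]
      refine (hpow N h).trans ?_
      calc C * κ ^ N * ‖transferOp l r φ h‖ ≤ C * κ ^ N * (s ^ 2 * ‖h‖) := by
            gcongr; exact hΨ1 h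
        _ = (C * s ^ 2 / κ) * κ ^ (N + 1) * ‖h‖ := by field_simp; ring
        _ ≤ _ := by gcongr; linarith
  set Q : (X → V →L[ℝ] V) → X → V →L[ℝ] V := fun h x =>
    a x * (b x + h (σ x) * c x) * (E x * (1 + h (τ x)) * e x) with hQ
  have hone : ‖(1 : V →L[ℝ] V)‖ ≤ 1 := ContinuousLinearMap.norm_id_le
  have hb' : ∀ h : X → V →L[ℝ] V, ‖h‖ ≤ ρ → ∀ x, ‖b x + h (σ x) * c x‖ ≤ 2 * s := by
    intro h hh x
    have h1 : ‖h (σ x) * c x‖ ≤ 1 * s := (norm_mul_le _ _).trans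
      (mul_le_mul ((norm_le_pi_norm h _).trans (hh.trans hρ1)) (hc x) (norm_nonneg _) zero_le_one)
    exact (norm_add_le _ _).trans (by linarith [hb x])
  have he' : ∀ h : X → V →L[ℝ] V, ‖h‖ ≤ ρ → ∀ x, ‖1 + h (τ x)‖ ≤ 2 := by
    intro h hh x
    exact (norm_add_le _ _).trans (by linarith [(norm_le_pi_norm h (τ x)).trans (hh.trans hρ1)])
  have hQ1 : ∀ h, ‖h‖ ≤ ρ → ‖Q h‖ ≤ 4 * s ^ 3 * δ := by
    intro h hh
    rw [pi_norm_le_iff_of_nonneg (by positivity)]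
    intro x
    exact (norm_mul_mul_le (ha x) (hb' h hh x) (norm_mul_mul_le (hE x) (he' h hh x) (he x))).trans
      (le_of_eq (by ring))
  have hQ2 : ∀ h h', ‖h‖ ≤ ρ → ‖h'‖ ≤ ρ → ‖Q h - Q h'‖ ≤ 4 * s ^ 3 * δ * ‖h - h'‖ := by
    intro h h' hh hh'
    rw [pi_norm_le_iff_of_nonneg (by positivity)]
    intro x
    have e1 : (Q h - Q h') x = a x * ((h - h') (σ x) * c x) * (E x * (1 + h (τ x)) * e x) +
        a x * (b x + h' (σ x) * c x) * (E x * (h - h') (τ x) * e x) := by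
      simp only [hQ, Pi.sub_apply]; noncomm_ring
    have e2 : ‖(h - h') (σ x) * c x‖ ≤ ‖h - h'‖ * s := (norm_mul_le _ _).trans
      (mul_le_mul (norm_le_pi_norm _ _) (hc x) (norm_nonneg _) (norm_nonneg _))
    rw [e1]
    refine (norm_add_le _ _).trans ((add_le_add
      (norm_mul_mul_le (ha x) e2 (norm_mul_mul_le (hE x) (he' h hh x) (he x)))
      (norm_mul_mul_le (ha x) (hb' h' hh' x)
        (norm_mul_mul_le (hE x) (norm_le_pi_norm _ _) (he x)))).trans (le_of_eq (by ring)))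
  obtain ⟨h, hh, hfix⟩ := exists_fixed (transferOp l r φ) hκ0.le hκ hΨ Q hρ hQ1 hQ2 hsmall hsmall'
  exact ⟨h, fun x => (norm_le_pi_norm h x).trans hh, fun x => congrFun hfix x⟩

end Graph

section Robust

variable {X : Type*} [Fintype X] {T : Equiv.Perm X}
variable {V : Type*} [NormedAddCommGroup V] [InnerProductSpace ℝ V] [FiniteDimensional ℝ V]
  {A B : X → V →L[ℝ] V} {K C κ : ℝ} {F G : X → Submodule ℝ V}

/-- A pair of complementary fields of subspaces, with the associated projections. -/
structure Split (F G : X → Submodule ℝ V) (P R : X → V →L[ℝ] V) : Prop where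
  P_mem : ∀ x v, P x v ∈ F x
  R_mem : ∀ x v, R x v ∈ G x
  add : ∀ x v, P x v + R x v = v
  P_F : ∀ x, ∀ v ∈ F x, P x v = v
  R_G : ∀ x, ∀ v ∈ G x, R x v = v
  P_G : ∀ x, ∀ v ∈ G x, P x v = 0
  R_F : ∀ x, ∀ v ∈ F x, R x v = 0

theorem Split.symm {P R : X → V →L[ℝ] V} (h : Split F G P R) : Split G F R P :=
  ⟨h.R_mem, h.P_mem, fun x v => by rw [add_comm, h.add], h.R_G, h.P_F, h.R_F, h.P_G⟩

theorem exists_split (h : ∀ x, IsCompl (F x) (G x)) : ∃ P R, Split F G P R :=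
  ⟨fun x => LinearMap.toContinuousLinearMap ((F x).projection (G x) (h x)),
    fun x => LinearMap.toContinuousLinearMap ((G x).projection (F x) (h x).symm),
    fun x v => Submodule.projection_apply_mem (h x) v,
    fun x v => Submodule.projection_apply_mem (h x).symm v,
    fun x v => Submodule.projection_add_projection_eq_self (h x) v,
    fun x _ hv => Submodule.projection_apply_of_mem_left (h x) hv,
    fun x _ hv => Submodule.projection_apply_of_mem_left (h x).symm hv,
    fun x _ hv => Submodule.projection_apply_of_mem_right (h x) hv,
    fun x _ hv => Submodule.projection_apply_of_mem_right (h x).symm hv⟩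

theorem Bdd.exists_inverse (hA : Bdd A K) : ∃ Ai : X → V →L[ℝ] V,
    (∀ x v, Ai x (A x v) = v) ∧ (∀ x v, A x (Ai x v) = v) ∧ ∀ x v, ‖Ai x v‖ ≤ K * ‖v‖ := by
  let e := fun x => LinearEquiv.ofInjectiveEndo (A x : V →ₗ[ℝ] V) (hA.injective x)
  have h1 : ∀ x v, (e x).symm (A x v) = v := fun x v => (e x).symm_apply_apply v
  have h2 : ∀ x v, A x ((e x).symm v) = v := fun x v => (e x).apply_symm_apply v
  refine ⟨fun x => LinearMap.toContinuousLinearMap ((e x).symm : V →ₗ[ℝ] V), h1, h2, fun x v => ?_⟩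
  have := (hA x ((e x).symm v)).2
  rwa [h2] at this

theorem Split.comm {P R : X → V →L[ℝ] V} (h : Split F G P R) (hF : Inv T B F) (hG : Inv T B G)
    (x : X) (v : V) : P (T x) (B x v) = B x (P x v) := by
  conv_lhs => rw [← h.add x v, map_add, map_add]
  rw [h.P_F _ _ (hF x _ (h.P_mem x v)), h.P_G _ _ (hG x _ (h.R_mem x v)), add_zero]

theorem Split.comm_cp {P R : X → V →L[ℝ] V} (h : Split F G P R) (hF : Inv T B F) (hG : Inv T B G)
    (N : ℕ) (x : X) (v : V) : P (T^[N] x) (cp T B N x v) = cp T B N x (P x v) := by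
  induction N with
  | zero => rfl
  | succ N ih =>
    rw [cp_succ_apply', cp_succ_apply', Function.iterate_succ_apply', h.comm hF hG, ih]

theorem cp_surjective (hA : Bdd A K) (N : ℕ) (x : X) : Function.Surjective (cp T A N x) := by
  obtain ⟨Ai, -, h2, -⟩ := hA.exists_inverse
  induction N with
  | zero => exact fun v => ⟨v, rfl⟩
  | succ N ih =>
    intro v
    obtain ⟨z, hz⟩ := ih (Ai (T^[N] x) v)
    exact ⟨z, by rw [cp_succ_apply', hz, h2]⟩

theorem iter_surjective (T : Equiv.Perm X) (N : ℕ) (y : X) : ∃ x, T^[N] x = y :=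
  T.surjective.iterate N y

theorem norm_le_of_apply {L : V →L[ℝ] V} {s : ℝ} (hs : 0 ≤ s) (h : ∀ v, ‖L v‖ ≤ s * ‖v‖) :
    ‖L‖ ≤ s := L.opNorm_le_bound hs h

/-- The graph over `G` of a field of maps `h : G → F`. -/
def graphField (P h : X → V →L[ℝ] V) (x : X) : Submodule ℝ V :=
  LinearMap.ker ((h x - P x : V →L[ℝ] V) : V →ₗ[ℝ] V)

theorem mem_graphField {P h : X → V →L[ℝ] V} {x : X} {v : V} :
    v ∈ graphField P h x ↔ h x v = P x v := by
  rw [graphField, LinearMap.mem_ker, ContinuousLinearMap.coe_coe, sub_apply, sub_eq_zero]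

/-- Maps from `G` to `F` are transported forward by `h ↦ B h B⁻¹`, and `ExpDom` says that this
decays exponentially. Invariance of the graph of `h` under `A` is this transport plus terms in `A -
B`, so there is a small solution. -/
theorem exists_invariant_right {P R : X → V →L[ℝ] V} (hP : Split F G P R) (hB : Bdd B K) (hK : 1 ≤ K)
    (hF : Inv T B F) (hG : Inv T B G) (hE : ExpDom T B F G C κ) (hC : 0 ≤ C) (hκ0 : 0 < κ)
    (hκ : κ < 1) {S δ ρ s : ℝ} (hS : 1 ≤ S) (hPS : ∀ x v, ‖P x v‖ ≤ S * ‖v‖)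
    (hRS : ∀ x v, ‖R x v‖ ≤ S * ‖v‖) (hs : s = S * K * S)
    (hAB : ∀ x, ‖A x - B x‖ ≤ δ) (hδ : 0 ≤ δ) (hρ : 0 ≤ ρ) (hρ1 : ρ ≤ 1)
    (hsmall : (1 + C * S * s ^ 2 / κ) / (1 - κ) * (4 * s ^ 3 * δ) ≤ ρ)
    (hsmall' : (1 + C * S * s ^ 2 / κ) / (1 - κ) * (4 * s ^ 3 * δ) ≤ 1 / 2) :
    ∃ h : X → V →L[ℝ] V, (∀ x v, ‖h x v‖ ≤ ρ * ‖v‖) ∧ (∀ x v, h x v ∈ F x) ∧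
      (∀ x v, h x (R x v) = h x v) ∧ Inv T A (graphField P h) := by
  obtain ⟨Bi, hBi, hBi', hBin⟩ := hB.exists_inverse
  have hs1 : 1 ≤ s := by rw [hs]; nlinarith [mul_nonneg (sub_nonneg.2 hS) (sub_nonneg.2 hK)]
  have hSs : S ≤ s := by rw [hs]; nlinarith [mul_nonneg (sub_nonneg.2 hS) (sub_nonneg.2 hK)]
  have hSKs : S * K ≤ s := by rw [hs]; nlinarith [mul_nonneg (sub_nonneg.2 hS) (sub_nonneg.2 hK)]
  have hcomm := hP.comm hF hG
  have hcommR := hP.symm.comm hG hF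
  set l : X → V →L[ℝ] V := fun y => B (T.symm y) * P (T.symm y) with hl
  set r : X → V →L[ℝ] V := fun y => R (T.symm y) * Bi (T.symm y) * R y with hr
  have hln : ∀ y, ‖l y‖ ≤ s := fun y => norm_le_of_apply (by linarith) fun v => by
    calc ‖B (T.symm y) (P (T.symm y) v)‖ ≤ K * (S * ‖v‖) :=
          ((hB _ _).1).trans (by gcongr; exact hPS _ _)
      _ = S * K * ‖v‖ := by ring
      _ ≤ _ := by gcongr
  have hrn : ∀ y, ‖r y‖ ≤ s := fun y => norm_le_of_apply (by linarith) fun v => by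
    calc ‖R (T.symm y) (Bi (T.symm y) (R y v))‖ ≤ S * (K * (S * ‖v‖)) :=
          (hRS _ _).trans (by gcongr; exact (hBin _ _).trans (by gcongr; exact hRS _ _))
      _ = S * K * S * ‖v‖ := by ring
      _ = _ := by rw [hs]
  have hone : ‖(1 : V →L[ℝ] V)‖ ≤ 1 := ContinuousLinearMap.norm_id_le
  have hpow1 : ∀ N (h : X → V →L[ℝ] V), (∀ x v, h x v ∈ F x) → ∀ x, ∀ g ∈ G x,
      (transferOp l r T.symm ^ N) h (T^[N] x) (cp T B N x g) = cp T B N x (h x g) := by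
    intro N h hh
    induction N with
    | zero => intro x g hg; rfl
    | succ N ih =>
      intro x g hg
      rw [pow_succ', mul_apply_eq_comp, transferOp_apply, cp_succ_apply', cp_succ_apply',
        Function.iterate_succ_apply', hl, hr]
      simp only [Equiv.symm_apply_apply, mul_apply_eq_comp]
      have hg' := hG.cp N x hg
      rw [hP.R_G _ _ (hG _ _ hg'), hBi, hP.R_G _ _ hg', ih x g hg, hP.P_F _ _ (hF.cp N x (hh x g))]
  have hmem : ∀ y v, l y v ∈ F y := fun y v => by
    have := hF _ _ (hP.P_mem (T.symm y) v)
    rwa [Equiv.apply_symm_apply] at this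
  have hrR : ∀ y v, r y (R y v) = r y v := fun y v => by
    simp only [hr, mul_apply_eq_comp]
    rw [hP.R_G _ _ (hP.R_mem y v)]
  have hpow : ∀ N h, ‖(transferOp l r T.symm ^ N) (transferOp l r T.symm h)‖ ≤
      C * S * κ ^ N * ‖transferOp l r T.symm h‖ := by
    intro N h
    set m := transferOp l r T.symm h with hm
    have hmF : ∀ x v, m x v ∈ F x := fun x v => hmem _ _
    have hmR : ∀ x v, (transferOp l r T.symm ^ N) m x (R x v) =
        (transferOp l r T.symm ^ N) m x v := by
      intro x v
      rcases N with - | N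
      · exact congrArg (fun z => l x (h (T.symm x) z)) (hrR x v)
      · rw [pow_succ', mul_apply_eq_comp, transferOp_apply, mul_apply_eq_comp, hrR]; rfl
    rw [pi_norm_le_iff_of_nonneg (by positivity)]
    intro y
    refine norm_le_of_apply (by positivity) fun v => ?_
    obtain ⟨x, rfl⟩ := iter_surjective T N y
    obtain ⟨z, rfl⟩ := cp_surjective (T := T) hB N x v
    rw [← hmR, hP.symm.comm_cp hG hF, hpow1 N m hmF x _ (hP.R_mem x z)]
    have hS2 := hRS (T^[N] x) (cp T B N x z)
    rw [hP.symm.comm_cp hG hF] at hS2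
    set g := R x z
    rcases eq_or_ne g 0 with h0 | h0
    · rw [h0, map_zero, map_zero, norm_zero]; positivity
    have h1 := hE N x _ (hmF x g) g (hP.R_mem x z)
    have h2 : ‖m x g‖ ≤ ‖m‖ * ‖g‖ := ((m x).le_opNorm g).trans (by gcongr; exact norm_le_pi_norm m x)
    refine le_of_mul_le_mul_right (h1.trans ?_) (norm_pos_iff.2 h0)
    calc C * κ ^ N * (‖cp T B N x g‖ * ‖m x g‖)
        ≤ C * κ ^ N * ((S * ‖cp T B N x z‖) * (‖m‖ * ‖g‖)) := by gcongr
      _ = _ := by ring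
  obtain ⟨h, hn, hfix⟩ := exists_graph_field (l := l) (r := r) (a := P) (b := P)
    (c := fun x => -R x) (E := fun y => A (T.symm y) - B (T.symm y)) (e := r) (φ := T.symm) (σ := id)
    (τ := T.symm) hs1 hln hrn
    (fun x => (norm_le_of_apply (by linarith) (hPS x)).trans hSs)
    (fun x => (norm_le_of_apply (by linarith) (hPS x)).trans hSs)
    (fun x => (norm_neg (R x)).trans_le ((norm_le_of_apply (by linarith) (hRS x)).trans hSs)) hrn
    (fun y => hAB _) hδ (by positivity) hκ0 hκ hρ hρ1 hpow hsmall hsmall'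
  have hfix' : ∀ y v, h y v = l y (h (T.symm y) (r y v)) + P y (P y ((A (T.symm y) - B (T.symm y))
      (r y v + h (T.symm y) (r y v))) - h y (R y ((A (T.symm y) - B (T.symm y))
      (r y v + h (T.symm y) (r y v))))) := by
    intro y v
    conv_lhs => rw [hfix y]
    simp only [add_apply, mul_apply_eq_comp, one_apply_eq_self, neg_apply, map_neg, id_eq,
      ← sub_eq_add_neg]
  have hhF : ∀ x v, h x v ∈ F x := by
    intro y v
    rw [hfix' y]
    exact (F y).add_mem (hmem _ _) (hP.P_mem _ _)
  have hhR : ∀ x v, h x (R x v) = h x v := by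
    intro y v
    rw [hfix' y, hrR, ← hfix' y]
  refine ⟨h, fun x v => ((h x).le_opNorm v).trans (by gcongr; exact hn x), hhF, hhR, ?_⟩
  intro x v hv
  rw [mem_graphField] at hv ⊢
  have hr1 : r (T x) (B x v) = R x v := by
    simp only [hr, mul_apply_eq_comp, Equiv.symm_apply_apply]
    rw [hcommR, hBi, hP.R_G _ _ (hP.R_mem x v)]
  have h1 := hfix' (T x) (B x v)
  rw [hr1, T.symm_apply_apply, hhR, hv, add_comm (R x v), hP.add, map_sub, hP.P_F _ _ (hP.P_mem _ _),
    hP.P_F _ _ (hhF _ _), hhR] at h1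
  simp only [hl, mul_apply_eq_comp, Equiv.symm_apply_apply, sub_apply, map_sub] at h1
  rw [hP.P_F _ _ (hP.P_mem x v), hcomm] at h1
  have h2 : h (T x) (A x v) - P (T x) (A x v) = 0 := by
    linear_combination (norm := module) h1
  exact sub_eq_zero.1 h2

/-- The same argument for maps from `F` to `G`, which decay when transported backward by `h ↦ B⁻¹ h
B`. Accordingly the value at `x` is computed from the one at `T x`. -/
theorem exists_invariant_left {P R : X → V →L[ℝ] V} (hP : Split F G P R) (hB : Bdd B K) (hK : 1 ≤ K)
    (hF : Inv T B F) (hG : Inv T B G) (hE : ExpDom T B F G C κ) (hC : 0 ≤ C) (hκ0 : 0 < κ)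
    (hκ : κ < 1) {S δ ρ s : ℝ} (hS : 1 ≤ S) (hPS : ∀ x v, ‖P x v‖ ≤ S * ‖v‖)
    (hRS : ∀ x v, ‖R x v‖ ≤ S * ‖v‖) (hs : s = S * K * S)
    (hAB : ∀ x, ‖A x - B x‖ ≤ δ) (hδ : 0 ≤ δ) (hρ : 0 ≤ ρ) (hρ1 : ρ ≤ 1)
    (hsmall : (1 + C * S * s ^ 2 / κ) / (1 - κ) * (4 * s ^ 3 * δ) ≤ ρ)
    (hsmall' : (1 + C * S * s ^ 2 / κ) / (1 - κ) * (4 * s ^ 3 * δ) ≤ 1 / 2) :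
    ∃ h : X → V →L[ℝ] V, (∀ x v, ‖h x v‖ ≤ ρ * ‖v‖) ∧ (∀ x v, h x v ∈ G x) ∧
      (∀ x v, h x (P x v) = h x v) ∧ Inv T A (graphField R h) := by
  obtain ⟨Bi, hBi, hBi', hBin⟩ := hB.exists_inverse
  have hs1 : 1 ≤ s := by rw [hs]; nlinarith [mul_nonneg (sub_nonneg.2 hS) (sub_nonneg.2 hK)]
  have hSs : S ≤ s := by rw [hs]; nlinarith [mul_nonneg (sub_nonneg.2 hS) (sub_nonneg.2 hK)]
  have hSKs : S * K ≤ s := by rw [hs]; nlinarith [mul_nonneg (sub_nonneg.2 hS) (sub_nonneg.2 hK)]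
  have hcomm := hP.comm hF hG
  have hcommR := hP.symm.comm hG hF
  set l : X → V →L[ℝ] V := fun x => R x * Bi x with hl
  set r : X → V →L[ℝ] V := fun x => B x * P x with hr
  set a : X → V →L[ℝ] V := fun x => R x * Bi x * R (T x) with ha
  have hln : ∀ y, ‖l y‖ ≤ s := fun y => norm_le_of_apply (by linarith) fun v => by
    calc ‖R y (Bi y v)‖ ≤ S * (K * ‖v‖) := (hRS _ _).trans (by gcongr; exact hBin _ _)
      _ = S * K * ‖v‖ := by ring
      _ ≤ _ := by gcongr
  have hrn : ∀ y, ‖r y‖ ≤ s := fun y => norm_le_of_apply (by linarith) fun v => by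
    calc ‖B y (P y v)‖ ≤ K * (S * ‖v‖) := ((hB _ _).1).trans (by gcongr; exact hPS _ _)
      _ = S * K * ‖v‖ := by ring
      _ ≤ _ := by gcongr
  have han : ∀ y, ‖a y‖ ≤ s := fun y => norm_le_of_apply (by linarith) fun v => by
    calc ‖R y (Bi y (R (T y) v))‖ ≤ S * (K * (S * ‖v‖)) :=
          (hRS _ _).trans (by gcongr; exact (hBin _ _).trans (by gcongr; exact hRS _ _))
      _ = S * K * S * ‖v‖ := by ring
      _ = _ := by rw [hs]
  have hPn : ∀ x, ‖P x‖ ≤ s := fun x => (norm_le_of_apply (by linarith) (hPS x)).trans hSs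
  have hrP : ∀ y v, r y (P y v) = r y v := fun y v => by
    simp only [hr, mul_apply_eq_comp]
    rw [hP.P_F _ _ (hP.P_mem y v)]
  have hpow1 : ∀ N (h : X → V →L[ℝ] V), (∀ x v, h x v ∈ G x) →
      (∀ x v, (transferOp l r T ^ N) h x v ∈ G x) ∧ ∀ x, ∀ f ∈ F x,
      cp T B N x ((transferOp l r T ^ N) h x f) = h (T^[N] x) (cp T B N x f) := by
    intro N h hh
    induction N with
    | zero => exact ⟨hh, fun x f hf => rfl⟩
    | succ N ih =>
      refine ⟨fun x v => ?_, fun x f hf => ?_⟩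
      · rw [pow_succ', mul_apply_eq_comp]; exact hP.R_mem _ _
      · rw [pow_succ', mul_apply_eq_comp, transferOp_apply, cp_succ_apply, cp_succ_apply,
          Function.iterate_succ_apply, hl, hr]
        simp only [mul_apply_eq_comp]
        rw [hP.P_F _ _ hf, ← hcommR, hBi', hP.R_G _ _ (ih.1 _ _), ih.2 _ _ (hF x f hf)]
  have hpow : ∀ N h, ‖(transferOp l r T ^ N) (transferOp l r T h)‖ ≤
      C * S * κ ^ N * ‖transferOp l r T h‖ := by
    intro N h
    set m := transferOp l r T h with hm
    obtain ⟨hm1, hm2⟩ := hpow1 N m fun x v => hP.R_mem _ _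
    have hmP : ∀ x v, (transferOp l r T ^ N) m x (P x v) = (transferOp l r T ^ N) m x v := by
      intro x v
      rcases N with - | N
      · exact congrArg (fun z => l x (h (T x) z)) (hrP x v)
      · rw [pow_succ', mul_apply_eq_comp, transferOp_apply, mul_apply_eq_comp, hrP]; rfl
    rw [pi_norm_le_iff_of_nonneg (by positivity)]
    intro x
    refine norm_le_of_apply (by positivity) fun v => ?_
    rw [← hmP]
    have h1 := hE N x _ (hP.P_mem x v) _ (hm1 x (P x v))
    rw [hm2 _ _ (hP.P_mem x v)] at h1
    have hS2 := hPS x v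
    set f := P x v
    rcases eq_or_ne f 0 with h0 | h0
    · rw [h0, map_zero, norm_zero]; positivity
    have h2 : ‖m (T^[N] x) (cp T B N x f)‖ ≤ ‖m‖ * ‖cp T B N x f‖ :=
      ((m _).le_opNorm _).trans (by gcongr; exact norm_le_pi_norm m _)
    have h3 : 0 < ‖cp T B N x f‖ := by
      refine norm_pos_iff.2 fun h4 => h0 ?_
      have := (hB.cp (T := T) (by linarith) N x f).2
      rw [h4, norm_zero, mul_zero] at this
      exact norm_le_zero_iff.1 this
    refine le_of_mul_le_mul_left (h1.trans ?_) h3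
    calc C * κ ^ N * (‖m (T^[N] x) (cp T B N x f)‖ * ‖f‖)
        ≤ C * κ ^ N * ((‖m‖ * ‖cp T B N x f‖) * (S * ‖v‖)) := by gcongr
      _ = _ := by ring
  obtain ⟨h, hn, hfix⟩ := exists_graph_field (l := l) (r := r) (a := a) (b := fun x => -R (T x))
    (c := fun x => P (T x)) (E := fun x => A x - B x) (e := P) (φ := T) (σ := T) (τ := id)
    hs1 hln hrn han
    (fun x => (norm_neg (R (T x))).trans_le ((norm_le_of_apply (by linarith) (hRS (T x))).trans hSs))
    (fun x => hPn _) hPn hAB hδ (by positivity) hκ0 hκ hρ hρ1 hpow hsmall hsmall'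
  have hfix' : ∀ x v, h x v = R x (Bi x (h (T x) (B x (P x v)))) +
      R x (Bi x (R (T x) (h (T x) (P (T x) ((A x - B x) (P x v + h x (P x v)))) -
        R (T x) ((A x - B x) (P x v + h x (P x v)))))) := by
    intro x v
    conv_lhs => rw [hfix x]
    simp only [hl, hr, ha, add_apply, mul_apply_eq_comp, one_apply_eq_self, id_eq,
      neg_add_eq_sub, sub_apply]
  have hhG : ∀ x v, h x v ∈ G x := by
    intro y v
    rw [hfix' y]
    exact (G y).add_mem (hP.R_mem _ _) (hP.R_mem _ _)
  have hhP : ∀ x v, h x (P x v) = h x v := by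
    intro y v
    rw [hfix' y, hP.P_F _ _ (hP.P_mem y v), ← hfix' y]
  refine ⟨h, fun x v => ((h x).le_opNorm v).trans (by gcongr; exact hn x), hhG, hhP, ?_⟩
  intro x v hv
  rw [mem_graphField] at hv ⊢
  have h1 := congrArg (B x) (hfix' x v)
  rw [hhP x v, hv, hP.add, map_add, ← hcommR, ← hcommR, ← hcommR, hBi', hBi', map_sub, hhP, ← hcomm,
    hhP, hP.R_G _ _ (hhG _ _), hP.R_G _ _ (hP.R_mem _ _),
    hP.R_G _ _ ((G _).sub_mem (hP.R_mem _ _) (hP.R_mem _ _)), hP.R_G _ _ (hhG _ _)] at h1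
  simp only [sub_apply, map_sub] at h1
  have h2 : h (T x) (A x v) - R (T x) (A x v) = 0 := by
    linear_combination (norm := module) -h1
  exact sub_eq_zero.1 h2

theorem norm_cp_sub_le (hA : Bdd A K) (hB : Bdd B K) (hK : 1 ≤ K) {δ : ℝ}
    (hAB : ∀ x, ‖A x - B x‖ ≤ δ) (N : ℕ) (x : X) (v : V) :
    ‖cp T A N x v - cp T B N x v‖ ≤ N * K ^ N * δ * ‖v‖ := by
  have hδ : 0 ≤ δ := (norm_nonneg _).trans (hAB x)
  induction N with
  | zero => simp [cp]
  | succ N ih =>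
    rw [cp_succ_apply', cp_succ_apply']
    set a := cp T A N x v
    set b := cp T B N x v
    have hb : ‖b‖ ≤ K ^ N * ‖v‖ := (hB.cp (T := T) (by linarith) N x v).1
    have e1 : A (T^[N] x) a - B (T^[N] x) b =
        A (T^[N] x) (a - b) + (A (T^[N] x) - B (T^[N] x)) b := by
      rw [map_sub, sub_apply]; abel
    rw [e1]
    have hKN : K ^ N ≤ K ^ (N + 1) := pow_le_pow_right₀ hK (by omega)
    calc _ ≤ K * (N * K ^ N * δ * ‖v‖) + δ * (K ^ N * ‖v‖) := by
          refine (norm_add_le _ _).trans (add_le_add ?_ ?_)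
          · exact ((hA _ _).1).trans (by gcongr)
          · exact ((A (T^[N] x) - B (T^[N] x)).le_opNorm_of_le hb).trans (by gcongr; exact hAB _)
      _ ≤ K * (N * K ^ N * δ * ‖v‖) + δ * (K ^ (N + 1) * ‖v‖) := by gcongr
      _ = _ := by push_cast; ring

/-- The cocycle has a splitting which is dominated at time `N`. -/
def Splits (T : Equiv.Perm X) (A : X → V →L[ℝ] V) (N : ℕ) : Prop :=
  ∃ F G : X → Submodule ℝ V, (∀ x, F x ≠ ⊥) ∧ (∀ x, G x ≠ ⊥) ∧ Inv T A F ∧ Inv T A G ∧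
    (∀ x, IsCompl (F x) (G x)) ∧
    ∀ x, ∀ f ∈ F x, ∀ g ∈ G x, 3 * (‖cp T A N x f‖ * ‖g‖) ≤ ‖cp T A N x g‖ * ‖f‖

theorem finrank_graphField {P R h : X → V →L[ℝ] V} (hP : Split F G P R)
    (hFG : ∀ x, IsCompl (F x) (G x)) (hh : ∀ x v, h x v ∈ F x) (x : X) :
    Module.finrank ℝ (G x) ≤ Module.finrank ℝ (graphField P h x) := by
  have h1 := Submodule.finrank_add_eq_of_isCompl (hFG x)
  have h2 := LinearMap.finrank_range_add_finrank_ker ((h x - P x : V →L[ℝ] V) : V →ₗ[ℝ] V)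
  have h3 : Module.finrank ℝ (LinearMap.range ((h x - P x : V →L[ℝ] V) : V →ₗ[ℝ] V)) ≤
      Module.finrank ℝ (F x) := by
    refine Submodule.finrank_mono ?_
    rintro _ ⟨v, rfl⟩
    exact (F x).sub_mem (hh x v) (hP.P_mem x v)
  unfold graphField
  omega

end Robust

theorem domination_transfer {C k a b a' b' f f' g g' : ℝ} (hC : 0 ≤ C) (hk : 0 ≤ k)
    (hCk : 16 * C * k ≤ 1 / 2) (ha : 0 ≤ a') (hb : 0 ≤ b) (hf : 0 ≤ f) (hg : 0 ≤ g)
    (h₁ : a ≤ 2 * a') (h₂ : b' ≤ 2 * b) (h₃ : g ≤ 2 * g') (h₄ : f' ≤ 2 * f)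
    (h : a' * g' ≤ C * k * (b' * f')) (hf' : 0 ≤ f') : 2 * (a * g) ≤ b * f := by
  have hbf := mul_nonneg hb hf
  calc 2 * (a * g) ≤ 2 * ((2 * a') * (2 * g')) := by gcongr
    _ = 8 * (a' * g') := by ring
    _ ≤ 8 * (C * k * (b' * f')) := by gcongr
    _ ≤ 8 * (C * k * ((2 * b) * (2 * f))) := by gcongr
    _ = 2 * (16 * C * k) * (b * f) := by ring
    _ ≤ 2 * (1 / 2) * (b * f) := by gcongr
    _ = _ := by ring

section Robust

variable {X : Type*} [Fintype X] {T : Equiv.Perm X}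
variable {V : Type*} [NormedAddCommGroup V] [InnerProductSpace ℝ V] [FiniteDimensional ℝ V]
  {A B : X → V →L[ℝ] V} {K C κ : ℝ} {F G : X → Submodule ℝ V}

theorem norm_cp_near (hA : Bdd A K) (hB : Bdd B K) (hK : 1 ≤ K) {δ ρ : ℝ} {ℓ : ℕ} (hρ0 : 0 ≤ ρ)
    (hAB : ∀ x, ‖A x - B x‖ ≤ δ) (hδ : ℓ * K ^ (2 * ℓ) * δ ≤ 1 / 4) (hρ : K ^ (2 * ℓ) * ρ ≤ 1 / 4)
    {x : X} {v w : V} (hvw : ‖v - w‖ ≤ ρ * ‖v‖) :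
    ‖cp T A ℓ x v - cp T B ℓ x w‖ ≤ 1 / 2 * ‖cp T A ℓ x v‖ := by
  have hK0 : 0 ≤ K := by linarith
  have hδ0 : 0 ≤ δ := (norm_nonneg _).trans (hAB x)
  have hKK : K ^ ℓ * K ^ ℓ = K ^ (2 * ℓ) := by rw [← pow_add]; congr 1; ring
  have e1 := norm_cp_sub_le (T := T) hA hB hK hAB ℓ x v
  have e2 := (hB.cp (T := T) hK0 ℓ x (v - w)).1
  rw [map_sub] at e2
  have e3 := (hA.cp (T := T) hK0 ℓ x v).2
  calc ‖cp T A ℓ x v - cp T B ℓ x w‖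
      ≤ ‖cp T A ℓ x v - cp T B ℓ x v‖ + ‖cp T B ℓ x v - cp T B ℓ x w‖ := norm_sub_le_norm_sub_add_norm_sub _ _ _
    _ ≤ ℓ * K ^ ℓ * δ * ‖v‖ + K ^ ℓ * (ρ * ‖v‖) := add_le_add e1 (e2.trans (by gcongr))
    _ = (ℓ * K ^ ℓ * δ + K ^ ℓ * ρ) * ‖v‖ := by ring
    _ ≤ (ℓ * K ^ ℓ * δ + K ^ ℓ * ρ) * (K ^ ℓ * ‖cp T A ℓ x v‖) := by gcongr
    _ = (ℓ * (K ^ ℓ * K ^ ℓ) * δ + (K ^ ℓ * K ^ ℓ) * ρ) * ‖cp T A ℓ x v‖ := by ring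
    _ ≤ _ := by rw [hKK]; gcongr; linarith

/-- The graphs are `ρ`-close to `F` and `G`, and the products of `A` and `B` over `ℓ` steps are
close. Each of the four norms in the domination inequality changes by a factor at most `2`, which
explains the factor `16` required at time `ℓ`. -/
theorem dom_graphField {P R h k : X → V →L[ℝ] V} (hP : Split F G P R) (hE : ExpDom T B F G C κ)
    (hC : 0 ≤ C) (hκ0 : 0 ≤ κ) (hA : Bdd A K) (hB : Bdd B K) (hK : 1 ≤ K) {δ ρ : ℝ} {ℓ : ℕ}
    (hℓ : 16 * C * κ ^ ℓ ≤ 1 / 2) (hρ0 : 0 ≤ ρ) (hρ4 : ρ ≤ 1 / 4)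
    (hAB : ∀ x, ‖A x - B x‖ ≤ δ) (hδ : ℓ * K ^ (2 * ℓ) * δ ≤ 1 / 4) (hρ : K ^ (2 * ℓ) * ρ ≤ 1 / 4)
    (hn : ∀ x v, ‖h x v‖ ≤ ρ * ‖v‖) (kn : ∀ x v, ‖k x v‖ ≤ ρ * ‖v‖) :
    Dom T A (graphField R k) (graphField P h) ℓ := by
  intro x f hf g hg
  rw [mem_graphField] at hf hg
  have hf1 : ‖f - P x f‖ ≤ ρ * ‖f‖ := by
    have : f - P x f = k x f := by rw [hf, sub_eq_iff_eq_add', hP.add]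
    rw [this]; exact kn x f
  have hg1 : ‖g - R x g‖ ≤ ρ * ‖g‖ := by
    have : g - R x g = h x g := by rw [hg, sub_eq_iff_eq_add, hP.add]
    rw [this]; exact hn x g
  have a1 := norm_cp_near (T := T) (x := x) hA hB hK hρ0 hAB hδ hρ hf1
  have a2 := norm_cp_near (T := T) (x := x) hA hB hK hρ0 hAB hδ hρ hg1
  have a3 := norm_sub_norm_le (cp T A ℓ x f) (cp T B ℓ x (P x f))
  have a4 := norm_sub_norm_le (cp T B ℓ x (R x g)) (cp T A ℓ x g)
  rw [norm_sub_rev] at a4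
  have a5 := norm_sub_norm_le g (R x g)
  have a6 := norm_sub_norm_le (P x f) f
  rw [norm_sub_rev] at a6
  have a7 := hE ℓ x _ (hP.P_mem x f) _ (hP.R_mem x g)
  have b1 : ‖cp T A ℓ x f‖ ≤ 2 * ‖cp T B ℓ x (P x f)‖ := by linarith
  have b2 : ‖cp T B ℓ x (R x g)‖ ≤ 2 * ‖cp T A ℓ x g‖ := by
    linarith [norm_nonneg (cp T A ℓ x g)]
  have b3 : ‖g‖ ≤ 2 * ‖R x g‖ := by nlinarith [norm_nonneg g]
  have b4 : ‖P x f‖ ≤ 2 * ‖f‖ := by nlinarith [norm_nonneg f]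
  exact domination_transfer hC (pow_nonneg hκ0 ℓ) hℓ (by positivity) (by positivity) (by positivity) (by positivity)
    b1 b2 b3 b4 a7 (norm_nonneg _)

end Robust

/-- Robustness of dominated splittings. -/
theorem exists_splits_of_near (K C κ : ℝ) (hK : 1 ≤ K) (hC : 0 ≤ C) (hκ0 : 0 < κ) (hκ1 : κ < 1) :
    ∃ (δ : ℝ) (L : ℕ), 0 < δ ∧ ∀ (X : Type v) [Fintype X] (T : Equiv.Perm X) (d : ℕ)
      (A B : X → Sp d →L[ℝ] Sp d) (_ : Bdd A K) (_ : Bdd B K) (_ : ∀ x, ‖A x - B x‖ ≤ δ)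
      (F G : X → Submodule ℝ (Sp d)) (_ : ∀ x, IsCompl (F x) (G x)) (_ : ∀ x, F x ≠ ⊥)
      (_ : ∀ x, G x ≠ ⊥) (_ : Inv T B F) (_ : Inv T B G) (_ : ExpDom T B F G C κ),
      ∀ N ≥ L, Splits T A N := by
  obtain ⟨-, -, N₀, -, -, -, hN₀, -⟩ := exists_ext_const C κ hκ0 hκ1
  obtain ⟨ℓ, hℓ0, hℓ⟩ : ∃ ℓ : ℕ, 0 < ℓ ∧ 16 * C * κ ^ ℓ ≤ 1 / 2 := by
    have h0 : Filter.Tendsto (fun N : ℕ => 16 * C * κ ^ N) Filter.atTop (nhds (16 * C * 0)) :=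
      (tendsto_pow_atTop_nhds_zero_of_lt_one hκ0.le hκ1).const_mul _
    rw [mul_zero] at h0
    obtain ⟨ℓ, h1, h2⟩ := ((h0.eventually_le_const (show (0 : ℝ) < 1 / 2 by norm_num)).and
      (Filter.eventually_gt_atTop 0)).exists
    exact ⟨ℓ, h2, h1⟩
  obtain ⟨κ', hκ'0, hκ'1, hκ'⟩ := exists_pow_eq_half hℓ0
  -- Domination at time `ℓ` becomes exponential with rate `κ'`, and from time `L` on it gives the
  -- factor `3` at every `N`, not only at multiples of `ℓ`.
  obtain ⟨L, hL⟩ : ∃ L : ℕ, ∀ N ≥ L, 2 * K ^ (2 * ℓ) * κ' ^ N ≤ 1 / 3 := by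
    have h0 : Filter.Tendsto (fun N : ℕ => 2 * K ^ (2 * ℓ) * κ' ^ N) Filter.atTop
        (nhds (2 * K ^ (2 * ℓ) * 0)) :=
      (tendsto_pow_atTop_nhds_zero_of_lt_one hκ'0.le hκ'1).const_mul _
    rw [mul_zero] at h0
    exact Filter.eventually_atTop.1 (h0.eventually_le_const (show (0 : ℝ) < 1 / 3 by norm_num))
  have hK0 : 0 < K := by linarith
  set S := 3 * K ^ (2 * N₀) + 1 with hS
  have hS1 : 1 ≤ S := by rw [hS]; linarith [show 0 ≤ 3 * K ^ (2 * N₀) by positivity]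
  set s := S * K * S with hs
  have hs0 : 0 < s := by positivity
  set M := (1 + C * S * s ^ 2 / κ) / (1 - κ) with hM
  have hM0 : 0 < M := div_pos (by positivity) (by linarith)
  set ρ := 1 / (4 * K ^ (2 * ℓ)) with hρ
  have hρ0 : 0 < ρ := by positivity
  have hKK : K ^ ℓ * K ^ ℓ = K ^ (2 * ℓ) := by rw [← pow_add]; congr 1; ring
  have hKℓ : 1 ≤ K ^ (2 * ℓ) := one_le_pow₀ hK
  have hρK : K ^ (2 * ℓ) * ρ = 1 / 4 := by rw [hρ]; field_simp
  have hρ4 : ρ ≤ 1 / 4 := by nlinarith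
  -- The first bound keeps the `ℓ`-step products of `A` and `B` close; the second gives graph maps
  -- of norm at most `ρ`, which is small compared with `K^{-2ℓ}`.
  set δ := min (1 / (4 * ℓ * K ^ (2 * ℓ))) (ρ / (M * (4 * s ^ 3))) with hδ
  have hδ0 : 0 < δ := by positivity
  have hδ1 : ℓ * K ^ (2 * ℓ) * δ ≤ 1 / 4 := by
    have h1 : δ ≤ 1 / (4 * ℓ * K ^ (2 * ℓ)) := min_le_left _ _
    rw [le_div_iff₀ (by positivity)] at h1
    linarith
  have hδ2 : M * (4 * s ^ 3 * δ) ≤ ρ := by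
    have h1 : δ ≤ ρ / (M * (4 * s ^ 3)) := min_le_right _ _
    rw [le_div_iff₀ (by positivity)] at h1
    linarith
  refine ⟨δ, L, hδ0, ?_⟩
  intro X _ T d A B hA hB hAB F G hFG hFne hGne hF hG hE
  obtain ⟨P, R, hP⟩ := exists_split hFG
  have hPS : ∀ x v, ‖P x v‖ ≤ S * ‖v‖ := by
    intro x v
    have := hE.angle hB hK hN₀ (hP.P_mem x v) ((G x).neg_mem (hP.R_mem x v))
    rw [sub_neg_eq_add, hP.add] at this
    exact this.trans (by rw [hS]; gcongr; linarith)
  have hRS : ∀ x v, ‖R x v‖ ≤ S * ‖v‖ := by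
    intro x v
    have := hE.angle_right hB hK hN₀ (hP.P_mem x v) ((G x).neg_mem (hP.R_mem x v))
    rwa [sub_neg_eq_add, hP.add, norm_neg] at this
  obtain ⟨h, hn, hhF, hhR, hinv⟩ := exists_invariant_right hP hB hK hF hG hE hC hκ0 hκ1 hS1 hPS hRS hs
    hAB hδ0.le hρ0.le (by linarith) hδ2 (hδ2.trans (by linarith))
  obtain ⟨k, kn, hkG, hkP, kinv⟩ := exists_invariant_left hP hB hK hF hG hE hC hκ0 hκ1 hS1 hPS hRS hs
    hAB hδ0.le hρ0.le (by linarith) hδ2 (hδ2.trans (by linarith))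
  have hd1 := finrank_graphField hP hFG hhF
  have hd2 := finrank_graphField hP.symm (fun x => (hFG x).symm) hkG
  -- The dimensions are large enough, so only disjointness matters. A common vector has each
  -- component at most a quarter of the other, hence vanishes.
  have hcompl : ∀ x, IsCompl (graphField R k x) (graphField P h x) := by
    intro x
    rw [Submodule.isCompl_iff_disjoint _ _ (by
      rw [← Submodule.finrank_add_eq_of_isCompl (hFG x)]; exact add_le_add (hd2 x) (hd1 x)),
      Submodule.disjoint_def]
    intro v hv1 hv2
    rw [mem_graphField] at hv1 hv2
    have h1 := hn x (R x v)
    have h2 := kn x (P x v)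
    rw [hhR, hv2] at h1
    rw [hkP, hv1] at h2
    have h3 : ‖P x v‖ ≤ 0 := by
      have : ρ * ‖R x v‖ ≤ 1 / 4 * ((1 / 4) * ‖P x v‖) := by
        gcongr; exact h2.trans (by gcongr)
      linarith [norm_nonneg (P x v)]
    have h4 : ‖R x v‖ ≤ 0 := h2.trans (by nlinarith)
    rw [← hP.add x v, norm_le_zero_iff.1 h3, norm_le_zero_iff.1 h4, add_zero]
  have hpos : ∀ (H : Submodule ℝ (Sp d)), H ≠ ⊥ → 0 < Module.finrank ℝ H := fun H hH =>
    Nat.pos_of_ne_zero fun h0 => hH (Submodule.finrank_eq_zero.1 h0)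
  have hne : ∀ (H : Submodule ℝ (Sp d)), 0 < Module.finrank ℝ H → H ≠ ⊥ := fun H hH h0 => by
    rw [h0, finrank_bot] at hH; exact lt_irrefl _ hH
  have hdom := dom_graphField hP hE hC hκ0.le hA hB hK hℓ hρ0.le hρ4 hAB hδ1 hρK.le hn kn
  have hE' := hdom.expDom hA hK kinv hinv hℓ0 hκ'0.le hκ'1.le hκ'
  intro N hN
  refine ⟨_, _, fun x => hne _ ((hpos _ (hFne x)).trans_le (hd2 x)),
    fun x => hne _ ((hpos _ (hGne x)).trans_le (hd1 x)), kinv, hinv, hcompl, ?_⟩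
  intro x f hf g hg
  have h1 := hE' N x f hf g hg
  have h2 := mul_le_mul_of_nonneg_right (hL N hN)
    (mul_nonneg (norm_nonneg (cp T A N x g)) (norm_nonneg f))
  linarith

end FibreCocycle

namespace FibreCocycle

/-! ### Complex eigenvalues: invariant planes and complex structures -/

section ComplexEigenvalue

variable {V : Type*} [AddCommGroup V] [Module ℝ V] [FiniteDimensional ℝ V]

/-- The real quadratic polynomial with prescribed trace and determinant. -/
noncomputable def quad (c m : ℝ) : ℝ[X] := Polynomial.X ^ 2 - C c * Polynomial.X + C m

theorem aeval_quad (M : Module.End ℝ V) (c m : ℝ) (v : V) :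
    aeval M (quad c m) v = M (M v) - c • M v + m • v := by
  simp [quad, pow_two, Module.algebraMap_end_apply]

/-- Real and imaginary parts of a complex eigenvector span a space killed by the quadratic factor,
and at least one of them is nonzero. -/
theorem exists_ker_quad {M : Module.End ℝ V} {z : ℂ}
    (hz : (M.charpoly.map (algebraMap ℝ ℂ)).IsRoot z) :
    ∃ v ≠ 0, aeval M (quad (2 * z.re) (z.re ^ 2 + z.im ^ 2)) v = 0 := by
  classical
  let b := Module.finBasis ℝ V
  set A := LinearMap.toMatrix b b M with hA
  have h1 : (A.map (algebraMap ℝ ℂ)).charpoly.eval z = 0 := by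
    rw [Matrix.charpoly_map, hA, LinearMap.charpoly_toMatrix]; exact hz
  rw [Matrix.eval_charpoly] at h1
  obtain ⟨w, hw0, hw⟩ := Matrix.exists_mulVec_eq_zero_iff.2 h1
  rw [Matrix.sub_mulVec, sub_eq_zero] at hw
  have hre : ∀ i, A.mulVec (fun j => (w j).re) i = z.re * (w i).re - z.im * (w i).im := by
    intro i
    have := congrArg Complex.re (congrFun hw i)
    simp [Matrix.mulVec, dotProduct, Matrix.scalar_apply, Matrix.diagonal_apply] at this
    simp [Matrix.mulVec, dotProduct]
    linarith
  have him : ∀ i, A.mulVec (fun j => (w j).im) i = z.re * (w i).im + z.im * (w i).re := by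
    intro i
    have := congrArg Complex.im (congrFun hw i)
    simp [Matrix.mulVec, dotProduct, Matrix.scalar_apply, Matrix.diagonal_apply] at this
    simp [Matrix.mulVec, dotProduct]
    linarith
  set u₁ := b.equivFun.symm fun j => (w j).re with hu₁
  set u₂ := b.equivFun.symm fun j => (w j).im with hu₂
  have hM : ∀ f : Fin (Module.finrank ℝ V) → ℝ,
      M (b.equivFun.symm f) = b.equivFun.symm (A.mulVec f) := by
    intro f
    apply b.equivFun.injective
    rw [LinearEquiv.apply_symm_apply, hA]
    have := LinearMap.toMatrix_mulVec_repr b b M (b.equivFun.symm f)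
    rw [← b.equivFun_apply, ← b.equivFun_apply, LinearEquiv.apply_symm_apply] at this
    exact this.symm
  have h₁ : M u₁ = z.re • u₁ - z.im • u₂ := by
    rw [hu₁, hM, ← map_smul, ← map_smul, ← map_sub]
    congr 1; funext i; rw [hre]; rfl
  have h₂ : M u₂ = z.re • u₂ + z.im • u₁ := by
    rw [hu₂, hM, ← map_smul, ← map_smul, ← map_add]
    congr 1; funext i; rw [him]; rfl
  by_cases h0 : u₁ = 0
  · refine ⟨u₂, fun h0' => hw0 ?_, ?_⟩
    · funext i
      have e1 := congrFun ((LinearEquiv.map_eq_zero_iff _).1 h0) i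
      have e2 := congrFun ((LinearEquiv.map_eq_zero_iff _).1 h0') i
      exact Complex.ext e1 e2
    · rw [aeval_quad, h₂, map_add, map_smul, map_smul, h₂, h₁]; module
  · exact ⟨u₁, h0, by rw [aeval_quad, h₁, map_sub, map_smul, map_smul, h₂, h₁]; module⟩

/-- The characteristic polynomial of a real plane map commuting with a complex structure. -/
theorem charpoly_of_complex_structure (hV : Module.finrank ℝ V = 2) {J N : Module.End ℝ V} {a b : ℝ}
    (hJ : ∀ v, J (J v) = -v) (hN : ∀ v, N v = a • v + b • J v) :
    N.charpoly = quad (2 * a) (a ^ 2 + b ^ 2) := by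
  have : Nontrivial V := Module.nontrivial_of_finrank_pos (R := ℝ) (by omega)
  obtain ⟨v, hv⟩ := exists_ne (0 : V)
  have hli : LinearIndependent ℝ ![v, J v] := by
    rw [LinearIndependent.pair_iff]
    intro s t hst
    have h1 := congrArg J hst
    rw [map_add, map_smul, map_smul, hJ, map_zero] at h1
    have h2 : (s ^ 2 + t ^ 2) • v = 0 := by
      have : (s ^ 2 + t ^ 2) • v = s • (s • v + t • J v) - t • (s • J v + t • -v) := by module
      rw [this, hst, h1]; simp
    have h3 := (smul_eq_zero.1 h2).resolve_right hv
    constructor <;> nlinarith [sq_nonneg s, sq_nonneg t]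
  let B := basisOfLinearIndependentOfCardEqFinrank hli (by simp [hV])
  have hB0 : B 0 = v := by simp [B]
  have hB1 : B 1 = J v := by simp [B]
  have hm : LinearMap.toMatrix B B N = !![a, -b; b, a] := by
    have e0 : N (B 0) = a • B 0 + b • B 1 := by rw [hB0, hB1, hN]
    have e1 : N (B 1) = (-b) • B 0 + a • B 1 := by rw [hB0, hB1, hN, hJ]; module
    ext i j
    rw [LinearMap.toMatrix_apply]
    fin_cases j <;> fin_cases i <;> simp [e0, e1]
  rw [← LinearMap.charpoly_toMatrix N B, hm, Matrix.charpoly_fin_two, quad,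
    Matrix.trace_fin_two_of, Matrix.det_fin_two_of]
  congr 3 <;> ring_nf

end ComplexEigenvalue

section ComplexStructure

variable {X : Type*} [Fintype X] {T : Equiv.Perm X}
variable {V : Type*} [NormedAddCommGroup V] [InnerProductSpace ℝ V] [FiniteDimensional ℝ V]
  {A B : X → V →L[ℝ] V} {K a b e : ℝ}

/-- The map `J` with `M = a + b J`, where `M` is the return map. -/
noncomputable def cstr (T : Equiv.Perm X) (A : X → V →L[ℝ] V) (a b : ℝ) (x : X) : V →L[ℝ] V :=
  b⁻¹ • (cp T A (Fintype.card X) x - a • 1)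

theorem ret_eq_cstr (hb : b ≠ 0) (x : X) (v : V) :
    ret T A x v = a • v + b • cstr T A a b x v := by
  rw [ret_apply, cstr]
  simp only [smul_apply, sub_apply, one_apply_eq_self, smul_smul, mul_inv_cancel₀ hb]
  module

theorem cstr_comm (hT : IsCyclic T) (x : X) (v : V) :
    cstr T A a b (T x) (A x v) = A x (cstr T A a b x v) := by
  simp only [cstr, smul_apply, sub_apply, one_apply_eq_self, map_smul, map_sub]
  congr 2
  exact ret_comm hT x v

theorem cstr_cp (hT : IsCyclic T) (N : ℕ) (x : X) (v : V) :
    cstr T A a b (T^[N] x) (cp T A N x v) = cp T A N x (cstr T A a b x v) := by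
  induction N with
  | zero => rfl
  | succ N ih => rw [cp_succ_apply', cp_succ_apply', Function.iterate_succ_apply', cstr_comm hT, ih]

theorem cstr_cstr (hb : b ≠ 0) (x : X) {v : V}
    (hv : aeval (ret T A x) (quad (2 * a) (a ^ 2 + b ^ 2)) v = 0) :
    cstr T A a b x (cstr T A a b x v) = -v := by
  rw [aeval_quad] at hv
  have h1 := ret_eq_cstr (T := T) (A := A) (a := a) hb x v
  have h2 := ret_eq_cstr (T := T) (A := A) (a := a) hb x (cstr T A a b x v)
  rw [h1, map_add, map_smul, map_smul, h1, h2] at hv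
  have h3 : (b ^ 2) • (cstr T A a b x (cstr T A a b x v) + v) = 0 := by
    rw [← hv]; module
  exact eq_neg_of_add_eq_zero_left ((smul_eq_zero.1 h3).resolve_left (pow_ne_zero 2 hb))

/-- A complex eigenvalue gives an invariant field of planes, with a complex structure. -/
theorem exists_plane_field (hT : IsCyclic T) (hA : Bdd A K) {x₀ : X} {z : ℂ}
    (hz : ((chi T A x₀).map (algebraMap ℝ ℂ)).IsRoot z) (hb : z.im ≠ 0) :
    ∃ W : X → Submodule ℝ V, (∀ x, Module.finrank ℝ (W x) = 2) ∧ Inv T A W ∧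
      (∀ x, ∀ w ∈ W x, cstr T A z.re z.im x w ∈ W x) ∧
      ∀ x, ∀ w ∈ W x, cstr T A z.re z.im x (cstr T A z.re z.im x w) = -w := by
  obtain ⟨v₀, hv₀, hq₀⟩ := exists_ker_quad hz
  set J := cstr T A z.re z.im with hJ
  choose k hk hkx using exists_iter_eq hT x₀
  set v : X → V := fun x => cp T A (k x) x₀ v₀ with hv
  have hJJ : ∀ x, J x (J x (v x)) = - v x := by
    intro x
    have : J x = J (T^[k x] x₀) := by rw [hkx]
    rw [this, hv, hJ, cstr_cp hT, cstr_cp hT, cstr_cstr hb x₀ hq₀, map_neg]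
  have hv0 : ∀ x, v x ≠ 0 := by
    intro x h0
    have := (hA.mono (le_abs_self K)).cp (T := T) (abs_nonneg K) (k x) x₀ v₀
    rw [show cp T A (k x) x₀ v₀ = 0 from h0, norm_zero, mul_zero] at this
    exact hv₀ (norm_le_zero_iff.1 this.2)
  have hmem : ∀ x w, w ∈ Submodule.span ℝ {v x, J x (v x)} ↔ ∃ s t : ℝ, s • v x + t • J x (v x) = w :=
    fun x w => Submodule.mem_span_pair
  have hJmem : ∀ x, ∀ w ∈ Submodule.span ℝ {v x, J x (v x)},
      J x w ∈ Submodule.span ℝ {v x, J x (v x)} := by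
    intro x w hw
    obtain ⟨s, t, rfl⟩ := (hmem x w).1 hw
    refine (hmem x _).2 ⟨-t, s, ?_⟩
    rw [map_add, map_smul, map_smul, hJJ]; module
  have hAv : ∀ x, A x (v x) ∈ Submodule.span ℝ {v (T x), J (T x) (v (T x))} := by
    intro x
    have e1 : A x (v x) = cp T A (k x + 1) x₀ v₀ := by rw [cp_succ_apply', hkx]
    have e2 : T^[k x + 1] x₀ = T x := by rw [Function.iterate_succ_apply', hkx]
    rcases (Nat.succ_le_of_lt (hk x)).eq_or_lt with h | h
    · have h' : k x + 1 = Fintype.card X := h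
      have h0 : T x = x₀ := by rw [← e2, h', iter_card hT]
      have h1 : k x₀ = 0 := iter_inj hT (hk x₀) (Fintype.card_pos_iff.2 ⟨x₀⟩) (hkx x₀)
      have h2 : v x₀ = v₀ := by rw [hv]; simp only [h1]; rfl
      rw [hmem, h0]
      refine ⟨z.re, z.im, ?_⟩
      rw [hJ, ← ret_eq_cstr hb, h2, e1, h', ret_apply]
    · have h1 : k (T x) = k x + 1 := iter_inj hT (hk _) h ((hkx _).trans e2.symm)
      have : A x (v x) = v (T x) := by rw [e1, hv]; simp only [h1]
      rw [this]
      exact Submodule.subset_span (by simp)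
  refine ⟨fun x => Submodule.span ℝ {v x, J x (v x)}, fun x => ?_, ?_, hJmem, ?_⟩
  · have hli : LinearIndependent ℝ ![v x, J x (v x)] := by
      rw [LinearIndependent.pair_iff]
      intro s t hst
      have h1 := congrArg (J x) hst
      rw [map_add, map_smul, map_smul, hJJ, map_zero] at h1
      have h2 : (s ^ 2 + t ^ 2) • v x = 0 := by
        have : (s ^ 2 + t ^ 2) • v x = s • (s • v x + t • J x (v x)) -
          t • (s • J x (v x) + t • -v x) := by module
        rw [this, hst, h1]; simp
      have h3 := (smul_eq_zero.1 h2).resolve_right (hv0 x)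
      constructor <;> nlinarith [sq_nonneg s, sq_nonneg t]
    have := finrank_span_eq_card hli
    rwa [Matrix.range_cons, Matrix.range_cons, Matrix.range_empty, Set.union_empty,
      Set.singleton_union, Fintype.card_fin] at this
  · intro x w hw
    obtain ⟨s, t, rfl⟩ := (hmem x w).1 hw
    rw [map_add, map_smul, map_smul, ← cstr_comm hT]
    exact Submodule.add_mem _ (Submodule.smul_mem _ _ (hAv x))
      (Submodule.smul_mem _ _ (hJmem _ _ (hAv x)))
  · intro x w hw
    obtain ⟨s, t, rfl⟩ := (hmem x w).1 hw
    rw [map_add, map_smul, map_smul, map_add, map_smul, map_smul, hJJ, map_neg]; module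

/-- A complex structure with small distortion of right angles has bounded norm. -/
theorem norm_complex_structure_le {W : Submodule ℝ V} {J : V →L[ℝ] V} {Λ : ℝ} (hΛ : 0 ≤ Λ)
    (hW : ∀ w ∈ W, J w ∈ W) (hJ : ∀ w ∈ W, J (J w) = -w)
    (h : ∀ w ∈ W, ‖w‖ = 1 → ‖J w - inner ℝ w (J w) • w‖ ≤ Λ) {w : V} (hw : w ∈ W) :
    ‖J w‖ ≤ 2 * Λ * ‖w‖ := by
  suffices H : ∀ v ∈ W, ‖v‖ = 1 → ‖J v‖ ≤ 2 * Λ by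
    rcases eq_or_ne w 0 with rfl | h0
    · simp
    have h1 := H _ (W.smul_mem ‖w‖⁻¹ hw) (norm_smul_inv_norm (𝕜 := ℝ) h0)
    rw [map_smul, norm_smul, norm_inv, norm_norm, inv_mul_le_iff₀ (norm_pos_iff.2 h0)] at h1
    linarith
  intro v hv hv1
  set α : ℝ := inner ℝ v (J v) with hα
  set y := J v - α • v with hy
  have hyW : y ∈ W := W.sub_mem (hW v hv) (W.smul_mem _ hv)
  have hyv : inner ℝ y v = (0 : ℝ) := by
    rw [hy, inner_sub_left, inner_smul_left, real_inner_self_eq_norm_sq, hv1, real_inner_comm, hα]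
    simp
  have hyΛ : ‖y‖ ≤ Λ := h v hv hv1
  have hJv : J v = α • v + y := by rw [hy]; abel
  -- In the orthonormal frame `v, y / ‖y‖` the off-diagonal entries of `J` have moduli `‖y‖` and `(1
  -- + α²) / ‖y‖`. Both are at most `Λ`, which bounds `α²` by `Λ²`.
  have hJy : J y = -(1 + α ^ 2) • v - α • y := by
    rw [hy, map_sub, map_smul, hJ v hv, hJv]; module
  have hsq : ‖J v‖ ^ 2 = α ^ 2 + ‖y‖ ^ 2 := by
    rw [hJv, norm_add_sq_real, inner_smul_left, real_inner_comm, hyv, norm_smul, hv1,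
      Real.norm_eq_abs, mul_one, sq_abs]; simp
  have hy0 : y ≠ 0 := by
    intro h0
    rw [h0, map_zero, smul_zero, sub_zero] at hJy
    have := (smul_eq_zero.1 hJy.symm).resolve_right (fun h => by simp [h] at hv1)
    nlinarith [sq_nonneg α]
  have hyp := norm_pos_iff.2 hy0
  have h2 := h _ (W.smul_mem ‖y‖⁻¹ hyW) (norm_smul_inv_norm (𝕜 := ℝ) hy0)
  have h3 : J (‖y‖⁻¹ • y) - inner ℝ (‖y‖⁻¹ • y) (J (‖y‖⁻¹ • y)) • (‖y‖⁻¹ • y) =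
      -(‖y‖⁻¹ * (1 + α ^ 2)) • v := by
    rw [map_smul, hJy]
    have : inner ℝ (‖y‖⁻¹ • y) (‖y‖⁻¹ • (-(1 + α ^ 2) • v - α • y)) = -α := by
      rw [inner_smul_left, inner_smul_right, inner_sub_right, inner_smul_right, inner_smul_right, hyv,
        real_inner_self_eq_norm_sq]
      simp; field_simp
    rw [this]; module
  rw [h3, norm_smul, hv1, mul_one, norm_neg, Real.norm_eq_abs, abs_of_pos (by positivity),
    inv_mul_le_iff₀ hyp] at h2
  nlinarith [norm_nonneg (J v)]

end ComplexStructure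

end FibreCocycle

namespace FibreCocycle

/-! ### Moving a complex pair of eigenvalues to the real axis -/

section RealSpectrum

variable {X : Type*} [Fintype X] {T : Equiv.Perm X}
variable {V : Type*} [NormedAddCommGroup V] [InnerProductSpace ℝ V] [FiniteDimensional ℝ V]
  {A B : X → V →L[ℝ] V} {K e : ℝ} {z : ℂ}

/-- The pair of eigenvalues `z`, `conj z` can be moved to the real axis along a circle. -/
def Realifiable (T : Equiv.Perm X) (A : X → V →L[ℝ] V) (z : ℂ) (e : ℝ) : Prop :=
  ∃ (P : ℝ → X → V →L[ℝ] V) (c : ℝ → ℝ), (∀ x, Continuous fun t => P t x) ∧ P 0 = A ∧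
    (∀ t ∈ Set.Icc (0 : ℝ) 1, ∀ x, ‖P t x - A x‖ < e) ∧
    (∀ t ∈ Set.Icc (0 : ℝ) 1, |c t| ≤ 2 * ‖z‖) ∧ |c 1| = 2 * ‖z‖ ∧
    ∀ t ∈ Set.Icc (0 : ℝ) 1, ∀ x, chi T (P t) x * quad (2 * z.re) (‖z‖ ^ 2) =
      chi T A x * quad (c t) (‖z‖ ^ 2)

theorem quad_ne_zero (c m : ℝ) : quad c m ≠ 0 := by
  intro h0
  have := congrArg (fun p => Polynomial.coeff p 2) h0
  simp [quad] at this

theorem norm_sq_eq (z : ℂ) : ‖z‖ ^ 2 = z.re ^ 2 + z.im ^ 2 := by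
  rw [← Complex.normSq_eq_norm_sq, Complex.normSq_apply]; ring

/-- Rotation of the planes by small angles. -/
noncomputable def rotate (W : X → Submodule ℝ V) (J A : X → V →L[ℝ] V) (θ : ℝ) (x : X) : V →L[ℝ] V :=
  A x + A x * (((Real.cos θ - 1) • 1 + Real.sin θ • J x) *
    ((W x).subtypeL.comp (W x).orthogonalProjectionOnto))

theorem rotate_apply_of_mem {W : X → Submodule ℝ V} {J : X → V →L[ℝ] V} (θ : ℝ) {x : X} {w : V}
    (hw : w ∈ W x) : rotate W J A θ x w = A x (Real.cos θ • w + Real.sin θ • J x w) := by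
  simp only [rotate, add_apply, mul_apply_eq_comp, ContinuousLinearMap.comp_apply,
    Submodule.subtypeL_apply, smul_apply, one_apply_eq_self]
  have hw' : ((W x).orthogonalProjectionOnto w : V) = w :=
    congrArg Subtype.val (Submodule.orthogonalProjectionOnto_mem_subspace_eq_self (⟨w, hw⟩ : W x))
  rw [hw', ← map_add]
  congr 1; module

/-- Each site contributes a rotation by `-t arg z / n` for the complex structure `J`. As `A`
commutes with `J`, the angles add up over the period and the argument of the eigenvalue becomes `(1
- t) arg z`. The cost per site is at most `K π (1 + Λ) / n`. -/
theorem realifiable_of_bounded (hT : IsCyclic T) (hA : Bdd A K) (hK : 1 ≤ K) (hz : z.im ≠ 0)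
    {W : X → Submodule ℝ V} (hW2 : ∀ x, Module.finrank ℝ (W x) = 2) (hW : Inv T A W)
    (hJ : ∀ x, ∀ w ∈ W x, cstr T A z.re z.im x w ∈ W x)
    (hJJ : ∀ x, ∀ w ∈ W x, cstr T A z.re z.im x (cstr T A z.re z.im x w) = -w) {Λ : ℝ} (hΛ : 0 ≤ Λ)
    (hJn : ∀ x, ∀ w ∈ W x, ‖cstr T A z.re z.im x w‖ ≤ Λ * ‖w‖)
    (he : K * (Real.pi * (1 + Λ)) < e * Fintype.card X) : Realifiable T A z e := by
  set J := cstr T A z.re z.im with hJdef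
  set n := Fintype.card X with hn
  set ψ := Complex.arg z with hψ
  rcases isEmpty_or_nonempty X with hX | hX
  · refine ⟨fun _ => A, fun _ => 2 * ‖z‖, fun x => continuous_const, rfl, fun t ht x => (hX.false x).elim,
      fun t ht => by rw [abs_of_nonneg (by positivity)], by rw [abs_of_nonneg (by positivity)],
      fun t ht x => (hX.false x).elim⟩
  have hn0 : 0 < (n : ℝ) := Nat.cast_pos.2 Fintype.card_pos
  have hnorm : ∀ θ x, ‖rotate W J A θ x - A x‖ ≤ K * (|θ| * (1 + Λ)) := by
    intro θ x
    refine ContinuousLinearMap.opNorm_le_bound _ (by positivity) fun v => ?_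
    set w := (W x).orthogonalProjectionOnto v
    have hw : ‖(w : V)‖ ≤ ‖v‖ := Submodule.norm_orthogonalProjectionOnto_apply_le _ v
    have e1 : (rotate W J A θ x - A x) v =
        A x ((Real.cos θ - 1) • (w : V) + Real.sin θ • J x w) := by
      simp only [rotate, add_sub_cancel_left, mul_apply_eq_comp, ContinuousLinearMap.comp_apply,
        Submodule.subtypeL_apply, add_apply, smul_apply, one_apply_eq_self]
      rfl
    have hc : |Real.cos θ - 1| ≤ |θ| := by
      have := Real.abs_cos_sub_cos_le θ 0
      simpa using this
    rw [e1]
    calc _ ≤ K * ‖(Real.cos θ - 1) • (w : V) + Real.sin θ • J x w‖ := (hA _ _).1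
      _ ≤ K * (|θ| * ‖v‖ + |θ| * (Λ * ‖v‖)) := by
          gcongr
          refine (norm_add_le _ _).trans (add_le_add ?_ ?_)
          · rw [norm_smul, Real.norm_eq_abs]; gcongr
          · rw [norm_smul, Real.norm_eq_abs]
            exact mul_le_mul (Real.abs_sin_le_abs) ((hJn x _ w.2).trans (by gcongr)) (norm_nonneg _)
              (abs_nonneg _)
      _ = _ := by ring
  have hsub : ∀ θ x v, rotate W J A θ x v - A x v ∈ W (T x) := by
    intro θ x v
    have : rotate W J A θ x v - A x v = A x ((Real.cos θ - 1) •
        ((W x).orthogonalProjectionOnto v : V) + Real.sin θ • J x ((W x).orthogonalProjectionOnto v)) := by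
      simp only [rotate, add_apply, add_sub_cancel_left, mul_apply_eq_comp,
        ContinuousLinearMap.comp_apply, Submodule.subtypeL_apply, smul_apply, one_apply_eq_self]
    rw [this]
    exact hW _ _ ((W x).add_mem ((W x).smul_mem _ (Subtype.mem _))
      ((W x).smul_mem _ (hJ x _ (Subtype.mem _))))
  have hmem : ∀ θ x, ∀ w ∈ W x, Real.cos θ • w + Real.sin θ • J x w ∈ W x := fun θ x w hw =>
    (W x).add_mem ((W x).smul_mem _ hw) ((W x).smul_mem _ (hJ x _ hw))
  have hinv : ∀ θ, Inv T (rotate W J A θ) W := fun θ x w hw => by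
    rw [rotate_apply_of_mem θ hw]; exact hW _ _ (hmem θ x w hw)
  have hcp : ∀ θ N x, ∀ w ∈ W x, cp T (rotate W J A θ) N x w =
      cp T A N x (Real.cos (N * θ) • w + Real.sin (N * θ) • J x w) := by
    intro θ N x w hw
    induction N with
    | zero => simp [cp]
    | succ N ih =>
      rw [cp_succ_apply', ih, rotate_apply_of_mem θ (hW.cp N x (hmem _ x w hw)), hJdef, cstr_cp hT,
        ← hJdef, cp_succ_apply', ← (cp T A N x).map_smul, ← (cp T A N x).map_smul, ← map_add]
      congr 2
      simp only [map_add, map_smul]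
      rw [hJJ x w hw]
      push_cast
      rw [add_mul, one_mul, Real.cos_add, Real.sin_add]
      module
  have hre : z.re = ‖z‖ * Real.cos ψ := (Complex.norm_mul_cos_arg z).symm
  have him : z.im = ‖z‖ * Real.sin ψ := (Complex.norm_mul_sin_arg z).symm
  have hret : ∀ t x, ∀ w ∈ W x, ret T (rotate W J A (-(t * ψ / n))) x w =
      (‖z‖ * Real.cos ((1 - t) * ψ)) • w + (‖z‖ * Real.sin ((1 - t) * ψ)) • J x w := by
    intro t x w hw
    have e1 : (n : ℝ) * (-(t * ψ / n)) = -(t * ψ) := by field_simp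
    have e2 : (1 - t) * ψ = ψ + -(t * ψ) := by ring
    rw [ret_apply, hcp _ _ _ _ hw, ← hn, e1, ← ret_apply, ret_eq_cstr (a := z.re) hz, ← hJdef, map_add,
      map_smul, map_smul, hJJ x w hw, e2, Real.cos_add, Real.sin_add]
    nth_rewrite 1 [hre]
    nth_rewrite 1 [him]
    module
  have hret0 : ∀ x, ∀ w ∈ W x, ret T A x w = z.re • w + z.im • J x w := fun x w _ =>
    ret_eq_cstr hz x w
  refine ⟨fun t => rotate W J A (-(t * ψ / n)), fun t => 2 * (‖z‖ * Real.cos ((1 - t) * ψ)), ?_, ?_, ?_,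
    ?_, ?_, ?_⟩
  · intro x
    unfold rotate
    have h1 : Continuous fun t : ℝ => Real.cos (-(t * ψ / n)) := by fun_prop
    have h2 : Continuous fun t : ℝ => Real.sin (-(t * ψ / n)) := by fun_prop
    exact continuous_const.add (continuous_const.mul ((((h1.sub continuous_const).smul
      continuous_const).add (h2.smul continuous_const)).mul continuous_const))
  · funext x; simp [rotate]
  · intro t ht x
    refine (hnorm _ x).trans_lt ?_
    have h1 : |-(t * ψ / n)| ≤ Real.pi / n := by
      rw [abs_neg, abs_div, abs_mul, abs_of_nonneg ht.1, abs_of_pos hn0]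
      gcongr
      have := Complex.abs_arg_le_pi z
      nlinarith [abs_nonneg ψ, ht.2, ht.1]
    calc K * (|-(t * ψ / n)| * (1 + Λ)) ≤ K * (Real.pi / n * (1 + Λ)) := by gcongr
      _ = (K * (Real.pi * (1 + Λ))) / n := by ring
      _ < e := by rwa [div_lt_iff₀ hn0]
  · intro t _
    rw [abs_mul, abs_mul, abs_norm, abs_two]
    have := Real.abs_cos_le_one ((1 - t) * ψ)
    nlinarith [norm_nonneg z]
  · simp
  · intro t _ x
    have hMW : ∀ w ∈ W x, ret T A x w ∈ W x := fun w hw => by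
      rw [hret0 x w hw]; exact (W x).add_mem ((W x).smul_mem _ hw) ((W x).smul_mem _ (hJ x w hw))
    have hMW' : ∀ w ∈ W x, ret T (rotate W J A (-(t * ψ / n))) x w ∈ W x := fun w hw => by
      rw [hret t x w hw]; exact (W x).add_mem ((W x).smul_mem _ hw) ((W x).smul_mem _ (hJ x w hw))
    have hdiff : ∀ v, ret T (rotate W J A (-(t * ψ / n))) x v - ret T A x v ∈ W x := by
      intro v
      have := cp_sub_mem (P := W) (hinv (-(t * ψ / n))) (fun x v => hsub _ x v) (Fintype.card X) x v
      rwa [iter_card hT] at this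
    have key := charpoly_subspace hMW hMW' hdiff
    let Jr : Module.End ℝ (W x) := (J x : V →ₗ[ℝ] V).restrict (hJ x)
    have hJr : ∀ v, Jr (Jr v) = -v := fun v => Subtype.ext (hJJ x v v.2)
    rw [charpoly_of_complex_structure (hW2 x) (J := Jr) (a := z.re) (b := z.im) hJr
        (fun v => Subtype.ext (hret0 x v v.2)),
      charpoly_of_complex_structure (hW2 x) (J := Jr) hJr (fun v => Subtype.ext (hret t x v v.2))] at key
    have e3 : (‖z‖ * Real.cos ((1 - t) * ψ)) ^ 2 + (‖z‖ * Real.sin ((1 - t) * ψ)) ^ 2 = ‖z‖ ^ 2 := by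
      have := Real.sin_sq_add_cos_sq ((1 - t) * ψ)
      linear_combination ‖z‖ ^ 2 * this
    rw [e3, ← norm_sq_eq] at key
    exact key

/-- The trace is moved to `2ρ` or to `-2ρ` according to the sign of `a`. The distance is `2(ρ -
|a|)`, at most `2|b|`. -/
theorem exists_trace_shift {a b ρ : ℝ} (hb : b ≠ 0) (hρ : 0 ≤ ρ) (h : ρ ^ 2 = a ^ 2 + b ^ 2) :
    ∃ τ, |τ| ≤ 2 ∧ |2 * a + τ * b| = 2 * ρ := by
  have h1 : ρ ≤ |a| + |b| := by
    have : ρ ^ 2 ≤ (|a| + |b|) ^ 2 := by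
      rw [h, ← sq_abs a, ← sq_abs b]; nlinarith [abs_nonneg a, abs_nonneg b]
    exact (pow_le_pow_iff_left₀ hρ (by positivity) two_ne_zero).1 this
  have h2 : |a| ≤ ρ := abs_le_of_sq_le_sq (by nlinarith [sq_nonneg b]) hρ
  have hb' := abs_pos.2 hb
  rcases le_total 0 a with ha | ha
  · rw [abs_of_nonneg ha] at h1 h2
    refine ⟨(2 * ρ - 2 * a) / b, ?_, ?_⟩
    · rw [abs_div, div_le_iff₀ hb', abs_of_nonneg (by linarith)]; linarith
    · rw [div_mul_cancel₀ _ hb, add_sub_cancel, abs_of_nonneg (by linarith)]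
  · rw [abs_of_nonpos ha] at h1 h2
    refine ⟨(-(2 * ρ) - 2 * a) / b, ?_, ?_⟩
    · rw [abs_div, div_le_iff₀ hb', abs_of_nonpos (by linarith)]; linarith
    · rw [div_mul_cancel₀ _ hb, add_sub_cancel, abs_neg, abs_of_nonneg (by linarith)]

/-- If `J v` has a large component orthogonal to `v`, there is a functional of norm at most `1 / Λ`
with `φ (J v) = 1` and `φ v = 0`. The factor `1 + τ v ⊗ φ` at one site is then small and unipotent,
and moves the trace on the plane by `τ · im z`. -/
theorem realifiable_of_shear (hT : IsCyclic T) (hA : Bdd A K) (hK : 1 ≤ K) (hz : z.im ≠ 0) {x : X}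
    {v : V} (hv : ‖v‖ = 1)
    (hJJ : cstr T A z.re z.im x (cstr T A z.re z.im x v) = -v) {Λ : ℝ} (hΛ : 0 < Λ)
    (h : Λ ≤ ‖cstr T A z.re z.im x v - inner ℝ v (cstr T A z.re z.im x v) • v‖)
    (he : 2 * K < e * Λ) (hKe : K * e ≤ 1 / 2) : Realifiable T A z e := by
  obtain ⟨φ, hφJ, hφv, hφn⟩ := exists_dual hv hΛ h
  obtain ⟨x₀, rfl⟩ := T.surjective x
  obtain ⟨τ, hτ, hτρ⟩ := exists_trace_shift hz (norm_nonneg z) (norm_sq_eq z)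
  set R : ℝ → V →L[ℝ] V := fun t => (t * τ) • φ.smulRight v with hR
  have hRn : ∀ t ∈ Set.Icc (0 : ℝ) 1, ‖R t‖ ≤ 2 / Λ := by
    intro t ht
    rw [hR]
    simp only
    rw [norm_smul, ContinuousLinearMap.norm_smulRight_apply, hv, mul_one, Real.norm_eq_abs, abs_mul,
      abs_of_nonneg ht.1, div_eq_mul_inv]
    exact mul_le_mul (by nlinarith [ht.2, ht.1, abs_nonneg τ]) hφn (norm_nonneg _) (by norm_num)
  have hclose : ∀ t ∈ Set.Icc (0 : ℝ) 1, ∀ x, ‖bump A x₀ (R t) x - A x‖ < e := by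
    intro t ht x
    refine (norm_bump_sub hA (by linarith) (hRn t ht) x).trans_lt ?_
    rw [div_mul_eq_mul_div, div_lt_iff₀ hΛ]; exact he
  refine ⟨fun t => bump A x₀ (R t), fun t => 2 * z.re + t * τ * z.im, ?_, ?_, hclose, ?_, ?_, ?_⟩
  · intro x
    exact continuous_bump (by fun_prop) x₀ x
  · simp [hR, bump_zero]
  · intro t ht
    have e1 : 2 * z.re + t * τ * z.im = (1 - t) * (2 * z.re) + t * (2 * z.re + τ * z.im) := by ring
    have h2 := Complex.abs_re_le_norm z
    change |2 * z.re + t * τ * z.im| ≤ _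
    rw [e1]
    refine (abs_add_le _ _).trans ?_
    rw [abs_mul, abs_mul, abs_mul, hτρ, abs_two, abs_of_nonneg ht.1,
      abs_of_nonneg (sub_nonneg.2 ht.2)]
    nlinarith [ht.1, ht.2]
  · simpa using hτρ
  · intro t ht y
    have hB : Bdd (bump A x₀ (R t)) (2 * K) := hA.near_two hK hKe fun x => (hclose t ht x).le
    rw [chi_eq hT hB (T x₀) y, chi_eq hT hA (T x₀) y]
    have hD : quad (2 * z.re) (‖z‖ ^ 2) ≠ 0 := quad_ne_zero _ _
    have := charpoly_rankOne (M := ret T A (T x₀)) (M' := ret T (bump A x₀ (R t)) (T x₀))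
      (φ := (t * τ) • (φ : V →ₗ[ℝ] ℝ).comp (ret T A (T x₀))) (a := v)
      (D := quad (2 * z.re) (‖z‖ ^ 2)) (N := C (t * τ * z.im) * Polynomial.X) ?_ hD ?_
    · have e1 : quad (2 * z.re) (‖z‖ ^ 2) - C (t * τ * z.im) * Polynomial.X =
          quad (2 * z.re + t * τ * z.im) (‖z‖ ^ 2) := by
        simp only [quad, C_add]; ring
      rwa [e1] at this
    · intro w
      rw [ret_bump hT]
      simp [hR, mul_smul]
    -- The resolvent of `M = a + b J` on the plane is explicit: `(s - M)⁻¹ v = ((s - a) v + b J v) /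
    -- D`.
    · intro s hs
      set J := cstr T A z.re z.im (T x₀)
      have hM := ret_eq_cstr (T := T) (A := A) (a := z.re) hz (T x₀)
      set D := (quad (2 * z.re) (‖z‖ ^ 2)).eval s with hDdef
      have hDs : D = (s - z.re) ^ 2 + z.im ^ 2 := by
        rw [hDdef, quad, norm_sq_eq]; simp; ring
      have hMw : ret T A (T x₀) (D⁻¹ • ((s - z.re) • v + z.im • J v)) =
          s • (D⁻¹ • ((s - z.re) • v + z.im • J v)) - v := by
        have h1 : v = D⁻¹ • (((s - z.re) ^ 2 + z.im ^ 2) • v) := by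
          rw [← hDs, smul_smul, inv_mul_cancel₀ hs, one_smul]
        have h2 : (s - z.re) • (z.re • v + z.im • J v) + z.im • (z.re • J v + z.im • -v) =
            s • ((s - z.re) • v + z.im • J v) - ((s - z.re) ^ 2 + z.im ^ 2) • v := by module
        rw [map_smul, map_add, map_smul, map_smul, hM, hM, hJJ, h2, smul_sub, ← h1, smul_comm]
      refine ⟨D⁻¹ • ((s - z.re) • v + z.im • J v), by rw [hMw]; abel, ?_⟩
      simp only [LinearMap.smul_apply, LinearMap.comp_apply, ContinuousLinearMap.coe_coe]
      rw [hMw, map_sub, map_smul, map_smul, map_add, map_smul, map_smul, hφv, hφJ]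
      simp
      field_simp

/-- Either `J` distorts right angles by more than `Λ = 3K / e` at some site, and one shear suffices,
or `J` is bounded by `2Λ` on the planes, and rotations along a long period suffice. -/
theorem exists_realifiable (K e : ℝ) (hK : 1 ≤ K) (he : 0 < e) : ∃ n₀ : ℕ,
    ∀ (X : Type*) [Fintype X] (T : Equiv.Perm X) (_ : IsCyclic T) (V : Type*) [NormedAddCommGroup V]
      [InnerProductSpace ℝ V] [FiniteDimensional ℝ V] (A : X → V →L[ℝ] V) (_ : Bdd A K)
      (_ : n₀ ≤ Fintype.card X) (x₀ : X) (z : ℂ)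
      (_ : ((chi T A x₀).map (algebraMap ℝ ℂ)).IsRoot z) (_ : z.im ≠ 0), Realifiable T A z e := by
  wlog hKe : K * e ≤ 1 / 2 generalizing e
  · obtain ⟨n₀, h⟩ := this (1 / (2 * K)) (by positivity) (le_of_eq (by field_simp))
    refine ⟨n₀, ?_⟩
    intro X _ T hT V _ _ _ A hA hn x₀ z hz hzi
    obtain ⟨P, c, h1, h2, h3, h4⟩ := h X T hT V A hA hn x₀ z hz hzi
    refine ⟨P, c, h1, h2, fun t ht x => (h3 t ht x).trans_le ?_, h4⟩
    rw [div_le_iff₀ (by positivity)]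
    nlinarith
  set Λ := 3 * K / e with hΛ
  have hΛ0 : 0 < Λ := by positivity
  obtain ⟨n₀, hn₀⟩ := exists_nat_gt (K * (Real.pi * (1 + 2 * Λ)) / e)
  refine ⟨n₀, ?_⟩
  intro X _ T hT V _ _ _ A hA hn x₀ z hz hzi
  obtain ⟨W, hW2, hW, hJ, hJJ⟩ := exists_plane_field hT hA hz hzi
  by_cases h : ∃ x, ∃ w ∈ W x, ‖w‖ = 1 ∧
      Λ < ‖cstr T A z.re z.im x w - inner ℝ w (cstr T A z.re z.im x w) • w‖
  · obtain ⟨x, w, hw, hw1, hΛw⟩ := h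
    exact realifiable_of_shear hT hA hK hzi hw1 (hJJ x w hw) hΛ0 hΛw.le
      (by rw [hΛ, mul_div_cancel₀ _ he.ne']; linarith) hKe
  · push Not at h
    refine realifiable_of_bounded hT hA hK hzi hW2 hW hJ hJJ (Λ := 2 * Λ) (by positivity)
      (fun x w hw => norm_complex_structure_le hΛ0.le (hJ x) (hJJ x) (h x) hw) ?_
    rw [div_lt_iff₀ he] at hn₀
    have : (n₀ : ℝ) ≤ Fintype.card X := by exact_mod_cast hn
    nlinarith

end RealSpectrum

end FibreCocycle

namespace FibreCocycle

universe v

/-! ### Moduli of eigenvalues and reduction to real spectrum -/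

section Moduli

/-- The moduli of the complex roots of a real polynomial. -/
noncomputable def moduli (p : ℝ[X]) : Multiset ℝ :=
  (p.map (algebraMap ℝ ℂ)).roots.map fun z => ‖z‖

theorem moduli_mul {p q : ℝ[X]} (hp : p ≠ 0) (hq : q ≠ 0) : moduli (p * q) = moduli p + moduli q := by
  rw [moduli, Polynomial.map_mul, Polynomial.roots_mul, Multiset.map_add]
  · rfl
  · rw [← Polynomial.map_mul]
    exact (Polynomial.map_ne_zero_iff (algebraMap ℝ ℂ).injective).2 (mul_ne_zero hp hq)

theorem rootsPoly_ne_zero (s : Multiset ℝ) : rootsPoly s ≠ 0 := by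
  refine Multiset.prod_ne_zero fun h => ?_
  obtain ⟨a, -, ha⟩ := Multiset.mem_map.1 h
  exact Polynomial.X_sub_C_ne_zero a ha

theorem moduli_X_sub_C (a : ℝ) : moduli (Polynomial.X - C a) = {|a|} := by
  simp [moduli]

theorem moduli_rootsPoly (s : Multiset ℝ) : moduli (rootsPoly s) = s.map fun a => |a| := by
  induction s using Multiset.induction_on with
  | empty => simp [rootsPoly_zero, moduli]
  | cons a s ih =>
    rw [rootsPoly_cons, moduli_mul (Polynomial.X_sub_C_ne_zero a) (rootsPoly_ne_zero s), ih,
      moduli_X_sub_C, Multiset.map_cons, Multiset.singleton_add]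

/-- The condition `|c| ≤ 2ρ` makes the roots a conjugate pair, possibly real and double, with
product `ρ²`. -/
theorem moduli_quad {c ρ : ℝ} (hρ : 0 ≤ ρ) (hc : |c| ≤ 2 * ρ) : moduli (quad c (ρ ^ 2)) = {ρ, ρ} := by
  have hc2 : c ^ 2 ≤ (2 * ρ) ^ 2 := sq_le_sq' (by linarith [neg_abs_le c]) ((le_abs_self c).trans hc)
  set s := √(ρ ^ 2 - c ^ 2 / 4) with hs
  have hs2 : s ^ 2 = ρ ^ 2 - c ^ 2 / 4 := Real.sq_sqrt (by nlinarith)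
  set w : ℂ := ⟨c / 2, s⟩ with hw
  have hwn : ‖w‖ = ρ := by
    have : ‖w‖ ^ 2 = ρ ^ 2 := by rw [norm_sq_eq, hw]; simp only; rw [hs2]; ring
    exact (pow_left_inj₀ (norm_nonneg _) hρ two_ne_zero).1 this
  have hsum : w + (starRingEnd ℂ) w = (c : ℂ) := by
    apply Complex.ext <;> simp [hw]
  have hprod : w * (starRingEnd ℂ) w = ((ρ ^ 2 : ℝ) : ℂ) := by
    rw [Complex.mul_conj, Complex.normSq_eq_norm_sq, hwn]
  have hfac : (quad c (ρ ^ 2)).map (algebraMap ℝ ℂ) =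
      (Polynomial.X - C w) * (Polynomial.X - C ((starRingEnd ℂ) w)) := by
    have e : (Polynomial.X - C w) * (Polynomial.X - C ((starRingEnd ℂ) w)) =
        Polynomial.X ^ 2 - C (w + (starRingEnd ℂ) w) * Polynomial.X + C (w * (starRingEnd ℂ) w) := by
      simp only [C_add, C_mul]; ring
    rw [e, hsum, hprod, quad]
    simp
  rw [moduli, hfac, Polynomial.roots_mul
    (mul_ne_zero (Polynomial.X_sub_C_ne_zero _) (Polynomial.X_sub_C_ne_zero _)),
    Polynomial.roots_X_sub_C, Polynomial.roots_X_sub_C]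
  simp [hwn]

theorem exists_nonreal_root {p : ℝ[X]} (hp : Multiset.card p.roots < p.natDegree) :
    ∃ z : ℂ, (p.map (algebraMap ℝ ℂ)).IsRoot z ∧ z.im ≠ 0 := by
  obtain ⟨q, hq, hcard, hroots⟩ := Polynomial.exists_prod_multiset_X_sub_C_mul p
  have hdeg : (q.map (algebraMap ℝ ℂ)).degree ≠ 0 := by
    rw [Polynomial.degree_map]
    intro h0
    have : q.natDegree = 0 := Polynomial.natDegree_eq_of_degree_eq_some h0
    omega
  obtain ⟨z, hz⟩ := IsAlgClosed.exists_root _ hdeg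
  have hq0 : q ≠ 0 := by rintro rfl; simp at hcard; omega
  refine ⟨z, ?_, fun him => ?_⟩
  · rw [← hq, Polynomial.map_mul]; exact Polynomial.root_mul_left_of_isRoot _ hz
  · have hz' : z = algebraMap ℝ ℂ z.re := Complex.ext rfl him
    rw [hz', Polynomial.isRoot_map_iff (algebraMap ℝ ℂ).injective, ← Polynomial.mem_roots hq0, hroots] at hz
    simp at hz

theorem roots_quad_of_nonreal {z : ℂ} (hz : z.im ≠ 0) : (quad (2 * z.re) (‖z‖ ^ 2)).roots = 0 := by
  rw [Multiset.eq_zero_iff_forall_notMem]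
  intro a ha
  have := (Polynomial.mem_roots (quad_ne_zero _ _)).1 ha
  rw [Polynomial.IsRoot.def, quad, norm_sq_eq] at this
  simp at this
  have h1 := sq_nonneg (a - z.re)
  have h2 : 0 < z.im ^ 2 := by positivity
  nlinarith

theorem card_roots_quad {c ρ : ℝ} (hc : |c| = 2 * ρ) : Multiset.card (quad c (ρ ^ 2)).roots = 2 := by
  have h1 : c ^ 2 = 4 * ρ ^ 2 := by rw [← sq_abs, hc]; ring
  have : quad c (ρ ^ 2) = (Polynomial.X - C (c / 2)) * (Polynomial.X - C (c / 2)) := by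
    have e : (Polynomial.X - C (c / 2)) * (Polynomial.X - C (c / 2)) =
        Polynomial.X ^ 2 - C (c / 2 + c / 2) * Polynomial.X + C (c / 2 * (c / 2)) := by
      simp only [C_add, C_mul]; ring
    rw [e, quad]; congr 2
    · ring_nf
    · linarith
  rw [this, Polynomial.roots_mul
    (mul_ne_zero (Polynomial.X_sub_C_ne_zero _) (Polynomial.X_sub_C_ne_zero _))]
  simp

end Moduli

section RealSpectrum

theorem chi_ne_zero {X V : Type*} [Fintype X] {T : Equiv.Perm X} [NormedAddCommGroup V]
    [InnerProductSpace ℝ V] [FiniteDimensional ℝ V] {A : X → V →L[ℝ] V} (x : X) : chi T A x ≠ 0 :=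
  (LinearMap.charpoly_monic _).ne_zero

theorem natDegree_chi {X : Type*} [Fintype X] {T : Equiv.Perm X} {d : ℕ}
    {A : X → Sp d →L[ℝ] Sp d} (x : X) : (chi T A x).natDegree = d := by
  rw [chi, LinearMap.charpoly_natDegree, finrank_euclideanSpace_fin]

/-- Small perturbations make the spectrum real, keeping the moduli of the eigenvalues. -/
theorem exists_path_to_real_spectrum (d m : ℕ) (K e : ℝ) (hK : 1 ≤ K) (he : 0 < e) : ∃ n₀ : ℕ,
    ∀ (X : Type v) [Fintype X] (T : Equiv.Perm X) (_ : IsCyclic T)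
      (A : X → Sp d →L[ℝ] Sp d) (_ : Bdd A K) (_ : n₀ ≤ Fintype.card X)
      (_ : ∀ x, d ≤ Multiset.card (chi T A x).roots + m),
      ∃ P : ℝ → X → Sp d →L[ℝ] Sp d, (∀ x, Continuous fun t => P t x) ∧ P 0 = A ∧
        (∀ t ∈ Set.Icc (0 : ℝ) 1, ∀ x, ‖P t x - A x‖ < e) ∧
        (∀ t ∈ Set.Icc (0 : ℝ) 1, ∀ x, moduli (chi T (P t) x) = moduli (chi T A x)) ∧
        ∀ x, chi T (P 1) x = rootsPoly (chi T (P 1) x).roots := by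
  -- Here `m` bounds the number of missing real eigenvalues. Each realification adds two of them,
  -- doubles the bound `K` and leaves half of the tolerance.
  induction m generalizing K e with
  | zero =>
    refine ⟨0, ?_⟩
    intro X _ T hT A hA hn hm
    refine ⟨fun _ => A, fun x => continuous_const, rfl, fun t ht x => by simpa using he,
      fun t ht x => rfl, fun x => ?_⟩
    have h1 := (chi T A x).card_roots'
    rw [natDegree_chi] at h1
    have h2 := hm x
    exact (Polynomial.prod_multiset_X_sub_C_of_monic_of_roots_card_eq (p := chi T A x)
      (LinearMap.charpoly_monic _) (by rw [natDegree_chi]; omega)).symm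
  | succ m ih =>
    set e₁ := min (e / 2) (1 / (2 * K)) with he₁
    have he₁0 : 0 < e₁ := by positivity
    have hKe : K * e₁ ≤ 1 / 2 := by
      have : e₁ ≤ 1 / (2 * K) := min_le_right _ _
      rw [le_div_iff₀ (by positivity)] at this
      linarith
    obtain ⟨n₁, H₁⟩ := exists_realifiable K e₁ hK he₁0
    obtain ⟨n₂, H₂⟩ := ih (2 * K) (e / 2) (by linarith) (by linarith)
    refine ⟨max n₁ n₂, ?_⟩
    intro X _ T hT A hA hn hm
    rcases isEmpty_or_nonempty X with hX | ⟨⟨x₀⟩⟩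
    · exact ⟨fun _ => A, fun x => continuous_const, rfl, fun t ht x => by simpa using he,
        fun t ht x => rfl, fun x => (hX.false x).elim⟩
    by_cases hlt : Multiset.card (chi T A x₀).roots < (chi T A x₀).natDegree
    swap
    · refine ⟨fun _ => A, fun x => continuous_const, rfl, fun t ht x => by simpa using he,
        fun t ht x => rfl, fun x => ?_⟩
      rw [chi_eq hT hA x₀ x]
      exact (Polynomial.prod_multiset_X_sub_C_of_monic_of_roots_card_eq (LinearMap.charpoly_monic _)
        (le_antisymm (chi T A x₀).card_roots' (not_lt.1 hlt))).symm
    obtain ⟨z, hz, hzi⟩ := exists_nonreal_root hlt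
    obtain ⟨P, c, h1, h2, h3, h4, h5, h6⟩ := H₁ X T hT (Sp d) A hA ((le_max_left _ _).trans hn) x₀ z hz hzi
    have hmod : ∀ t ∈ Set.Icc (0 : ℝ) 1, ∀ x, moduli (chi T (P t) x) = moduli (chi T A x) := by
      intro t ht x
      have := congrArg moduli (h6 t ht x)
      rw [moduli_mul (chi_ne_zero x) (quad_ne_zero _ _), moduli_mul (chi_ne_zero x) (quad_ne_zero _ _),
        moduli_quad (norm_nonneg z) (h4 t ht), moduli_quad (norm_nonneg z)] at this
      · exact add_right_cancel this
      · rw [abs_mul, abs_two]; linarith [Complex.abs_re_le_norm z]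
    have hcard : ∀ x, Multiset.card (chi T (P 1) x).roots = Multiset.card (chi T A x).roots + 2 := by
      intro x
      have := congrArg (fun p => Multiset.card (Polynomial.roots p)) (h6 1 (by simp) x)
      rw [Polynomial.roots_mul (mul_ne_zero (chi_ne_zero x) (quad_ne_zero _ _)),
        Polynomial.roots_mul (mul_ne_zero (chi_ne_zero x) (quad_ne_zero _ _)), roots_quad_of_nonreal hzi,
        Multiset.card_add, Multiset.card_add, card_roots_quad h5, Multiset.card_zero, add_zero] at this
      exact this
    have hB : Bdd (P 1) (2 * K) := hA.near_two hK hKe fun x => (h3 1 (by simp) x).le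
    obtain ⟨Q, k1, k2, k3, k4, k5⟩ := H₂ X T hT (P 1) hB ((le_max_right _ _).trans hn)
      (fun x => by have := hm x; have := hcard x; omega)
    refine ⟨concat P Q, continuous_concat h1 k1 k2.symm, by rw [concat_zero, h2], fun t ht x => ?_,
      fun t ht x => ?_, by rw [concat_one]; exact k5⟩
    · refine (norm_concat h3 k3 ht x).trans_le ?_
      linarith [min_le_left (e / 2) (1 / (2 * K))]
    · rcases concat_cases (P := P) (Q := Q) ht with ⟨-, h, h'⟩ | ⟨-, h, h'⟩
      · rw [h', hmod _ h]
      · rw [h', k4 _ h, hmod 1 (by simp)]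

end RealSpectrum

/-! ### Rescaling real eigenvalues by triangular perturbations -/

section Scaling

variable {X : Type v} [Fintype X] {T : Equiv.Perm X}

/-- The eigenvalues of a cocycle with real spectrum can be rescaled at will. -/
theorem exists_rescaling (hT : IsCyclic T) {d : ℕ} {A : X → Sp d →L[ℝ] Sp d} {K η : ℝ} (hA : Bdd A K)
    (hK : 0 ≤ K) {m c : ℕ → ℝ} (hχ : ∀ x, chi T A x = rootsPoly ((Multiset.range d).map m))
    (hc : ∀ i < d, |c i| ≤ η) (hη : 0 ≤ η) :
    ∃ P : ℝ → X → Sp d →L[ℝ] Sp d, (∀ x, Continuous fun t => P t x) ∧ P 0 = A ∧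
      (∀ t ∈ Set.Icc (0 : ℝ) 1, ∀ x, ‖P t x - A x‖ ≤ K * (Real.exp η - 1)) ∧
      ∀ t ∈ Set.Icc (0 : ℝ) 1, ∀ x, chi T (P t) x = rootsPoly ((Multiset.range d).map fun i =>
        m i * Real.exp (Fintype.card X * (t * c i))) := by
  have hη1 : 0 ≤ Real.exp η - 1 := by linarith [Real.add_one_le_exp η]
  induction d with
  | zero =>
    exact ⟨fun _ => A, fun x => continuous_const, rfl, fun t ht x => by
      rw [sub_self, norm_zero]; positivity, fun t ht x => by simpa using hχ x⟩
  | succ d ih =>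
    rcases isEmpty_or_nonempty X with hX | ⟨⟨x₀⟩⟩
    · exact ⟨fun _ => A, fun x => continuous_const, rfl, fun t ht x => (hX.false x).elim,
        fun t ht x => (hX.false x).elim⟩
    have hr : (chi T A x₀).IsRoot (m d) := by
      rw [hχ, rootsPoly_isRoot]; exact Multiset.mem_map_of_mem _ (by simp)
    obtain ⟨w, q, hw⟩ := exists_isEig hT hA hr
    obtain ⟨k⟩ := exists_compl hw.unit
    have hχ' : ∀ x, chi T (k.quot T A) x = rootsPoly ((Multiset.range d).map m) := by
      intro x
      have := hχ x
      rw [k.chi_quot hT hw, Multiset.range_succ, Multiset.map_cons, rootsPoly_cons] at this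
      exact mul_left_cancel₀ (Polynomial.X_sub_C_ne_zero _) this
    obtain ⟨Q, h1, h2, h3, h4⟩ := ih (k.bdd hw hA) hχ' (fun i hi => hc i (by omega))
    -- The path of the quotient is lifted, and the multipliers along `w` are multiplied by `e^{t
    -- c_d}`. Over the period this gives the factor `exp (n t c_d)`.
    set P : ℝ → X → Sp (d + 1) →L[ℝ] Sp (d + 1) := fun t x =>
      k.lift T A (Q t) x + ((Real.exp (t * c d) - 1) * q x) • (innerSL ℝ (w x)).smulRight (w (T x)) with hP
    have hPw : ∀ t, IsEig T (P t) w (fun x => Real.exp (t * c d) * q x)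
        (m d * Real.exp (Fintype.card X * (t * c d))) := by
      intro t
      refine ⟨hw.unit, fun x => ?_, ?_⟩
      · simp only [hP, add_apply, smul_apply, ContinuousLinearMap.smulRight_apply, innerSL_apply_apply]
        rw [k.lift_w, hw.map, real_inner_self_eq_norm_sq, hw.unit]
        module
      · rw [Finset.prod_mul_distrib, hw.prod, Finset.prod_const, Finset.card_univ, ← Real.exp_nat_mul,
          mul_comm]
    have hPq : ∀ t, k.quot T (P t) = Q t := by
      intro t
      rw [← k.quot_lift (T := T) (A := A) (Q t)]
      funext x
      ext1 v
      simp only [Compl.quot, hP, ContinuousLinearMap.comp_apply, add_apply, map_add, smul_apply,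
        map_smul, ContinuousLinearMap.smulRight_apply, k.Q_w, smul_zero, add_zero]
    refine ⟨P, fun x => ?_, ?_, fun t ht x => ?_, fun t ht x => ?_⟩
    · have : Continuous fun t : ℝ => (Real.exp (t * c d) - 1) * q x := by fun_prop
      exact (k.continuous_lift h1 x).add (this.smul continuous_const)
    · funext x
      simp only [hP, h2, k.lift_quot]; simp
    · refine ContinuousLinearMap.opNorm_le_bound _ (by positivity) fun v => ?_
      have e1 : (P t x - A x) v = ((Real.exp (t * c d) - 1) * q x * inner ℝ (w x) v) • w (T x) +
          k.J (T x) ((Q t x - k.quot T A x) (k.Q x v)) := by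
        simp only [hP, Compl.lift, sub_apply, add_apply, smul_apply, ContinuousLinearMap.comp_apply,
          ContinuousLinearMap.smulRight_apply, innerSL_apply_apply,
          LinearIsometry.coe_toContinuousLinearMap, smul_smul]
        abel
      have e2 := k.norm_sq hw.unit (T x) ((Real.exp (t * c d) - 1) * q x * inner ℝ (w x) v)
        ((Q t x - k.quot T A x) (k.Q x v))
      have e3 := k.norm_sq hw.unit x (inner ℝ (w x) v) (k.Q x v)
      rw [← k.decomp] at e3
      rw [← e1] at e2
      have e4 : ‖(Q t x - k.quot T A x) (k.Q x v)‖ ≤ K * (Real.exp η - 1) * ‖k.Q x v‖ :=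
        ((Q t x - k.quot T A x).le_opNorm _).trans (by gcongr; exact h3 t ht x)
      have htc : |t * c d| ≤ η := by
        rw [abs_mul, abs_of_nonneg ht.1]
        exact (mul_le_of_le_one_left (abs_nonneg _) ht.2).trans (hc d (by omega))
      have e5 : |(Real.exp (t * c d) - 1) * q x| ≤ K * (Real.exp η - 1) := by
        rw [abs_mul, mul_comm]
        exact mul_le_mul (hw.bounds hA x).1 (abs_exp_sub_one_le htc) (abs_nonneg _) hK
      set D := K * (Real.exp η - 1) with hD
      have hD0 : 0 ≤ D := by positivity
      -- The two parts of the perturbation act between orthogonal components with the same constant,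
      -- so by Pythagoras the bound does not grow with the dimension.
      have e6 : ‖(P t x - A x) v‖ ^ 2 ≤ (D * ‖v‖) ^ 2 := by
        rw [e2, mul_pow D ‖v‖, e3, mul_pow ((Real.exp (t * c d) - 1) * q x),
          ← sq_abs ((Real.exp (t * c d) - 1) * q x), mul_add, ← mul_pow D ‖k.Q x v‖]
        gcongr
      exact (pow_le_pow_iff_left₀ (norm_nonneg _) (by positivity) two_ne_zero).1 e6
    · rw [k.chi_quot hT (hPw t), hPq, h4 t ht, Multiset.range_succ, Multiset.map_cons, rootsPoly_cons]

end Scaling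

end FibreCocycle

namespace FibreCocycle

/-! ### Paths of cocycles with monotone graphs -/

section Paths

variable {X : Type*} [Fintype X] {T : Equiv.Perm X} {d : ℕ} {A B D : X → Sp d →L[ℝ] Sp d}
  {Λ Λ' Λ'' : ℕ → ℝ} {e e' : ℝ}

/-- `Λ 0 ≤ ⋯ ≤ Λ (d - 1)` are the Lyapunov exponents of `A`. -/
def Spec (T : Equiv.Perm X) (A : X → Sp d →L[ℝ] Sp d) (Λ : ℕ → ℝ) : Prop :=
  (∀ i j, i ≤ j → j < d → Λ i ≤ Λ j) ∧
    ∀ x, moduli (chi T A x) = (Multiset.range d).map fun i => Real.exp (Fintype.card X * Λ i)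

/-- A short path of cocycles, along which the graph of the exponents grows continuously. -/
def PathTo (T : Equiv.Perm X) (A B : X → Sp d →L[ℝ] Sp d) (Λ Λ' : ℕ → ℝ) (e : ℝ) : Prop :=
  ∃ (P : ℝ → X → Sp d →L[ℝ] Sp d) (l : ℝ → ℕ → ℝ), (∀ x, Continuous fun t => P t x) ∧
    P 0 = A ∧ P 1 = B ∧ (∀ t ∈ Set.Icc (0 : ℝ) 1, ∀ x, ‖P t x - A x‖ < e) ∧
    (∀ i, Continuous fun t => l t i) ∧ l 0 = Λ ∧ l 1 = Λ' ∧
    (∀ t ∈ Set.Icc (0 : ℝ) 1, Spec T (P t) (l t)) ∧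
    ∀ j ≤ d, MonotoneOn (fun t => ∑ i ∈ Finset.range j, l t i) (Set.Icc 0 1)

theorem PathTo.norm_lt (h : PathTo T A B Λ Λ' e) (x : X) : ‖B x - A x‖ < e := by
  obtain ⟨P, l, -, -, h1, h2, -⟩ := h
  rw [← h1]; exact h2 1 (by simp) x

theorem PathTo.spec (h : PathTo T A B Λ Λ' e) : Spec T B Λ' := by
  obtain ⟨P, l, -, -, h1, -, -, -, h2, h3, -⟩ := h
  rw [← h1, ← h2]; exact h3 1 (by simp)

theorem PathTo.trans (h : PathTo T A B Λ Λ' e) (h' : PathTo T B D Λ' Λ'' e') :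
    PathTo T A D Λ Λ'' (e + e') := by
  obtain ⟨P, l, p1, p2, p3, p4, p5, p6, p7, p8, p9⟩ := h
  obtain ⟨Q, m, q1, q2, q3, q4, q5, q6, q7, q8, q9⟩ := h'
  set r : ℝ → ℕ → ℝ := fun t i => if t ≤ 1 / 2 then l (2 * t) i else m (2 * t - 1) i with hr
  have hr1 : ∀ {t}, t ≤ 1 / 2 → r t = l (2 * t) := fun ht => funext fun i => by
    simp only [hr, if_pos ht]
  have hr2 : ∀ {t}, 1 / 2 < t → r t = m (2 * t - 1) := fun ht => funext fun i => by
    simp only [hr, if_neg (not_le.2 ht)]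
  refine ⟨concat P Q, r, continuous_concat p1 q1 (p3.trans q2.symm), by rw [concat_zero, p2],
    by rw [concat_one, q3], fun t ht x => norm_concat p4 (by rw [p3]; exact q4) ht x, fun i => ?_,
    ?_, ?_, fun t ht => ?_, fun j hj t ht t' ht' htt => ?_⟩
  · refine Continuous.if_le ((p5 i).comp (by fun_prop)) ((q5 i).comp (by fun_prop)) continuous_id
      continuous_const fun t ht => ?_
    rw [ht]; norm_num [p7, q6]
  · rw [hr1 (by norm_num), mul_zero, p6]
  · rw [hr2 (by norm_num)]; norm_num [q7]
  · rcases concat_cases (P := P) (Q := Q) ht with ⟨h0, h, h'⟩ | ⟨h0, h, h'⟩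
    · rw [h', hr1 h0]; exact p8 _ h
    · rw [h', hr2 h0]; exact q8 _ h
  · dsimp only
    rcases concat_cases (P := P) (Q := Q) ht with ⟨h0, h, -⟩ | ⟨h0, h, -⟩ <;>
      rcases concat_cases (P := P) (Q := Q) ht' with ⟨k0, k, -⟩ | ⟨k0, k, -⟩
    · rw [hr1 h0, hr1 k0]; exact p9 j hj h k (by linarith)
    · rw [hr1 h0, hr2 k0]
      refine (p9 j hj h (by simp) h.2).trans ?_
      have := q9 j hj (by simp) k k.1
      dsimp only at this ⊢
      rwa [q6, ← p7] at this
    · linarith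
    · rw [hr2 h0, hr2 k0]; exact q9 j hj h k (by linarith)

/-- A family of real numbers can be recovered from the family of its moduli. -/
theorem exists_eq_map_range {s : Multiset ℝ} {f : ℕ → ℝ}
    (h : (s.map fun a => |a|) = (Multiset.range d).map f) :
    ∃ m : ℕ → ℝ, s = (Multiset.range d).map m ∧ ∀ i < d, |m i| = f i := by
  induction d generalizing s with
  | zero => exact ⟨0, by simpa using h, by simp⟩
  | succ d ih =>
    rw [Multiset.range_succ, Multiset.map_cons] at h
    obtain ⟨a, ha, haf⟩ := Multiset.mem_map.1 (show f d ∈ s.map fun a => |a| by rw [h]; simp)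
    obtain ⟨s', rfl⟩ := Multiset.exists_cons_of_mem ha
    rw [Multiset.map_cons, haf, Multiset.cons_inj_right] at h
    obtain ⟨m, hm, hm'⟩ := ih h
    refine ⟨Function.update m d a, ?_, fun i hi => ?_⟩
    · rw [Multiset.range_succ, Multiset.map_cons, Function.update_self, hm]
      congr 1
      refine Multiset.map_congr rfl fun i hi => ?_
      rw [Function.update_of_ne (Multiset.mem_range.1 hi).ne]
    · rcases Nat.lt_succ_iff_lt_or_eq.1 hi with hi | rfl
      · rw [Function.update_of_ne hi.ne, hm' i hi]
      · rw [Function.update_self, haf]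

theorem chi_eq_rootsPoly {x : X} (h : Multiset.card (chi T A x).roots = d) :
    chi T A x = rootsPoly (chi T A x).roots :=
  (Polynomial.prod_multiset_X_sub_C_of_monic_of_roots_card_eq (p := chi T A x)
    (LinearMap.charpoly_monic _) (by rw [natDegree_chi, h])).symm

theorem Spec.exists_chi_eq [Nonempty X] (h : Spec T A Λ) (hT : IsCyclic T) {K : ℝ} (hA : Bdd A K)
    (hr : ∀ x, Multiset.card (chi T A x).roots = d) :
    ∃ m : ℕ → ℝ, (∀ x, chi T A x = rootsPoly ((Multiset.range d).map m)) ∧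
      ∀ i < d, |m i| = Real.exp (Fintype.card X * Λ i) := by
  obtain ⟨x₀⟩ := ‹Nonempty X›
  have h1 := h.2 x₀
  rw [chi_eq_rootsPoly (hr x₀), moduli_rootsPoly] at h1
  obtain ⟨m, hm, hm'⟩ := exists_eq_map_range h1
  exact ⟨m, fun x => by rw [chi_eq hT hA x₀ x, chi_eq_rootsPoly (hr x₀), hm], hm'⟩

end Paths

section Kernels

variable {X : Type*} [Fintype X] {T : Equiv.Perm X} {V : Type*} [NormedAddCommGroup V]
  [InnerProductSpace ℝ V] [FiniteDimensional ℝ V] {A : X → V →L[ℝ] V}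

theorem isCompl_kerField {f g : ℝ[X]} (hfg : IsCoprime f g) {x : X} (h : chi T A x = f * g) :
    IsCompl (kerField T A f x) (kerField T A g x) := by
  refine ⟨Polynomial.disjoint_ker_aeval_of_isCoprime _ hfg, codisjoint_iff.2 ?_⟩
  rw [kerField, kerField, Polynomial.sup_ker_aeval_eq_ker_aeval_mul_of_coprime _ hfg, ← h, chi,
    LinearMap.aeval_self_charpoly, LinearMap.ker_zero]

theorem kerField_ne_bot {s : Multiset ℝ} {a : ℝ} (ha : a ∈ s) {x : X} (h : (chi T A x).IsRoot a) :
    kerField T A (rootsPoly s) x ≠ ⊥ := by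
  obtain ⟨v, hv⟩ := ((Module.End.hasEigenvalue_iff_isRoot_charpoly _ _).2 h).exists_hasEigenvector
  refine (Submodule.ne_bot_iff _).2 ⟨v, ?_, hv.2⟩
  rw [kerField, LinearMap.mem_ker, Module.End.aeval_apply_of_hasEigenvector hv,
    (rootsPoly_isRoot.2 ha).eq_zero, zero_smul]

end Kernels

/-! ### One mixing step at a gap -/

section Step

universe v

/-- The exponents with the `k`-th one lowered and the one before it raised by `c`. -/
def shift (Λ : ℕ → ℝ) (k : ℕ) (c : ℝ) (i : ℕ) : ℝ :=
  Λ i + ((if i + 1 = k then c else 0) - if i = k then c else 0)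

theorem sum_shift (Λ : ℕ → ℝ) (k : ℕ) (hk : 1 ≤ k) (c : ℝ) (j : ℕ) :
    ∑ i ∈ Finset.range j, shift Λ k c i =
      ∑ i ∈ Finset.range j, Λ i + if j = k then c else 0 := by
  obtain ⟨k, rfl⟩ : ∃ l, k = l + 1 := ⟨k - 1, by omega⟩
  simp only [shift, Finset.sum_add_distrib, Finset.sum_sub_distrib, Nat.add_right_cancel_iff,
    Finset.sum_ite_eq', Finset.mem_range]
  congr 1
  split_ifs <;> first | omega | simp

theorem shift_mono {Λ : ℕ → ℝ} {d k : ℕ} {c : ℝ} (hk : 1 ≤ k)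
    (hΛ : ∀ i j, i ≤ j → j < d → Λ i ≤ Λ j) (hc : 0 ≤ c) (h : 2 * c ≤ Λ k - Λ (k - 1)) :
    ∀ i j, i ≤ j → j < d → shift Λ k c i ≤ shift Λ k c j := by
  intro i j hij hj
  obtain ⟨k, rfl⟩ : ∃ l, k = l + 1 := ⟨k - 1, by omega⟩
  rw [Nat.add_sub_cancel] at h
  have h0 := hΛ i j hij hj
  simp only [shift, Nat.add_right_cancel_iff]
  have h1 : i ≤ k → k ≤ j → Λ i ≤ Λ k := fun h h' => hΛ _ _ h (by omega)
  have h2 : k + 1 ≤ j → Λ (k + 1) ≤ Λ j := fun h => hΛ _ _ h hj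
  split_ifs <;> subst_vars <;>
    first | omega | linarith | linarith [h1 (by omega) (by omega)] | linarith [h2 (by omega)]

/-- Two consecutive exponents with a gap can be brought closer, if there is no domination. -/
theorem exists_mixable (d : ℕ) (K e η : ℝ) (hK : 1 ≤ K) (he : 0 < e) (hη : 0 < η) :
    ∃ (δ : ℝ) (L : ℕ), 0 < δ ∧ ∀ (X : Type v) [Fintype X] (T : Equiv.Perm X) (_ : IsCyclic T)
      (A₀ A : X → Sp d →L[ℝ] Sp d) (_ : Bdd A₀ K) (_ : Bdd A K) (_ : ∀ x, ‖A₀ x - A x‖ ≤ δ)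
      (_ : L ≤ Fintype.card X) (N : ℕ) (_ : L ≤ N) (_ : ¬ Splits T A₀ N) (m Λ : ℕ → ℝ)
      (_ : ∀ x, chi T A x = rootsPoly ((Multiset.range d).map m))
      (_ : ∀ i j, i ≤ j → j < d → Λ i ≤ Λ j)
      (_ : ∀ i < d, |m i| = Real.exp (Fintype.card X * Λ i)) (k : ℕ) (_ : 1 ≤ k) (_ : k < d)
      (_ : 2 * η ≤ Λ k - Λ (k - 1)), Mergeable T A (m (k - 1)) (m k) e := by
  obtain ⟨C, κ, n₀, hC, hκ, hκ1, H⟩ := exists_mergeable_of_not_expDom.{v} K e hK he d d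
  obtain ⟨δ, L, hδ, H'⟩ := exists_splits_of_near.{v} K C κ hK hC hκ hκ1
  -- For periods at least `n₁` a gap `2η` between exponents becomes a factor `4` between moduli.
  obtain ⟨n₁, hn₁⟩ := exists_nat_ge (Real.log 4 / (2 * η))
  refine ⟨δ, max (max n₀ n₁) L, hδ, ?_⟩
  intro X _ T hT A₀ A hA₀ hA hnear hn N hN hS m Λ hχ hΛ hm k hk hkd hgap
  have hn₀ : n₀ ≤ Fintype.card X := by omega
  have hcard : (n₁ : ℝ) ≤ Fintype.card X := by exact_mod_cast (by omega)
  have hlog : Real.log 4 ≤ Fintype.card X * (Λ k - Λ (k - 1)) := by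
    rw [div_le_iff₀ (by linarith)] at hn₁
    calc Real.log 4 ≤ n₁ * (2 * η) := hn₁
      _ ≤ Fintype.card X * (Λ k - Λ (k - 1)) := by gcongr
  have h4 : 4 * |m (k - 1)| ≤ |m k| := by
    rw [hm _ hkd, hm _ (by omega), ← Real.exp_log (show (0 : ℝ) < 4 by norm_num), ← Real.exp_add]
    refine Real.exp_le_exp.2 ?_
    linarith
  have hpos : 0 < |m (k - 1)| := by rw [hm _ (by omega)]; positivity
  have hmono : ∀ i j, i ≤ j → j < d → |m i| ≤ |m j| := by
    intro i j hij hj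
    rw [hm _ hj, hm _ (by omega)]
    have := hΛ i j hij hj
    gcongr
  set s := (Multiset.range k).map m with hs
  set t := (Multiset.range (d - k)).map fun i => m (k + i) with ht
  have hst : (Multiset.range d).map m = s + t := by
    rw [show d = k + (d - k) by omega, Multiset.range_add, Multiset.map_add, Multiset.map_map, hs,
      ht]
    rfl
  have hμ : m (k - 1) ∈ s := Multiset.mem_map_of_mem _ (Multiset.mem_range.2 (by omega))
  have hν : m k ∈ t := Multiset.mem_map.2 ⟨0, Multiset.mem_range.2 (by omega), rfl⟩
  have hsμ : ∀ a ∈ s, |a| ≤ |m (k - 1)| := by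
    intro a ha
    obtain ⟨i, hi, rfl⟩ := Multiset.mem_map.1 ha
    rw [Multiset.mem_range] at hi
    exact hmono _ _ (by omega) (by omega)
  have htν : ∀ b ∈ t, |m k| ≤ |b| := by
    intro a ha
    obtain ⟨i, hi, rfl⟩ := Multiset.mem_map.1 ha
    rw [Multiset.mem_range] at hi
    exact hmono _ _ (by omega) (by omega)
  have hχ' : ∀ x, chi T A x = rootsPoly s * rootsPoly t := fun x => by
    rw [hχ x, hst, rootsPoly_add]
  -- If the spectral splitting of `A` at the gap were dominated with constants `C, κ`, it would
  -- persist to the nearby `A₀`, which has no such splitting at time `N`.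
  refine H X T hT d A hA hn₀ s t _ _ hχ' (by simp [hs]; omega) (by simp [ht]) hμ
    (Or.inr hν) hsμ htν (by linarith) h4 fun hE => hS ?_
  refine H' X T d A₀ A hA₀ hA hnear _ _ (fun x => isCompl_kerField ?_ (hχ' x))
    (fun x => kerField_ne_bot hμ ?_) (fun x => kerField_ne_bot hν ?_) (inv_kerField hT _)
    (inv_kerField hT _) hE N (by omega)
  · refine isCoprime_rootsPoly fun a ha b hb hab => ?_
    subst hab
    linarith [hsμ a ha, htν a hb]
  · rw [hχ, hst, rootsPoly_isRoot]; exact Multiset.mem_add.2 (Or.inl hμ)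
  · rw [hχ, hst, rootsPoly_isRoot]; exact Multiset.mem_add.2 (Or.inr hν)

theorem range_eq_cons_cons {d k : ℕ} (hk : k + 1 < d) :
    ∃ s : Multiset ℕ, Multiset.range d = k ::ₘ (k + 1) ::ₘ s ∧ k ∉ s ∧ k + 1 ∉ s := by
  have hnd := Multiset.nodup_range d
  obtain ⟨s, hs⟩ := Multiset.exists_cons_of_mem (Multiset.mem_range.2 (show k < d by omega))
  have h1 : k + 1 ∈ s := by
    have : k + 1 ∈ Multiset.range d := Multiset.mem_range.2 hk
    rw [hs, Multiset.mem_cons] at this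
    exact this.resolve_left (by omega)
  obtain ⟨s', rfl⟩ := Multiset.exists_cons_of_mem h1
  rw [hs, Multiset.nodup_cons, Multiset.nodup_cons] at hnd
  exact ⟨s', hs, fun h => hnd.1 (Multiset.mem_cons_of_mem h), hnd.2.1⟩

variable {X : Type*} [Fintype X] {T : Equiv.Perm X} {d : ℕ} {A : X → Sp d →L[ℝ] Sp d}

theorem Mergeable.exists_pathTo {Λ : ℕ → ℝ} {μ ν e η : ℝ} (hM : Mergeable T A μ ν e)
    (hr : ∀ x, Multiset.card (chi T A x).roots = d) (hΛ : Spec T A Λ) {k : ℕ} (hk : 1 ≤ k)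
    (hkd : k < d) (hμ : |μ| = Real.exp (Fintype.card X * Λ (k - 1)))
    (hν : |ν| = Real.exp (Fintype.card X * Λ k)) (hη : 0 ≤ η) (hgap : 2 * η ≤ Λ k - Λ (k - 1)) :
    ∃ B, (∀ x, Multiset.card (chi T B x).roots = d) ∧ PathTo T A B Λ (shift Λ k η) e := by
  obtain ⟨μ', ν', hμ', hν', -, -, hM⟩ := hM
  obtain ⟨k, rfl⟩ : ∃ l, k = l + 1 := ⟨k - 1, by omega⟩
  rw [Nat.add_sub_cancel] at hμ hgap
  -- Exponents are logarithms of moduli divided by the period, so a shift by `η` means `δ = nη`; the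
  -- condition that the moduli do not cross is then the gap `2η`.
  obtain ⟨P, θ, h1, h2, h3, h4, h5, h6, h7, h8⟩ := hM (Fintype.card X * η) (by positivity) (by
    rw [hμ', hν', hμ, hν, ← Real.exp_add, ← Real.exp_add]
    refine Real.exp_le_exp.2 ?_
    nlinarith [(Nat.cast_nonneg (Fintype.card X) : (0 : ℝ) ≤ Fintype.card X)])
  have hX : ∀ a b : ℝ, (Polynomial.X - C a) * (Polynomial.X - C b) ≠ 0 := fun a b =>
    mul_ne_zero (Polynomial.X_sub_C_ne_zero _) (Polynomial.X_sub_C_ne_zero _)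
  refine ⟨P 1, fun x => ?_, P, fun t => shift Λ (k + 1) (θ t * η), h1, h2, rfl, h3, fun i => ?_,
    ?_, ?_, fun t ht => ⟨?_, fun x => ?_⟩, fun j hj t ht t' ht' htt => ?_⟩
  · have := congrArg (fun p => Multiset.card (Polynomial.roots p)) (h8 1 (by simp) x)
    rw [Polynomial.roots_mul (mul_ne_zero (chi_ne_zero x) (hX _ _)),
      Polynomial.roots_mul (mul_ne_zero (chi_ne_zero x) (hX _ _)), Multiset.card_add,
      Multiset.card_add, Polynomial.roots_mul (hX _ _), Polynomial.roots_mul (hX _ _)] at this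
    simp only [Polynomial.roots_X_sub_C, Multiset.card_add, Multiset.card_singleton, hr] at this
    omega
  · unfold shift
    have : Continuous fun t => θ t * η := by fun_prop
    exact continuous_const.add ((Continuous.if_const _ this continuous_const).sub
      (Continuous.if_const _ this continuous_const))
  · funext i; simp [shift, h6]
  · funext i; simp [shift, h7]
  · have h0 : 0 ≤ θ t := h6 ▸ h5 ht.1
    have h0' : θ t ≤ 1 := h7 ▸ h5 ht.2
    refine shift_mono (by omega) hΛ.1 (by positivity) ?_
    rw [Nat.add_sub_cancel]; nlinarith
  · obtain ⟨s, hs, hs1, hs2⟩ := range_eq_cons_cons hkd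
    have := congrArg moduli (h8 t ht x)
    rw [moduli_mul (chi_ne_zero x) (hX _ _), moduli_mul (chi_ne_zero x) (hX _ _), hΛ.2,
      moduli_mul (Polynomial.X_sub_C_ne_zero _) (Polynomial.X_sub_C_ne_zero _),
      moduli_mul (Polynomial.X_sub_C_ne_zero _) (Polynomial.X_sub_C_ne_zero _), moduli_X_sub_C,
      moduli_X_sub_C, moduli_X_sub_C, moduli_X_sub_C, abs_mul, abs_mul, Real.abs_exp, Real.abs_exp,
      hμ', hν', hμ, hν, ← Real.exp_add, ← Real.exp_add, hs, Multiset.map_cons, Multiset.map_cons,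
      ← Multiset.singleton_add, ← Multiset.singleton_add] at this
    rw [hs, Multiset.map_cons, Multiset.map_cons, ← Multiset.singleton_add,
      ← Multiset.singleton_add]
    have e1 : s.map (fun i => Real.exp (Fintype.card X * shift Λ (k + 1) (θ t * η) i)) =
        s.map (fun i => Real.exp (Fintype.card X * Λ i)) := by
      refine Multiset.map_congr rfl fun i hi => ?_
      have h1 : i ≠ k := fun h => hs1 (h ▸ hi)
      have h2 : i ≠ k + 1 := fun h => hs2 (h ▸ hi)
      simp [shift, h1, h2]
    have e2 : Fintype.card X * shift Λ (k + 1) (θ t * η) k =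
        Fintype.card X * Λ k + θ t * (Fintype.card X * η) := by
      simp [shift]; ring
    have e3 : Fintype.card X * shift Λ (k + 1) (θ t * η) (k + 1) =
        Fintype.card X * Λ (k + 1) + -(θ t * (Fintype.card X * η)) := by
      simp [shift]; ring
    rw [e1, e2, e3]
    refine add_right_cancel (this.trans ?_)
    abel
  · dsimp only
    rw [sum_shift _ _ (by omega), sum_shift _ _ (by omega)]
    have := h5 htt
    split_ifs
    · gcongr
    · exact le_rfl

/-- One step of the mixing procedure. -/
theorem exists_mixing_step (d : ℕ) (K e η : ℝ) (hK : 1 ≤ K) (he : 0 < e) (hη : 0 < η) :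
    ∃ (δ : ℝ) (L : ℕ), 0 < δ ∧ ∀ (X : Type v) [Fintype X] (T : Equiv.Perm X) (_ : IsCyclic T)
      (A₀ A : X → Sp d →L[ℝ] Sp d) (_ : Bdd A₀ K) (_ : Bdd A K) (_ : ∀ x, ‖A₀ x - A x‖ ≤ δ)
      (_ : L ≤ Fintype.card X) (N : ℕ) (_ : L ≤ N) (_ : ¬ Splits T A₀ N) (Λ : ℕ → ℝ)
      (_ : ∀ x, Multiset.card (chi T A x).roots = d) (_ : Spec T A Λ) (k : ℕ) (_ : 1 ≤ k)
      (_ : k < d) (_ : 2 * η ≤ Λ k - Λ (k - 1)),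
      ∃ B, (∀ x, Multiset.card (chi T B x).roots = d) ∧ PathTo T A B Λ (shift Λ k η) e := by
  obtain ⟨δ, L, hδ, H⟩ := exists_mixable.{v} d K e η hK he hη
  refine ⟨δ, max L 1, hδ, ?_⟩
  intro X _ T hT A₀ A hA₀ hA hnear hn N hN hS Λ hr hΛ k hk hkd hgap
  have : Nonempty X := Fintype.card_pos_iff.1 (by omega)
  obtain ⟨m, hm, hm'⟩ := hΛ.exists_chi_eq hT hA hr
  exact (H X T hT A₀ A hA₀ hA hnear (by omega) N (by omega) hS m Λ hm hΛ.1 hm' k hk hkd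
    hgap).exists_pathTo hr hΛ hk hkd (hm' _ (by omega)) (hm' _ hkd) hη.le hgap

end Step

end FibreCocycle

namespace FibreCocycle

/-! ### A discrete maximum principle -/

section Convexity

/-- A sequence vanishing at the ends, which is almost convex wherever it is not small, is small. -/
theorem le_of_almost_convex {d : ℕ} {D : ℕ → ℝ} {η : ℝ} (hη : 0 ≤ η) (h0 : D 0 = 0) (hd : D d = 0)
    (h : ∀ k, k + 1 < d → η ≤ D (k + 1) → -(2 * η) < D (k + 2) - 2 * D (k + 1) + D k) :
    ∀ k ≤ d, D k ≤ (1 + d ^ 2) * η := by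
  -- The parabola `η k (d - k)` has second difference `-2η`, so `g` is strictly convex wherever `D ≥
  -- η`. Its maximum therefore lies at an end or where `D < η`.
  set g : ℕ → ℝ := fun k => D k - η * (k * (d - k)) with hg
  obtain ⟨m, hm, hmax⟩ := Finset.exists_max_image (Finset.range (d + 1)) g ⟨0, by simp⟩
  have hm1 : g m ≤ η := by
    rcases Nat.eq_zero_or_pos m with rfl | hm0
    · simpa [hg, h0] using hη
    rcases (Nat.lt_succ_iff.1 (Finset.mem_range.1 hm)).eq_or_lt with rfl | hmd
    · simpa [hg, hd] using hη
    obtain ⟨m, rfl⟩ : ∃ l, m = l + 1 := ⟨m - 1, by omega⟩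
    have hnn : 0 ≤ η * (((m + 1 : ℕ) : ℝ) * (d - (m + 1 : ℕ))) := by
      have : ((m + 1 : ℕ) : ℝ) ≤ d := by exact_mod_cast hmd.le
      have := sub_nonneg.2 this
      positivity
    by_contra hlt
    have h1 := h m hmd (by simp only [hg] at hlt; linarith)
    have h2 := hmax m (Finset.mem_range.2 (by omega))
    have h3 := hmax (m + 2) (Finset.mem_range.2 (by omega))
    simp only [hg] at h2 h3
    push_cast at h2 h3
    nlinarith
  intro k hk
  have h1 := hmax k (Finset.mem_range.2 (by omega))
  have hk' : (k : ℝ) ≤ d := by exact_mod_cast hk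
  have h2 : (k : ℝ) * (d - k) ≤ d ^ 2 := by nlinarith [(Nat.cast_nonneg k : (0 : ℝ) ≤ k)]
  have h3 := mul_le_mul_of_nonneg_left h2 hη
  have h4 : D k = g k + η * (k * (d - k)) := by simp [hg]
  rw [h4]
  linarith

end Convexity

/-! ### Bounds on exponents and the final rescaling -/

section Flow

variable {X : Type*} [Fintype X] {T : Equiv.Perm X} {d : ℕ} {A : X → Sp d →L[ℝ] Sp d}
  {Λ Λ' : ℕ → ℝ} {K η e : ℝ}

theorem Spec.bounds [Nonempty X] (h : Spec T A Λ) (hT : IsCyclic T) (hA : Bdd A K) (hK : 1 ≤ K)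
    (hr : ∀ x, Multiset.card (chi T A x).roots = d) {i : ℕ} (hi : i < d) :
    |Λ i| ≤ Real.log K := by
  obtain ⟨m, hm, hm'⟩ := h.exists_chi_eq hT hA hr
  obtain ⟨x₀⟩ := ‹Nonempty X›
  have hroot : (chi T A x₀).IsRoot (m i) := by
    rw [hm, rootsPoly_isRoot]; exact Multiset.mem_map_of_mem _ (Multiset.mem_range.2 hi)
  obtain ⟨u, p, hu⟩ := exists_isEig hT hA hroot
  have hn : (0 : ℝ) < Fintype.card X := by exact_mod_cast Fintype.card_pos
  have hK0 : 0 < K := by linarith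
  have h1 : |m i| ≤ K ^ Fintype.card X := by
    rw [← hu.prod, Finset.abs_prod]
    calc ∏ x, |p x| ≤ ∏ _x : X, K := Finset.prod_le_prod (fun _ _ => abs_nonneg _)
          fun x _ => (hu.bounds hA x).1
      _ = K ^ Fintype.card X := by simp
  have h2 : 1 ≤ K ^ Fintype.card X * |m i| := by
    rw [← hu.prod, Finset.abs_prod]
    calc (1 : ℝ) = ∏ _x : X, (1 : ℝ) := by simp
      _ ≤ ∏ x, (K * |p x|) := Finset.prod_le_prod (fun _ _ => zero_le_one)
          fun x _ => (hu.bounds hA x).2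
      _ = K ^ Fintype.card X * ∏ x, |p x| := by simp [Finset.prod_mul_distrib]
  have h3 : K ^ Fintype.card X = Real.exp (Fintype.card X * Real.log K) := by
    rw [Real.exp_nat_mul, Real.exp_log hK0]
  rw [hm' i hi, h3] at h1 h2
  rw [← Real.exp_add, Real.one_le_exp_iff] at h2
  rw [Real.exp_le_exp] at h1
  rw [abs_le]
  constructor
  · have : 0 ≤ Fintype.card X * (Real.log K + Λ i) := by linarith
    linarith [nonneg_of_mul_nonneg_right this hn]
  · exact le_of_mul_le_mul_left h1 hn

/-- The last part of the path: small corrections of the exponents by rescaling. -/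
theorem Spec.exists_pathTo [Nonempty X] (hΛ : Spec T A Λ) (hT : IsCyclic T) (hA : Bdd A K)
    (hK : 1 ≤ K) (hr : ∀ x, Multiset.card (chi T A x).roots = d)
    (hΛ' : ∀ i j, i ≤ j → j < d → Λ' i ≤ Λ' j)
    (hle : ∀ k ≤ d, ∑ i ∈ Finset.range k, Λ i ≤ ∑ i ∈ Finset.range k, Λ' i)
    (hc : ∀ i < d, |Λ' i - Λ i| ≤ η) (hη : 0 ≤ η) (he : K * (Real.exp η - 1) < e) :
    ∃ B, PathTo T A B Λ Λ' e := by
  obtain ⟨m, hm, hm'⟩ := hΛ.exists_chi_eq hT hA hr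
  obtain ⟨P, h1, h2, h3, h4⟩ := exists_rescaling hT hA (by linarith) (c := fun i => Λ' i - Λ i) hm hc hη
  refine ⟨P 1, P, fun t i => Λ i + t * (Λ' i - Λ i), h1, h2, rfl,
    fun t ht x => (h3 t ht x).trans_lt he, fun i => by fun_prop, by simp, by simp,
    fun t ht => ⟨fun i j hij hj => ?_, fun x => ?_⟩, fun j hj t ht t' ht' htt => ?_⟩
  · have k1 := mul_le_mul_of_nonneg_left (hΛ.1 i j hij hj) (sub_nonneg.2 ht.2)
    have k2 := mul_le_mul_of_nonneg_left (hΛ' i j hij hj) ht.1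
    linarith
  · rw [h4 t ht, moduli_rootsPoly, Multiset.map_map]
    refine Multiset.map_congr rfl fun i hi => ?_
    rw [Function.comp_apply, abs_mul, hm' i (Multiset.mem_range.1 hi), Real.abs_exp, ← Real.exp_add]
    congr 1; ring
  · simp only [Finset.sum_add_distrib, ← Finset.mul_sum, Finset.sum_sub_distrib]
    have := sub_nonneg.2 (hle j hj)
    gcongr

theorem PathTo.mono {B : X → Sp d →L[ℝ] Sp d} {e' : ℝ} (h : PathTo T A B Λ Λ' e) (he : e ≤ e') :
    PathTo T A B Λ Λ' e' := by
  obtain ⟨P, l, h1, h2, h3, h4, h5⟩ := h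
  exact ⟨P, l, h1, h2, h3, fun t ht x => (h4 t ht x).trans_le he, h5⟩

end Flow

/-! ### Induction on the total deficit -/

section Core

universe v

/-- The deficit of the `k`-th value of a graph with respect to another one. -/
def deficit (Λ Λ' : ℕ → ℝ) (k : ℕ) : ℝ :=
  ∑ i ∈ Finset.range k, Λ' i - ∑ i ∈ Finset.range k, Λ i

theorem deficit_succ (Λ Λ' : ℕ → ℝ) (k : ℕ) :
    deficit Λ Λ' (k + 1) = deficit Λ Λ' k + (Λ' k - Λ k) := by
  simp only [deficit, Finset.sum_range_succ]; ring

theorem deficit_zero (Λ Λ' : ℕ → ℝ) : deficit Λ Λ' 0 = 0 := by simp [deficit]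

theorem deficit_shift (Λ Λ' : ℕ → ℝ) {k : ℕ} (hk : 1 ≤ k) (c : ℝ) (j : ℕ) :
    deficit (shift Λ k c) Λ' j = deficit Λ Λ' j - if j = k then c else 0 := by
  rw [deficit, sum_shift _ _ hk, deficit]; ring

/-- The end of the mixing. Where the deficit is at least `η`, the current gap is below `2η` while
the target is convex, so the second difference of the deficit exceeds `-2η`. By the maximum
principle all deficits are `O(η)`, and rescaling closes them. -/
theorem Spec.exists_pathTo_of_no_gap {X : Type v} [Fintype X] [Nonempty X] {T : Equiv.Perm X}
    {d : ℕ} {A : X → Sp d →L[ℝ] Sp d} {Λ Λ' : ℕ → ℝ} {K η e : ℝ} (hΛ : Spec T A Λ) (hT : IsCyclic T)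
    (hA : Bdd A K) (hK : 1 ≤ K) (hr : ∀ x, Multiset.card (chi T A x).roots = d)
    (hΛ' : ∀ i j, i ≤ j → j < d → Λ' i ≤ Λ' j) (hD : ∀ k ≤ d, 0 ≤ deficit Λ Λ' k)
    (hd : deficit Λ Λ' d = 0) (hη : 0 ≤ η)
    (hgap : ∀ k, 1 ≤ k → k < d → η ≤ deficit Λ Λ' k → Λ k - Λ (k - 1) < 2 * η)
    (he : K * (Real.exp ((1 + d ^ 2) * η) - 1) < e) : ∃ B, PathTo T A B Λ Λ' e := by
  have hsmall : ∀ k ≤ d, deficit Λ Λ' k ≤ (1 + d ^ 2) * η := by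
    refine le_of_almost_convex hη (deficit_zero _ _) hd fun k hk h => ?_
    have h1 := hgap (k + 1) (by omega) hk h
    have h2 := hΛ' k (k + 1) (by omega) hk
    rw [deficit_succ _ _ (k + 1), deficit_succ]
    rw [Nat.add_sub_cancel] at h1
    linarith
  refine hΛ.exists_pathTo hT hA hK hr hΛ' (fun k hk => sub_nonneg.1 (hD k hk)) (fun i hi => ?_)
    (by positivity) he
  have h1 := deficit_succ Λ Λ' i
  have h2 := hsmall i hi.le
  have h3 := hsmall (i + 1) hi
  have h4 := hD i hi.le
  have h5 := hD (i + 1) hi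
  rw [abs_le]
  constructor <;> linarith

/-- Each mixing at an index with deficit at least `η` lowers the total deficit by `η` and leaves all
deficits nonnegative, so `r` bounds the number of steps. Lack of domination is known only for the
initial cocycle `A₀`, so every intermediate cocycle must stay close to `A₀`. The part `f` of the
tolerance is reserved for the rescaling. -/
theorem exists_pathTo_of_deficit (d : ℕ) (K η f : ℝ) (hK : 1 ≤ K) (hη : 0 < η)
    (hf : 2 * K * (Real.exp ((1 + d ^ 2) * η) - 1) ≤ f) (r : ℕ) (e : ℝ) (he : 0 < e) :
    ∃ (δ : ℝ) (L : ℕ), 0 < δ ∧ ∀ (X : Type v) [Fintype X] (T : Equiv.Perm X) (_ : IsCyclic T)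
      (A₀ A : X → Sp d →L[ℝ] Sp d) (_ : Bdd A₀ K) (_ : ∀ x, ‖A x - A₀ x‖ ≤ δ)
      (_ : L ≤ Fintype.card X) (N : ℕ) (_ : L ≤ N) (_ : ¬ Splits T A₀ N) (Λ Λ' : ℕ → ℝ)
      (_ : ∀ x, Multiset.card (chi T A x).roots = d) (_ : Spec T A Λ)
      (_ : ∀ i j, i ≤ j → j < d → Λ' i ≤ Λ' j) (_ : ∀ k ≤ d, 0 ≤ deficit Λ Λ' k)
      (_ : deficit Λ Λ' d = 0) (_ : ∑ k ∈ Finset.range d, deficit Λ Λ' k ≤ r * η),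
      ∃ B, PathTo T A B Λ Λ' (e + f) := by
  have hKe : ∀ {δ : ℝ}, δ ≤ 1 / (2 * K) → K * δ ≤ 1 / 2 := fun {δ} h => by
    rw [le_div_iff₀ (by positivity)] at h
    linarith
  induction r generalizing e with
  | zero =>
    refine ⟨1 / (2 * K), 1, by positivity, ?_⟩
    intro X _ T hT A₀ A hA₀ hnear hn N hN hS Λ Λ' hr hΛ hΛ' hD hd hsum
    have : Nonempty X := Fintype.card_pos_iff.1 (by omega)
    refine hΛ.exists_pathTo_of_no_gap hT (hA₀.near_two hK (hKe le_rfl) hnear) (by linarith) hr hΛ'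
      hD hd hη.le (fun k hk hkd h => ?_) (by linarith)
    have := Finset.single_le_sum (f := deficit Λ Λ')
      (fun i hi => hD i (Finset.mem_range.1 hi).le) (Finset.mem_range.2 hkd)
    simp only [Nat.cast_zero, zero_mul] at hsum
    linarith
  | succ r ih =>
    obtain ⟨δ₁, L₁, hδ₁, H₁⟩ := ih (e / 2) (by linarith)
    -- The tolerance `δ₁ / 2` of this step, added to the initial distance `δ₁ / 2`, stays within the
    -- `δ₁` that the remaining steps require.
    obtain ⟨δ₂, L₂, hδ₂, H₂⟩ := exists_mixing_step.{v} d (2 * K) (min (e / 2) (δ₁ / 2)) η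
      (by linarith) (by positivity) hη
    refine ⟨min (1 / (2 * K)) (min (δ₁ / 2) δ₂), max (max L₁ L₂) 1, by positivity, ?_⟩
    intro X _ T hT A₀ A hA₀ hnear hn N hN hS Λ Λ' hr hΛ hΛ' hD hd hsum
    have : Nonempty X := Fintype.card_pos_iff.1 (by omega)
    have hA : Bdd A (2 * K) := hA₀.near_two hK (hKe (min_le_left _ _)) hnear
    by_cases hgap : ∀ k, 1 ≤ k → k < d → η ≤ deficit Λ Λ' k → Λ k - Λ (k - 1) < 2 * η
    · exact hΛ.exists_pathTo_of_no_gap hT hA (by linarith) hr hΛ' hD hd hη.le hgap (by linarith)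
    push Not at hgap
    obtain ⟨k, hk, hkd, hηk, hg⟩ := hgap
    obtain ⟨B, hrB, hAB⟩ := H₂ X T hT A₀ A (hA₀.mono (by linarith)) hA
      (fun x => by
        rw [norm_sub_rev]
        exact (hnear x).trans ((min_le_right _ _).trans (min_le_right _ _)))
      (by omega) N (by omega) hS Λ hr hΛ k hk hkd hg
    obtain ⟨D, hBD⟩ := H₁ X T hT A₀ B hA₀ (fun x => by
        have h1 := (hAB.norm_lt x).le.trans (min_le_right _ _)
        have h2 := (hnear x).trans ((min_le_right _ _).trans (min_le_left _ _))
        have h3 := norm_add_le (B x - A x) (A x - A₀ x)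
        rw [sub_add_sub_cancel] at h3
        linarith)
      (by omega) N (by omega) hS (shift Λ k η) Λ' hrB hAB.spec hΛ'
      (fun j hj => by
        rw [deficit_shift _ _ hk]
        split_ifs with h
        · subst h; linarith
        · linarith [hD j hj])
      (by rw [deficit_shift _ _ hk, if_neg hkd.ne', hd, sub_zero])
      (by
        simp only [deficit_shift _ _ hk, Finset.sum_sub_distrib, Finset.sum_ite_eq',
          Finset.mem_range, if_pos hkd]
        push_cast at hsum
        linarith)
    refine ⟨D, (hAB.trans hBD).mono ?_⟩
    linarith [min_le_left (e / 2) (δ₁ / 2)]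

/-- Bounds the number of mixings independently of the cocycle and of the target. The last target
increment is at most the last exponent, because the deficit is nonnegative before `d` and zero at
`d`; by convexity all target increments are at most `b`. -/
theorem sum_deficit_le {d : ℕ} {Λ Λ' : ℕ → ℝ} {b : ℝ} (hΛ : ∀ i < d, |Λ i| ≤ b)
    (hΛ' : ∀ i j, i ≤ j → j < d → Λ' i ≤ Λ' j) (hD : ∀ k ≤ d, 0 ≤ deficit Λ Λ' k)
    (hd : deficit Λ Λ' d = 0) : ∑ k ∈ Finset.range d, deficit Λ Λ' k ≤ d * (d * (2 * b)) := by
  rcases Nat.eq_zero_or_pos d with rfl | hd0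
  · simp
  obtain ⟨c, rfl⟩ : ∃ c, d = c + 1 := ⟨d - 1, by omega⟩
  have hb : 0 ≤ b := (abs_nonneg _).trans (hΛ 0 hd0)
  have hlast : Λ' c ≤ Λ c := by
    have := hD c (by omega)
    rw [deficit_succ] at hd
    linarith
  have hdiff : ∀ i < c + 1, Λ' i - Λ i ≤ 2 * b := fun i hi => by
    have h1 := hΛ' i c (by omega) (by omega)
    have h2 := (abs_le.1 (hΛ c (by omega))).2
    have h3 := (abs_le.1 (hΛ i hi)).1
    linarith
  have hk : ∀ k ∈ Finset.range (c + 1), deficit Λ Λ' k ≤ (c + 1 : ℕ) * (2 * b) := by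
    intro k hk
    rw [Finset.mem_range] at hk
    rw [deficit, ← Finset.sum_sub_distrib]
    calc _ ≤ ∑ _i ∈ Finset.range k, 2 * b :=
          Finset.sum_le_sum fun i hi => hdiff i ((Finset.mem_range.1 hi).trans hk)
      _ = k * (2 * b) := by simp
      _ ≤ _ := by gcongr
  exact (Finset.sum_le_sum hk).trans_eq (by simp)

theorem Spec.congr {X : Type*} [Fintype X] {T : Equiv.Perm X} {d : ℕ} {A B : X → Sp d →L[ℝ] Sp d}
    {Λ : ℕ → ℝ} (h : Spec T A Λ) (hAB : ∀ x, moduli (chi T B x) = moduli (chi T A x)) :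
    Spec T B Λ := ⟨h.1, fun x => by rw [hAB, h.2]⟩

/-- In the absence of dominated splittings, the graph of the exponents of a cocycle of large period
can be raised at will. -/
theorem exists_pathTo_of_not_splits (d : ℕ) (K ε : ℝ) (hK : 1 ≤ K) (hε : 0 < ε) : ∃ L : ℕ,
    ∀ (X : Type v) [Fintype X] (T : Equiv.Perm X) (_ : IsCyclic T) (A : X → Sp d →L[ℝ] Sp d)
      (_ : Bdd A K) (_ : L ≤ Fintype.card X) (N : ℕ) (_ : L ≤ N) (_ : ¬ Splits T A N) (Λ Λ' : ℕ → ℝ)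
      (_ : Spec T A Λ) (_ : ∀ i j, i ≤ j → j < d → Λ' i ≤ Λ' j) (_ : ∀ k ≤ d, 0 ≤ deficit Λ Λ' k)
      (_ : deficit Λ Λ' d = 0), ∃ B, PathTo T A B Λ Λ' ε := by
  have hK0 : 0 < K := by linarith
  -- The step size is dictated by the final rescaling, which must cost at most `ε / 4` for a cocycle
  -- bounded by `2K`.
  obtain ⟨η, hη, hf⟩ : ∃ η : ℝ, 0 < η ∧ 2 * K * (Real.exp ((1 + d ^ 2) * η) - 1) ≤ ε / 4 := by
    refine ⟨Real.log (1 + ε / (8 * K)) / (1 + d ^ 2),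
      div_pos (Real.log_pos (lt_add_of_pos_right 1 (by positivity))) (by positivity),
      le_of_eq ?_⟩
    rw [mul_div_cancel₀ _ (by positivity), Real.exp_log (by positivity)]
    field_simp
    ring
  obtain ⟨r, hr⟩ := exists_nat_ge (d * (d * (2 * Real.log (2 * K))) / η)
  rw [div_le_iff₀ hη] at hr
  obtain ⟨δ, L₁, hδ, H₁⟩ := exists_pathTo_of_deficit.{v} d K η (ε / 4) hK hη hf r (ε / 4) (by linarith)
  obtain ⟨n₀, H₂⟩ := exists_path_to_real_spectrum.{v} d d K (min (1 / (2 * K)) (min δ (ε / 4))) hK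
    (by positivity)
  refine ⟨max (max L₁ n₀) 1, ?_⟩
  intro X _ T hT A hA hn N hN hS Λ Λ' hΛ hΛ' hD hd
  have : Nonempty X := Fintype.card_pos_iff.1 (by omega)
  obtain ⟨P, p1, p2, p3, p4, p5⟩ := H₂ X T hT A hA (by omega) (fun x => by omega)
  have hmin := min_le_left (1 / (2 * K)) (min δ (ε / 4))
  have hmin' := min_le_right (1 / (2 * K)) (min δ (ε / 4))
  have hAB : PathTo T A (P 1) Λ Λ (ε / 4) :=
    ⟨P, fun _ => Λ, p1, p2, rfl, fun t ht x =>
      (p3 t ht x).trans_le (hmin'.trans (min_le_right _ _)), fun i => continuous_const, rfl, rfl,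
      fun t ht => hΛ.congr (p4 t ht), fun j hj => monotoneOn_const⟩
  have hrB : ∀ x, Multiset.card (chi T (P 1) x).roots = d := fun x => by
    have h1 := congrArg Polynomial.natDegree (p5 x)
    rw [natDegree_chi, rootsPoly, Polynomial.natDegree_multiset_prod_X_sub_C_eq_card] at h1
    exact h1.symm
  have hB : Bdd (P 1) (2 * K) := hA.near_two hK (e := 1 / (2 * K))
    (by rw [mul_one_div, div_le_div_iff₀ (by positivity) (by norm_num)]; linarith)
    fun x => (p3 1 (by simp) x).le.trans hmin
  obtain ⟨B, hB'⟩ := H₁ X T hT A (P 1) hA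
    (fun x => (p3 1 (by simp) x).le.trans (hmin'.trans (min_le_left _ _))) (by omega) N (by omega) hS
    Λ Λ' hrB hAB.spec hΛ' hD hd ((sum_deficit_le (fun i hi => hAB.spec.bounds hT hB (by linarith) hrB hi)
      hΛ' hD hd).trans hr)
  exact ⟨B, (hAB.trans hB').mono (by linarith)⟩

end Core

end FibreCocycle

namespace FibreCocycle

/-! ### From constant fibres back to bundles -/

section MinExpansion

variable {V W : Type*} [NormedAddCommGroup V] [NormedSpace ℝ V] [NormedAddCommGroup W]
  [NormedSpace ℝ W]

theorem minExpansion_le (B : V →L[ℝ] W) {v : V} (hv : ‖v‖ = 1) : minExpansion B ≤ ‖B v‖ :=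
  ciInf_le (f := fun v : Metric.sphere (0 : V) 1 => ‖B v‖)
    ⟨0, by rintro _ ⟨v, rfl⟩; exact norm_nonneg _⟩ ⟨v, by simp [hv]⟩

theorem minExpansion_mul_le (B : V →L[ℝ] W) (v : V) : minExpansion B * ‖v‖ ≤ ‖B v‖ := by
  rcases eq_or_ne v 0 with rfl | hv
  · simp
  have h0 : 0 < ‖v‖ := norm_pos_iff.2 hv
  have h := minExpansion_le B (v := ‖v‖⁻¹ • v) (by rw [norm_smul]; simp [h0.ne'])
  rw [map_smul, norm_smul, norm_inv, norm_norm, inv_mul_eq_div] at h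
  exact (le_div_iff₀ h0).1 h

/-- In the zero space the unit sphere is empty and the real infimum is `0` by convention. -/
theorem le_minExpansion [Nontrivial V] (B : V →L[ℝ] W) {c : ℝ} (h : ∀ v, ‖v‖ = 1 → c ≤ ‖B v‖) :
    c ≤ minExpansion B := by
  have : Nonempty (Metric.sphere (0 : V) 1) := NormedSpace.sphere_nonempty.2 zero_le_one |>.to_subtype
  exact le_ciInf fun v => h v (by simp)

end MinExpansion

section Model

variable {X : Type*} {E : X → Type*} [∀ x, NormedAddCommGroup (E x)]
  [∀ x, InnerProductSpace ℝ (E x)] {T : Equiv.Perm X} {d : ℕ} (φ : ∀ x, E x ≃ₗᵢ[ℝ] Sp d)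
  (A : Cocycle T E)

/-- The cocycle with constant fibre obtained by identifying the fibres of a bundle. -/
noncomputable def model (x : X) : Sp d →L[ℝ] Sp d :=
  ((φ (T x)).toContinuousLinearEquiv : E (T x) →L[ℝ] Sp d).comp
    ((A x : E x →L[ℝ] E (T x)).comp ((φ x).symm.toContinuousLinearEquiv : Sp d →L[ℝ] E x))

theorem model_apply (x : X) (v : E x) : model φ A x (φ x v) = φ (T x) (A x v) := by
  simp [model]

theorem norm_model_apply (x : X) (v : Sp d) : ‖model φ A x v‖ = ‖A x ((φ x).symm v)‖ := by
  simp [model]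

theorem bdd_model {K : ℝ} (hK : 0 < K) (hA : IsBoundedBy A K) : Bdd (model φ A) K := by
  intro x v
  obtain ⟨h1, -, h2⟩ := hA x
  rw [norm_model_apply]
  constructor
  · refine ((A x : E x →L[ℝ] E (T x)).le_opNorm ((φ x).symm v)).trans ?_
    rw [LinearIsometryEquiv.norm_map]
    gcongr
  · have h3 := minExpansion_mul_le (A x : E x →L[ℝ] E (T x)) ((φ x).symm v)
    rw [LinearIsometryEquiv.norm_map] at h3
    have h4 : K⁻¹ * ‖v‖ ≤ ‖A x ((φ x).symm v)‖ := (by gcongr : K⁻¹ * ‖v‖ ≤ _).trans h3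
    rwa [inv_mul_le_iff₀ hK] at h4

theorem iter_model (n : ℕ) (x : X) (v : E x) :
    φ (T^[n] x) (iter A n x v) = cp T (model φ A) n x (φ x v) := by
  induction n generalizing x with
  | zero => rfl
  | succ n ih =>
    rw [cp_succ_apply, model_apply]
    exact ih (T x) (A x v)

theorem fibreCast_model {x y : X} (h : x = y) (v : E x) : φ y (fibreCast h v) = φ x v := by
  subst h; rfl

theorem chi_model [Fintype X] [∀ x, FiniteDimensional ℝ (E x)] (hT : IsCyclic T) (x : X) :
    chi T (model φ A) x = (returnMap hT A x : E x →ₗ[ℝ] E x).charpoly := by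
  rw [chi, ← LinearEquiv.charpoly_conj (φ x).toLinearEquiv]
  congr 1
  ext1 w
  obtain ⟨v, rfl⟩ := (φ x).surjective w
  rw [LinearEquiv.conj_apply_apply, ret_apply]
  have h1 : (φ x).toLinearEquiv.symm (φ x v) = v := (φ x).symm_apply_apply v
  have h2 : (returnMap hT A x : E x →ₗ[ℝ] E x) v =
    fibreCast (iterate_card hT x) (iter A (Nat.card X) x v) := rfl
  have h3 : ∀ u, (φ x).toLinearEquiv u = φ x u := fun _ => rfl
  rw [h1, h2, h3, fibreCast_model, iter_model, Nat.card_eq_fintype_card]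

/-- Injectivity makes the dimension non-decreasing along the orbit, and the orbit returns. -/
theorem finrank_eq_of_inv [Fintype X] (hT : IsCyclic T) {B : X → Sp d →L[ℝ] Sp d} {K : ℝ}
    (hB : Bdd B K) {F : X → Submodule ℝ (Sp d)} (hF : Inv T B F) (x y : X) :
    Module.finrank ℝ (F x) = Module.finrank ℝ (F y) := by
  have key : ∀ x y, Module.finrank ℝ (F x) ≤ Module.finrank ℝ (F y) := fun x y => by
    obtain ⟨k, -, rfl⟩ := exists_iter_eq hT x y
    induction k with
    | zero => rfl
    | succ k ih =>
      refine ih.trans ?_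
      rw [Function.iterate_succ_apply']
      refine LinearMap.finrank_le_finrank_of_injective
        (f := (B (T^[k] x) : Sp d →ₗ[ℝ] Sp d).restrict (hF (T^[k] x))) fun u v huv => ?_
      exact Subtype.ext (hB.injective _ (congrArg Subtype.val huv))
  exact le_antisymm (key x y) (key y x)

/-- The subbundle corresponding to a family of subspaces of the model fibre. -/
noncomputable def pullField (F : X → Submodule ℝ (Sp d)) (x : X) : Submodule ℝ (E x) :=
  (F x).comap ((φ x).toLinearEquiv : E x →ₗ[ℝ] Sp d)

theorem mem_pullField {F : X → Submodule ℝ (Sp d)} {x : X} {v : E x} :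
    v ∈ pullField φ F x ↔ φ x v ∈ F x := Iff.rfl

theorem symm_mem_pullField {F : X → Submodule ℝ (Sp d)} {x : X} {v : Sp d} (hv : v ∈ F x) :
    (φ x).symm v ∈ pullField φ F x := by
  rwa [mem_pullField, LinearIsometryEquiv.apply_symm_apply]

theorem isInvariantSubbundle_pullField [Fintype X] [∀ x, FiniteDimensional ℝ (E x)]
    (hT : IsCyclic T) {K : ℝ} (hB : Bdd (model φ A) K) {F : X → Submodule ℝ (Sp d)}
    (hF : ∀ x, F x ≠ ⊥) (hI : Inv T (model φ A) F) : IsInvariantSubbundle A (pullField φ F) := by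
  have hfin : ∀ x, Module.finrank ℝ (pullField φ F x) = Module.finrank ℝ (F x) := fun x => by
    rw [pullField, Submodule.comap_equiv_eq_map_symm, LinearEquiv.finrank_map_eq]
  have hfin' : ∀ x y, Module.finrank ℝ (pullField φ F x) = Module.finrank ℝ (pullField φ F y) :=
    fun x y => by rw [hfin, hfin, finrank_eq_of_inv hT hB hI x y]
  refine ⟨fun x => ?_, hfin', fun x => ?_⟩
  · obtain ⟨v, hv, hv0⟩ := (Submodule.ne_bot_iff _).1 (hF x)
    exact (Submodule.ne_bot_iff _).2 ⟨(φ x).symm v, symm_mem_pullField φ hv, by simpa using hv0⟩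
  · refine Submodule.eq_of_le_of_finrank_eq ?_ ?_
    · rintro _ ⟨v, hv, rfl⟩
      have := hI x _ (mem_pullField φ |>.1 hv)
      rwa [model_apply] at this
    · rw [hfin' (T x) x]
      exact LinearEquiv.finrank_map_eq (A x).toLinearEquiv _

theorem hasDominatedSplitting_of_splits [Fintype X] [∀ x, FiniteDimensional ℝ (E x)]
    (hT : IsCyclic T) {K : ℝ} (hK : 0 < K) (hA : IsBoundedBy A K) {N : ℕ}
    (h : Splits T (model φ A) N) : HasDominatedSplitting A N := by
  have hB := bdd_model φ A hK hA
  obtain ⟨F, G, hF, hG, hIF, hIG, hFG, hdom⟩ := h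
  have hIF' := isInvariantSubbundle_pullField φ A hT hB hF hIF
  have hIG' := isInvariantSubbundle_pullField φ A hT hB hG hIG
  refine ⟨pullField φ F, pullField φ G, hIF', hIG', fun x => ⟨?_, ?_⟩, fun x => ?_⟩
  · rw [Submodule.disjoint_def]
    intro v hv hv'
    have := Submodule.disjoint_def.1 (hFG x).disjoint _ hv hv'
    exact (map_eq_zero_iff (φ x) (φ x).injective).1 this
  · rw [Submodule.codisjoint_iff_exists_add_eq]
    intro v
    obtain ⟨f, g, hf, hg, hfg⟩ := Submodule.codisjoint_iff_exists_add_eq.1 (hFG x).codisjoint (φ x v)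
    exact ⟨_, _, symm_mem_pullField φ hf, symm_mem_pullField φ hg, by
      rw [← map_add, hfg, LinearIsometryEquiv.symm_apply_apply]⟩
  · have : Nontrivial (pullField φ G x) := (Submodule.nontrivial_iff_ne_bot).2 (hIG'.ne_bot x)
    have hnorm : ∀ v, ‖cp T (model φ A) N x (φ x v)‖ = ‖iter A N x v‖ := fun v => by
      rw [← iter_model, LinearIsometryEquiv.norm_map]
    set M := (iter A N x : E x →L[ℝ] E (T^[N] x)) with hM
    have h1 : (K ^ N)⁻¹ ≤ minExpansion (M.comp (pullField φ G x).subtypeL) := by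
      refine le_minExpansion _ fun v hv => ?_
      have := (hB.cp (T := T) hK.le N x (φ x v)).2
      rw [hnorm, LinearIsometryEquiv.norm_map, ← Submodule.coe_norm, hv] at this
      rw [inv_le_iff_one_le_mul₀' (by positivity)]
      exact this
    have hm : 0 < minExpansion (M.comp (pullField φ G x).subtypeL) := lt_of_lt_of_le (by positivity) h1
    have h2 : ‖M.comp (pullField φ F x).subtypeL‖ ≤
        minExpansion (M.comp (pullField φ G x).subtypeL) / 3 := by
      refine ContinuousLinearMap.opNorm_le_bound _ (by positivity) fun f => ?_
      rcases eq_or_ne f 0 with rfl | hf0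
      · simp
      have hf' : 0 < ‖f‖ := norm_pos_iff.2 hf0
      have h3 : 3 * ‖M f‖ / ‖f‖ ≤ minExpansion (M.comp (pullField φ G x).subtypeL) := by
        refine le_minExpansion _ fun g hg => ?_
        have := hdom x _ (mem_pullField φ |>.1 f.2) _ (mem_pullField φ |>.1 g.2)
        rw [hnorm, hnorm, LinearIsometryEquiv.norm_map, LinearIsometryEquiv.norm_map,
          ← Submodule.coe_norm, ← Submodule.coe_norm, hg, mul_one] at this
        rw [div_le_iff₀ hf']
        exact this
      rw [div_le_iff₀ hf'] at h3
      change ‖M f‖ ≤ _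
      linarith
    -- The factor `3` in `Splits` leaves room for the strict inequality: the ratio is at most `1 /
    -- 3`.
    rw [div_lt_iff₀ hm]
    linarith

end Model

section Pull

variable {X : Type*} {E : X → Type*} [∀ x, NormedAddCommGroup (E x)]
  [∀ x, InnerProductSpace ℝ (E x)] {T : Equiv.Perm X} {d : ℕ} (φ : ∀ x, E x ≃ₗᵢ[ℝ] Sp d)
  (B : X → Sp d →L[ℝ] Sp d) (hB : ∀ x, Function.Injective (B x))

/-- The cocycle on a bundle corresponding to a cocycle with constant fibre. -/
noncomputable def pull : Cocycle T E := fun x =>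
  ((φ x).toContinuousLinearEquiv.trans
    (LinearEquiv.ofInjectiveEndo (B x : Sp d →ₗ[ℝ] Sp d) (hB x)).toContinuousLinearEquiv).trans
    (φ (T x)).symm.toContinuousLinearEquiv

theorem pull_apply (x : X) (v : E x) :
    (pull φ B hB : Cocycle T E) x v = (φ (T x)).symm (B x (φ x v)) := rfl

theorem model_pull : model φ (pull φ B hB : Cocycle T E) = B := by
  funext x
  ext1 v
  obtain ⟨v, rfl⟩ := (φ x).surjective v
  rw [model_apply, pull_apply, LinearIsometryEquiv.apply_symm_apply]

theorem pull_model (A : Cocycle T E) (h : ∀ x, Function.Injective (model φ A x)) :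
    pull φ (model φ A) h = A := by
  funext x
  ext v
  rw [pull_apply, model_apply, LinearIsometryEquiv.symm_apply_apply]

theorem norm_pull_sub_le (A : Cocycle T E) (x : X) :
    ‖((pull φ B hB : Cocycle T E) x : E x →L[ℝ] E (T x)) - (A x : E x →L[ℝ] E (T x))‖ ≤
      ‖B x - model φ A x‖ := by
  refine ContinuousLinearMap.opNorm_le_bound _ (norm_nonneg _) fun v => ?_
  have h : φ (T x) ((((pull φ B hB : Cocycle T E) x : E x →L[ℝ] E (T x)) -
      (A x : E x →L[ℝ] E (T x))) v) = (B x - model φ A x) (φ x v) := by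
    rw [sub_apply, map_sub, sub_apply, model_apply]
    congr 1
    exact (φ (T x)).apply_symm_apply _
  rw [← (φ (T x)).norm_map, h, ← (φ x).norm_map v]
  exact (B x - model φ A x).le_opNorm _

theorem continuous_pull {S : Type*} [TopologicalSpace S] {P : S → X → Sp d →L[ℝ] Sp d}
    (hP : ∀ t x, Function.Injective (P t x)) (x : X) (h : Continuous fun t => P t x) :
    Continuous fun t => ((pull φ (P t) (hP t) : Cocycle T E) x : E x →L[ℝ] E (T x)) := by
  have : (fun t => ((pull φ (P t) (hP t) : Cocycle T E) x : E x →L[ℝ] E (T x))) = fun t =>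
      ((φ (T x)).symm.toContinuousLinearEquiv : Sp d →L[ℝ] E (T x)).comp
        ((P t x).comp ((φ x).toContinuousLinearEquiv : E x →L[ℝ] Sp d)) := rfl
  rw [this]
  exact continuous_const.clm_comp (h.clm_comp continuous_const)

end Pull

section Graph

variable {X : Type*} [Fintype X] [Nonempty X] {E : X → Type*} [∀ x, NormedAddCommGroup (E x)]
  [∀ x, InnerProductSpace ℝ (E x)] [∀ x, FiniteDimensional ℝ (E x)] {T : Equiv.Perm X} {d : ℕ}
  (φ : ∀ x, E x ≃ₗᵢ[ℝ] Sp d)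

theorem lyapunovExponents_eq (hT : IsCyclic T) (A : Cocycle T E) (x : X) :
    lyapunovExponents hT A x = ((moduli (chi T (model φ A) x)).map
      fun a => Real.log a / Fintype.card X).sort (· ≤ ·) := by
  rw [lyapunovExponents, eigenvalues, moduli, chi_model φ A hT, Multiset.map_map,
    Nat.card_eq_fintype_card]
  rfl

theorem lyapunovGraph_eq_sum (hT : IsCyclic T) (A : Cocycle T E) {Λ : ℕ → ℝ}
    (h : Spec T (model φ A) Λ) (j : Fin (d + 1)) :
    lyapunovGraph d hT A j = ∑ i ∈ Finset.range j, Λ i := by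
  have hn : (Fintype.card X : ℝ) ≠ 0 := by exact_mod_cast Fintype.card_ne_zero
  have h1 : (moduli (chi T (model φ A) (Classical.arbitrary X))).map
      (fun a => Real.log a / Fintype.card X) = ((List.range d).map Λ : List ℝ) := by
    rw [h.2, Multiset.map_map]
    have : ((fun a => Real.log a / Fintype.card X) ∘ fun i => Real.exp (Fintype.card X * Λ i)) = Λ := by
      funext i
      simp [hn]
    rw [this]; rfl
  have h2 : ((List.range d).map Λ).Pairwise (· ≤ ·) := by
    rw [List.pairwise_map]
    refine (List.pairwise_lt_range (n := d)).imp_of_mem fun {i j} _ hj hij => ?_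
    exact h.1 i j hij.le (List.mem_range.1 hj)
  rw [lyapunovGraph, lyapunovExponents_eq φ, h1, Multiset.coe_sort, List.mergeSort_eq_self _ (by simpa using h2),
    ← List.map_take, List.take_range, min_eq_left (by omega)]
  rfl

theorem exists_spec (hT : IsCyclic T) (A : Cocycle T E) {K : ℝ} (hK : 0 < K) (hA : IsBoundedBy A K) :
    ∃ Λ, Spec T (model φ A) Λ := by
  have hB := bdd_model φ A hK hA
  have hn : (Fintype.card X : ℝ) ≠ 0 := by exact_mod_cast Fintype.card_ne_zero
  set x₀ := Classical.arbitrary X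
  set M := moduli (chi T (model φ A) x₀) with hM
  set L := lyapunovExponents hT A x₀ with hL
  rw [lyapunovExponents_eq φ] at hL
  have hlen : L.length = d := by
    rw [hL, Multiset.length_sort, Multiset.card_map, moduli, Multiset.card_map,
      IsAlgClosed.card_roots_eq_natDegree, Polynomial.natDegree_map, natDegree_chi]
  -- A bounded cocycle has no eigenvalue `0`, so moduli are recovered from their logarithms.
  have hpos : ∀ a ∈ M, 0 < a := by
    intro a ha
    obtain ⟨z, hz, rfl⟩ := Multiset.mem_map.1 ha
    rw [norm_pos_iff]
    rintro rfl
    have h0 := Polynomial.isRoot_of_mem_roots hz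
    rw [← map_zero (algebraMap ℝ ℂ), Polynomial.isRoot_map_iff (algebraMap ℝ ℂ).injective] at h0
    obtain ⟨u, p, hu⟩ := exists_isEig hT hB h0
    obtain ⟨y, -, hy⟩ := Finset.prod_eq_zero_iff.1 hu.prod
    have := (hu.bounds hB y).2
    rw [hy, abs_zero, mul_zero] at this
    linarith
  have hLsort : L.Pairwise (· ≤ ·) := by rw [hL]; exact Multiset.pairwise_sort _ _
  refine ⟨fun i => L.getD i 0, fun i j hij hj => ?_, fun x => ?_⟩
  · dsimp only
    rw [List.getD_eq_getElem L _ (show i < L.length by omega),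
      List.getD_eq_getElem L _ (show j < L.length by omega)]
    rcases hij.eq_or_lt with rfl | hij
    · exact le_rfl
    · exact List.pairwise_iff_getElem.1 hLsort i j (by omega) (by omega) hij
  · have h1 : ((Multiset.range d).map fun i => L.getD i 0) = (L : Multiset ℝ) := by
      change (((List.range d).map fun i => L.getD i 0 : List ℝ) : Multiset ℝ) = L
      congr 1
      refine List.ext_getElem (by simp [hlen]) fun i h1 h2 => ?_
      rw [List.getElem_map, List.getElem_range, List.getD_eq_getElem _ _ h2]
    have h2 : (L : Multiset ℝ) = M.map fun a => Real.log a / Fintype.card X := by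
      rw [hL, Multiset.sort_eq]
    rw [chi_eq hT hB x₀ x, ← hM]
    have h3 : (Multiset.range d).map (fun i => Real.exp (Fintype.card X * L.getD i 0)) =
        ((Multiset.range d).map fun i => L.getD i 0).map fun a => Real.exp (Fintype.card X * a) := by
      rw [Multiset.map_map]; rfl
    rw [h3, h1, h2, Multiset.map_map]
    conv_lhs => rw [← Multiset.map_id M]
    refine Multiset.map_congr rfl fun a ha => ?_
    simp only [Function.comp_apply, id]
    rw [mul_div_cancel₀ _ hn, Real.exp_log (hpos a ha)]

end Graph

end FibreCocycle

namespace FibreCocycle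

/-- The increments of a graph. -/
def increments {d : ℕ} (σ : Fin (d + 1) → ℝ) (i : ℕ) : ℝ :=
  σ (Fin.ofNat (d + 1) (min (i + 1) d)) - σ (Fin.ofNat (d + 1) (min i d))

theorem sum_increments {d : ℕ} {σ : Fin (d + 1) → ℝ} (h0 : σ 0 = 0) {k : ℕ} (hk : k < d + 1) :
    ∑ i ∈ Finset.range k, increments σ i = σ ⟨k, hk⟩ := by
  simp only [increments]
  rw [Finset.sum_range_sub fun i => σ (Fin.ofNat (d + 1) (min i d))]
  have h1 : Fin.ofNat (d + 1) (min k d) = ⟨k, hk⟩ := by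
    ext; simp [Fin.ofNat, min_eq_left (Nat.lt_succ_iff.1 hk), Nat.mod_eq_of_lt hk]
  have h2 : Fin.ofNat (d + 1) (min 0 d) = 0 := by ext; simp [Fin.ofNat]
  rw [h1, h2, h0, sub_zero]

theorem increments_mono {d : ℕ} {σ : Fin (d + 1) → ℝ} (h : σ ∈ convexGraphs d) :
    ∀ i j, i ≤ j → j < d → increments σ i ≤ increments σ j := by
  intro i j hij
  induction j, hij using Nat.le_induction with
  | base => intro _; exact le_rfl
  | succ j hij ih =>
    intro hj
    refine (ih (by omega)).trans ?_
    have hval : ∀ k ≤ d, ((Fin.ofNat (d + 1) (min k d) : Fin (d + 1)) : ℕ) = k := fun k hk => by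
      simp [Fin.ofNat, min_eq_left hk, Nat.mod_eq_of_lt (Nat.lt_succ_iff.2 hk)]
    refine h.2 _ _ _ ?_ ?_
    · rw [hval _ (by omega), hval _ (by omega)]
    · rw [hval _ (by omega), hval _ (by omega)]

/-- Paths of cocycles with constant fibre induce paths of cocycles on bundles. -/
theorem exists_path_of_pathTo {X : Type*} [Fintype X] [Nonempty X] {E : X → Type*}
    [∀ x, NormedAddCommGroup (E x)] [∀ x, InnerProductSpace ℝ (E x)]
    [∀ x, FiniteDimensional ℝ (E x)] {T : Equiv.Perm X} {d : ℕ} {K ε : ℝ} (hK : 1 ≤ K)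
    (hT : IsCyclic T) (φ : ∀ x, E x ≃ₗᵢ[ℝ] Sp d) {A : Cocycle T E} (hA : IsBoundedBy A K)
    {σ : Fin (d + 1) → ℝ} (hσ : σ ∈ convexGraphs d) (hle : lyapunovGraph d hT A ≤ σ)
    (hlast : σ (Fin.last d) = lyapunovGraph d hT A (Fin.last d))
    (H : ∀ Λ Λ' : ℕ → ℝ, Spec T (model φ A) Λ → (∀ i j, i ≤ j → j < d → Λ' i ≤ Λ' j) →
      (∀ k ≤ d, 0 ≤ deficit Λ Λ' k) → deficit Λ Λ' d = 0 →
      ∃ B, PathTo T (model φ A) B Λ Λ' (min ε (1 / (2 * K)))) :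
    ∃ P : unitInterval → Cocycle T E, IsPath P ∧ IsShort P ε ∧ P 0 = A ∧
      IsNondecreasingPath (fun t => lyapunovGraph d hT (P t)) ∧ lyapunovGraph d hT (P 1) = σ := by
  have hK0 : 0 < K := by linarith
  have hB := bdd_model φ A hK0 hA
  obtain ⟨Λ, hΛ⟩ := exists_spec φ hT A hK0 hA
  have hdef : ∀ k (hk : k < d + 1), deficit Λ (increments σ) k =
      σ ⟨k, hk⟩ - lyapunovGraph d hT A ⟨k, hk⟩ := fun k hk => by
    rw [deficit, sum_increments hσ.1 hk, lyapunovGraph_eq_sum φ hT A hΛ]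
  obtain ⟨B, P, l, p1, p2, -, p4, p5, p6, p7, p8, p9⟩ := H Λ (increments σ) hΛ (increments_mono hσ)
    (fun k hk => by rw [hdef k (by omega)]; exact sub_nonneg.2 (hle _))
    (by rw [hdef d (by omega)]; exact sub_eq_zero.2 hlast)
  -- The radius `1 / (2K)` in the tolerance keeps all members of the path invertible, so that they
  -- are cocycles.
  have hinj : ∀ (t : unitInterval) x, Function.Injective (P t x) := fun t x =>
    (hB.near_two hK (e := 1 / (2 * K))
      (by rw [mul_one_div, div_le_div_iff₀ (by positivity) (by norm_num)]; linarith)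
      fun x => (p4 t t.2 x).le.trans (min_le_right _ _)).injective x
  have hzero : pull φ (P (0 : unitInterval)) (hinj 0) = A := by
    refine Eq.trans ?_ (pull_model φ A (hB.injective))
    congr 1
  have hgraph : ∀ (t : unitInterval) (j : Fin (d + 1)),
      lyapunovGraph d hT (pull φ (P t) (hinj t) : Cocycle T E) j = ∑ i ∈ Finset.range j, l t i :=
    fun t j => lyapunovGraph_eq_sum φ hT _ (by rw [model_pull]; exact p8 t t.2) j
  refine ⟨fun t => pull φ (P t) (hinj t), fun x => ?_, fun t x => ?_, hzero, ⟨?_, ?_⟩, ?_⟩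
  · exact continuous_pull φ (P := fun t : unitInterval => P t) hinj x
      ((p1 x).comp continuous_subtype_val)
  · dsimp only
    rw [hzero]
    exact ((norm_pull_sub_le φ _ (hinj t) A x).trans_lt (p4 t t.2 x)).trans_le (min_le_left _ _)
  · refine continuous_pi fun j => ?_
    simp only [hgraph]
    exact continuous_finsetSum _ fun i _ => (p5 i).comp continuous_subtype_val
  · intro t t' htt j
    simp only [hgraph]
    exact p9 j (by omega) t.2 t'.2 htt
  · funext j
    rw [hgraph, Set.Icc.coe_one, p7, sum_increments hσ.1 j.2]

end FibreCocycle

end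

theorem theoremt (d : ℕ) (hd : 2 ≤ d) (K : ℝ) (hK : 1 < K) (ε : ℝ) (hε : 0 < ε) :
    ∃ L ∈ powersOfTwo,
      ∀ (X : Type*) [Finite X] [Nonempty X] (T : Equiv.Perm X) (hT : IsCyclic T)
        (E : X → Type*) [∀ x, NormedAddCommGroup (E x)] [∀ x, InnerProductSpace ℝ (E x)]
        [∀ x, FiniteDimensional ℝ (E x)] (A : Cocycle T E),
        (∀ x, Module.finrank ℝ (E x) = d) →
        IsBoundedBy A K →
        L ≤ Nat.card X →
        ¬ HasDominatedSplitting A L →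
        ∀ σ ∈ convexGraphs d,
          lyapunovGraph d hT A ≤ σ →
          σ (Fin.last d) = lyapunovGraph d hT A (Fin.last d) →
          ∃ P : unitInterval → Cocycle T E,
            IsPath P ∧ IsShort P ε ∧ P 0 = A ∧
            IsNondecreasingPath (fun t => lyapunovGraph d hT (P t)) ∧
            lyapunovGraph d hT (P 1) = σ := by
  have hK0 : 0 < K := by linarith
  obtain ⟨L, H⟩ := FibreCocycle.exists_pathTo_of_not_splits d K (min ε (1 / (2 * K))) hK.le
    (by positivity)
  -- The statement on constant fibres holds for every time `N ≥ L`, in particular for the power of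
  -- two `2 ^ L`.
  refine ⟨2 ^ L, ⟨L, rfl⟩, ?_⟩
  intro X _ _ T hT E _ _ _ A hE hA hcard hS σ hσ hle hlast
  have := Fintype.ofFinite X
  rw [Nat.card_eq_fintype_card] at hcard
  have hL : L ≤ 2 ^ L := Nat.lt_two_pow_self.le
  exact FibreCocycle.exists_path_of_pathTo hK.le hT (fun x =>
    ((stdOrthonormalBasis ℝ (E x)).reindex (finCongr (hE x))).repr) hA hσ hle hlast
    fun Λ Λ' hΛ hΛ' hD hd => H X T hT _ (FibreCocycle.bdd_model _ A hK0 hA) (hL.trans hcard) _ hL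
      (fun h => hS (FibreCocycle.hasDominatedSplitting_of_splits _ A hT hK0 hA h)) Λ Λ' hΛ hΛ' hD hd
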